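/- **Setting.** A stochastic shortest path (SSP) instance consists of a measurable state space $\mathcal S$ (possibly infinite; a countable one carries the discrete $\sigma$-algebra), a goal state $g\notin\mathcal S$ with $\mathcal S_+=\mathcal S\cup\{g\}$, a finite action set $\mathcal A$, an initial state $s_{\rm init}\in\mathcal S$, a cost function $c:\mathcal S\times\mathcal A\to[c_{\min},1]$ with $c_{\min}>0$, and transition laws $P_{s,a}$ on $\mathcal S_+$. A stationary policy $\pi:\mathcal S\to\mathcal A$ is proper if it reaches $g$ with probability one from every state; $V^\pi(s)$ and $T^\pi(s)$ are its expected total cost and expected number of steps until $g$ is reached from $s$. Let $\pi^\star$ be an optimal proper policy, i.e. a proper policy with $V^{\pi^\star}(s)\le V^\pi(s)$ for all proper $\pi$ and all $s$; put $V^\star=V^{\pi^\star}$, $B_\star=\sup_sV^\star(s)$, $T_\star=\sup_sT^{\pi^\star}(s)$, and assume $B_\star>1$ and $T_\star<\infty$. The instance is linear: for some $d\ge2$ there are a known feature map $\phi:\mathcal S\times\mathcal A\to\mathbb R^d$, an unknown $\theta^\star\in\mathbb R^d$ and an unknown $\mathbb R^d$-valued measure $\mu$ on $\mathcal S_+$ with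 $c(s,a)=\phi(s,a)^\top\theta^\star$, $P_{s,a}(E)=\phi(s,a)^\top\mu(E)$ for measurable $E$, $\|\phi(s,a)\|_2\le1$, $\|\theta^\star\|_2\le\sqrt d$, and $\|\int h\,d\mu\|_2\le\sqrt d\,\|h\|_\infty$ for every bounded measurable $h:\mathcal S_+\to\mathbb R$. Put $\phi(g,a)=0$. **Algorithm.** Let $K\ge2$ be the number of episodes, $\delta\in(0,1)$, $H=\lceil4T_\star\ln(4K)\rceil$, $B=3B_\star$, and terminal cost $c_f(s)=2B_\star$ for $s\in\mathcal S$, $c_f(g)=0$. Time is divided into intervals $m=1,2,\dots$ of $H$ layers. Interval $1$ starts in $s^1_1=s_{\rm init}$. In layer $h$ of interval $m$ the learner takes an action $a^m_h$ in $s^m_h$; if $s^m_h\ne g$ it pays $c^m_h=c(s^m_h,a^m_h)$ and moves to $s^m_{h+1}\sim P_{s^m_h,a^m_h}$, and if $s^m_h=g$ then $c^m_h=0$ and $s^m_{h+1}=g$. The next interval starts in $s^m_{H+1}$ if this is not $g$, and otherwise a new episode begins, in $s_{\rm init}$; the process stops once $K$ episodes are completed. In interval $m$, with $\phi^{m'}_{h'}=\phi(s^{m'}_{h'},a^{m'}_{h'})$,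 let $$\Lambda_m=I+\sum_{m'<m}\sum_{h'=1}^H\phi^{m'}_{h'}{\phi^{m'}_{h'}}^\top,\qquad \beta_m=50\,dB\sqrt{\ln(16BmHd/\delta)},\qquad V^m_{H+1}=c_f,$$ and for $h=H,\dots,1$ $$w^m_h=\Lambda_m^{-1}\sum_{m'<m}\sum_{h'=1}^H\phi^{m'}_{h'}\bigl(c^{m'}_{h'}+V^m_{h+1}(s^{m'}_{h'+1})\bigr),\qquad \widehat Q^m_h(s,a)=\phi(s,a)^\top w^m_h-\beta_m\|\phi(s,a)\|_{\Lambda_m^{-1}},$$ $$Q^m_h(s,a)=\min\{\max\{\widehat Q^m_h(s,a),0\},B\},\qquad V^m_h(s)=\min_aQ^m_h(s,a).$$ The action is $a^m_h\in\arg\min_aQ^m_h(s^m_h,a)$, ties being broken in any way that does not look into the future. **Regret.** Let $T$ be the total number of steps taken outside $g$, and let $R_K=\sum_{t=1}^Tc(s_t,a_t)-K\,V^\star(s_{\rm init})$, the sum running over these steps, with $R_K=\infty$ if $T=\infty$. **Theorem.** (i) There are absolute constants $C>0$ and $q\in\mathbb N$ such that for every linear SSP instance, every $K\ge2$ and every $\delta\in(0,1)$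 as above, with probability at least $1-2\delta$, $$R_K\le C\Bigl(\sqrt{d^3B_\star^2T_\star K}+d^3B_\star T_\star\Bigr)\ln^q\frac{dB_\star T_\star K}{\delta}.$$ (ii) The algorithm is computationally efficient: there are absolute constants $C,q\in\mathbb N$ such that, in every layer $h$ of every interval $m$ (for any horizon $H$ and any inputs $B$, $c_f$, $\delta$), all values $Q^m_h(s^m_h,a)$, $a\in\mathcal A$, are computed from the observed features, costs and goal indicators by a straight-line program with at most $C\,(d\,|\mathcal A|\,H\,m)^q$ instructions (reading an input, loading a constant, $+,-,\times,/,\sqrt{\cdot},\min,\max$), independently of the size of $\mathcal S$. -/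

import Mathlib

open MeasureTheory ProbabilityTheory Filter Topology

universe u v w

noncomputable section

/-! ## Stochastic shortest path instances

The non-goal states form the measurable space `S`; `Option S` is the state space together with the
goal, the goal state being `none`. -/

/-- The disjoint-union sigma-algebra: a set is measurable iff its trace on `S` is measurable. -/
instance optionMeasurableSpace {S : Type u} [MeasurableSpace S] : MeasurableSpace (Option S) :=
  MeasurableSpace.map some inferInstance

/-- An instance of the stochastic shortest path problem with strictly positive costs. -/
structure SSP (S : Type u) (A : Type v) [MeasurableSpace S] where
  /-- the initial state -/
  init : S
  /-- the cost function -/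
  cost : S → A → ℝ
  /-- a global lower bound of the costs -/
  cmin : ℝ
  cmin_pos : 0 < cmin
  cost_mem : ∀ s a, cost s a ∈ Set.Icc cmin 1
  /-- the transition function: for each action a Markov kernel from states to states or goal -/
  trans : A → Kernel S (Option S)
  isMarkov : ∀ a, IsMarkovKernel (trans a)

namespace SSP

variable {S : Type u} {A : Type v} [MeasurableSpace S]

/-- Transition law extended to the goal, which is absorbing. -/
def step (M : SSP S A) (a : A) : Option S → Measure (Option S)
  | none => Measure.dirac none
  | some s => M.trans a s

/-- Cost function extended to the goal, where it vanishes. -/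
def stepCost (M : SSP S A) : Option S → A → ℝ
  | none, _ => 0
  | some s, a => M.cost s a

/-- One step of the chain obtained by following the stationary policy `π`, absorbed at the goal. -/
def policyStep (M : SSP S A) (π : S → A) : Option S → Measure (Option S)
  | none => Measure.dirac none
  | some s => M.trans (π s) s

/-- The law of the state after `n` steps when following `π` from `s`, absorbed at the goal. -/
def law (M : SSP S A) (π : S → A) (s : S) : ℕ → Measure (Option S)
  | 0 => Measure.dirac (some s)
  | n + 1 => (M.law π s n).bind (M.policyStep π)

/-- The cost of one step of `π`; no cost is incurred at the goal. -/
def policyCost (M : SSP S A) (π : S → A) : Option S → ENNReal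
  | none => 0
  | some s => ENNReal.ofReal (M.cost s (π s))

/-- The policy `π` reaches the goal with probability one from every state. (Since the goal is
absorbing, the mass of the goal after `n` steps is the probability that it is reached by then.) -/
def IsProper (M : SSP S A) [MeasurableSpace A] (π : S → A) : Prop :=
  Measurable π ∧ ∀ s, Tendsto (fun n => M.law π s n {none}) atTop (𝓝 1)

/-- `V^π(s)`: the expected total cost until the goal is reached. -/
def value (M : SSP S A) (π : S → A) (s : S) : ENNReal :=
  ∑' n, ∫⁻ x, M.policyCost π x ∂(M.law π s n)

/-- `T^π(s)`: the expected number of steps until the goal is reached, that is, the sum over `n` of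
the probability that the goal has not been reached after `n` steps. -/
def hittingTime (M : SSP S A) (π : S → A) (s : S) : ENNReal :=
  ∑' n, M.law π s n {none}ᶜ

/-- `π` is proper and its value function is minimal among proper policies at every state. -/
def IsOptimalProper (M : SSP S A) [MeasurableSpace A] (π : S → A) : Prop :=
  M.IsProper π ∧ ∀ π', M.IsProper π' → ∀ s, M.value π s ≤ M.value π' s

/-- The largest expected cost of `π` over all starting states. -/
def maxValue (M : SSP S A) (π : S → A) : ENNReal := ⨆ s, M.value π s

/-- The largest expected hitting time of `π` over all starting states. -/
def maxHittingTime (M : SSP S A) (π : S → A) : ENNReal := ⨆ s, M.hittingTime π s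

/-- The linear structure of costs and transitions with respect to the feature map `φ`; `μ` is a
vector-valued measure on the states and the goal. -/
def IsLinear (M : SSP S A) {d : ℕ} (φ : S → A → EuclideanSpace ℝ (Fin d)) : Prop :=
  (∀ a, Measurable fun s => φ s a) ∧ (∀ s a, ‖φ s a‖ ≤ 1) ∧
  ∃ (θ : EuclideanSpace ℝ (Fin d)) (μ : VectorMeasure (Option S) (EuclideanSpace ℝ (Fin d))),
    ‖θ‖ ≤ √d ∧
    (∀ s a, M.cost s a = inner ℝ (φ s a) θ) ∧
    (∀ s a, ∀ E : Set (Option S), MeasurableSet E →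
      (M.trans a s).real E = inner ℝ (φ s a) (μ E)) ∧
    (∀ h : Option S → ℝ, Measurable h → ∀ b : ℝ, (∀ x, |h x| ≤ b) →
      ‖μ.integral h (ContinuousLinearMap.lsmul ℝ ℝ)‖ ≤ √d * b)

end SSP

/-! ## The optimistic linear finite-horizon algorithm

Intervals `m`, layers `h`, are numbered from `0`: an interval has the states `state m 0, …,
state m H`, and the actions and costs `action m h`, `cost m h` with `h < H`. -/

/-- A record of the interaction: what the learner observes. -/
structure Record (S : Type u) (A : Type v) where
  state : ℕ → ℕ → Option S
  action : ℕ → ℕ → A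
  cost : ℕ → ℕ → ℝ

/-- Inputs of the finite-horizon algorithm: the horizon `H`, the truncation level `B`, the terminal
cost `cf` of every non-goal state, and the confidence parameter `δ`. -/
structure FHParams where
  H : ℕ
  B : ℝ
  cf : ℝ
  δ : ℝ

namespace FHSSP

variable {S : Type u} {A : Type v} {d : ℕ}

/-- Features extended by zero to the goal. -/
def feature (φ : S → A → EuclideanSpace ℝ (Fin d)) : Option S → A → Fin d → ℝ
  | none, _ => 0
  | some s, a => (φ s a).ofLp

/-- Terminal cost; the goal has none. -/
def terminalCost (p : FHParams) : Option S → ℝ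
  | none => 0
  | some _ => p.cf

/-- The feature vector of the state and action in layer `h` of interval `m`. -/
def visited (φ : S → A → EuclideanSpace ℝ (Fin d)) (r : Record S A) (m h : ℕ) : Fin d → ℝ :=
  feature φ (r.state m h) (r.action m h)

/-- The regularized Gram matrix of the features visited before interval `m`. -/
def gram (φ : S → A → EuclideanSpace ℝ (Fin d)) (p : FHParams) (r : Record S A) (m : ℕ) :
    Matrix (Fin d) (Fin d) ℝ :=
  1 + ∑ m' ∈ Finset.range m, ∑ h ∈ Finset.range p.H,
    Matrix.vecMulVec (visited φ r m' h) (visited φ r m' h)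

/-- The bonus coefficient in interval `m` (which is the interval number `m + 1`). -/
def beta (d : ℕ) (p : FHParams) (m : ℕ) : ℝ :=
  50 * d * p.B * √(Real.log (16 * p.B * (m + 1 : ℕ) * p.H * d / p.δ))

/-- The ridge regression estimate for the continuation value function `V`. -/
def weight (φ : S → A → EuclideanSpace ℝ (Fin d)) (p : FHParams) (r : Record S A) (m : ℕ)
    (V : Option S → ℝ) : Fin d → ℝ :=
  Matrix.mulVec (gram φ p r m)⁻¹ (∑ m' ∈ Finset.range m, ∑ h ∈ Finset.range p.H,
    (r.cost m' h + V (r.state m' (h + 1))) • visited φ r m' h)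

/-- The optimistic estimate of the action values for the continuation value function `V`, before
truncation: estimate minus bonus. -/
def rawQ (φ : S → A → EuclideanSpace ℝ (Fin d)) (p : FHParams) (r : Record S A) (m : ℕ)
    (V : Option S → ℝ) (x : Option S) (a : A) : ℝ :=
  dotProduct (feature φ x a) (weight φ p r m V)
    - beta d p m * √(dotProduct (feature φ x a)
        (Matrix.mulVec (gram φ p r m)⁻¹ (feature φ x a)))

/-- The estimate of the action values, truncated to `[0, B]`. -/
def truncQ (φ : S → A → EuclideanSpace ℝ (Fin d)) (p : FHParams) (r : Record S A) (m : ℕ)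
    (V : Option S → ℝ) (x : Option S) (a : A) : ℝ :=
  min (max (rawQ φ p r m V x a) 0) p.B

/-- The estimated value function in interval `m` when `j` layers remain. -/
def valueToGo [Fintype A] [Nonempty A] (φ : S → A → EuclideanSpace ℝ (Fin d)) (p : FHParams)
    (r : Record S A) (m : ℕ) : ℕ → Option S → ℝ
  | 0 => terminalCost p
  | j + 1 => fun x =>
      Finset.univ.inf' Finset.univ_nonempty (truncQ φ p r m (valueToGo φ p r m j) x)

/-- The estimated action values in layer `h` of interval `m`, for `h < H`. -/
def Q [Fintype A] [Nonempty A] (φ : S → A → EuclideanSpace ℝ (Fin d)) (p : FHParams)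
    (r : Record S A) (m h : ℕ) : Option S → A → ℝ :=
  truncQ φ p r m (valueToGo φ p r m (p.H - (h + 1)))

end FHSSP

/-! ## Running the finite-horizon approximation -/

/-- The random states and actions of a run. -/
structure Trajectory (S : Type u) (A : Type v) (Ω : Type w) where
  state : ℕ → ℕ → Ω → Option S
  action : ℕ → ℕ → Ω → A

namespace Trajectory

variable {S : Type u} {A : Type v} {Ω : Type w} [MeasurableSpace S]

/-- What the learner sees when the trajectory is realized in `M`: states, actions and costs. -/
def record (X : Trajectory S A Ω) (M : SSP S A) (ω : Ω) : Record S A where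
  state m h := X.state m h ω
  action m h := X.action m h ω
  cost m h := M.stepCost (X.state m h ω) (X.action m h ω)

open Classical in
/-- The number of intervals before interval `m` that end in the goal. As long as it is less than
`K`, this is the number of completed episodes. -/
def episodesDone (X : Trajectory S A Ω) (H m : ℕ) (ω : Ω) : ℕ :=
  ((Finset.range m).filter fun m' => X.state m' H ω = none).card

open Classical in
/-- `T`, the number of steps taken outside the goal. -/
def totalSteps (X : Trajectory S A Ω) (H : ℕ) (ω : Ω) : ENNReal :=
  ∑' m, ∑ h ∈ Finset.range H, if X.state m h ω = none then 0 else 1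

/-- The total cost of all steps. -/
def totalCost (X : Trajectory S A Ω) (M : SSP S A) (H : ℕ) (ω : Ω) : ENNReal :=
  ∑' m, ∑ h ∈ Finset.range H, ENNReal.ofReal (M.stepCost (X.state m h ω) (X.action m h ω))

open Classical in
/-- The regret over `K` episodes against the policy `π`; it is infinite if the number of steps is
infinite. -/
def regret (X : Trajectory S A Ω) (M : SSP S A) (π : S → A) (H K : ℕ) (ω : Ω) : EReal :=
  if X.totalSteps H ω = ⊤ then ⊤
  else (X.totalCost M H ω : EReal) - (K : EReal) * (M.value π M.init : EReal)

end Trajectory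

/-- `X` is a run over `K` episodes in `M` of the finite-horizon approximation that uses the
optimistic linear finite-horizon algorithm with inputs `p`. Layer `h` of interval `m` happens at
time `m * H + h` of the filtration `ℱ`.

Every interval consists of `H` layers; after the goal is reached, the rest of the interval is spent
in the goal at no cost. The next interval starts in the last state of the previous one or, if that
is the goal, in the initial state (a new episode). Once `K` episodes are completed, the process
stays in the goal, so nothing happens any more. -/
structure IsRun {S : Type u} {A : Type v} {Ω : Type w} [MeasurableSpace S] [MeasurableSpace A]
    [Fintype A] [Nonempty A] {mΩ : MeasurableSpace Ω} {d : ℕ} (M : SSP S A)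
    (φ : S → A → EuclideanSpace ℝ (Fin d)) (p : FHParams) (K : ℕ)
    (P : Measure Ω) (ℱ : Filtration ℕ mΩ) (X : Trajectory S A Ω) : Prop where
  measurable_state : ∀ m h, h ≤ p.H → Measurable[ℱ (m * p.H + h)] (X.state m h)
  measurable_action : ∀ m h, h < p.H → Measurable[ℱ (m * p.H + h)] (X.action m h)
  /-- The first interval starts in the initial state. -/
  start : ∀ ω, X.state 0 0 ω = some M.init
  /-- Passage to the next interval when the goal has not been reached. -/
  resume : ∀ m ω, X.state m p.H ω ≠ none → X.state (m + 1) 0 ω = X.state m p.H ω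
  /-- Passage to the next interval, and the next episode, when the goal has been reached. -/
  restart : ∀ m ω, X.state m p.H ω = none →
    X.state (m + 1) 0 ω = if X.episodesDone p.H (m + 1) ω < K then some M.init else none
  /-- Given the past, the next state follows the transition law at the current state and action. -/
  transition : ∀ m h, h < p.H → ∀ E : Set (Option S), MeasurableSet E →
    P[fun ω => E.indicator (fun _ => (1 : ℝ)) (X.state m (h + 1) ω) | ℱ (m * p.H + h)]
      =ᵐ[P] fun ω => (M.step (X.action m h ω) (X.state m h ω)).real E
  /-- The action minimizes the estimated action values (ties are broken in any way). -/
  greedy : ∀ m h, h < p.H → ∀ ω a,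
    FHSSP.Q φ p (X.record M ω) m h (X.state m h ω) (X.action m h ω)
      ≤ FHSSP.Q φ p (X.record M ω) m h (X.state m h ω) a

/-- The inputs that the finite-horizon approximation uses for an instance whose optimal policy `π`
has largest expected cost `B⋆` and largest hitting time `T⋆`: horizon `⌈4 T⋆ ln (4K)⌉`, truncation
level `3 B⋆` and terminal cost `2 B⋆`. -/
def fhParams {S : Type u} {A : Type v} [MeasurableSpace S] (M : SSP S A) (π : S → A) (K : ℕ)
    (δ : ℝ) : FHParams where
  H := ⌈4 * (M.maxHittingTime π).toReal * Real.log (4 * K)⌉₊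
  B := 3 * (M.maxValue π).toReal
  cf := 2 * (M.maxValue π).toReal
  δ := δ

/-! ## Counting arithmetic operations -/

/-- `StraightLine I n R`: there is a straight-line program of `n` instructions whose registers, as
functions of the data, hold the functions in `R`. An instruction reads one of the inputs in `I`,
loads a constant, or applies an arithmetic operation to registers that were computed before. -/
inductive StraightLine {D : Type w} (I : Set (D → ℝ)) : ℕ → Set (D → ℝ) → Prop
  | nil : StraightLine I 0 ∅
  | read {n R f} : StraightLine I n R → f ∈ I → StraightLine I (n + 1) (insert f R)
  | const {n R} (c : ℝ) : StraightLine I n R → StraightLine I (n + 1) (insert (fun _ => c) R)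
  | add {n R f g} : StraightLine I n R → f ∈ R → g ∈ R →
      StraightLine I (n + 1) (insert (fun x => f x + g x) R)
  | sub {n R f g} : StraightLine I n R → f ∈ R → g ∈ R →
      StraightLine I (n + 1) (insert (fun x => f x - g x) R)
  | mul {n R f g} : StraightLine I n R → f ∈ R → g ∈ R →
      StraightLine I (n + 1) (insert (fun x => f x * g x) R)
  | div {n R f g} : StraightLine I n R → f ∈ R → g ∈ R →
      StraightLine I (n + 1) (insert (fun x => f x / g x) R)
  | sqrt {n R f} : StraightLine I n R → f ∈ R → StraightLine I (n + 1) (insert (fun x => √(f x)) R)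
  | min {n R f g} : StraightLine I n R → f ∈ R → g ∈ R →
      StraightLine I (n + 1) (insert (fun x => Min.min (f x) (g x)) R)
  | max {n R f g} : StraightLine I n R → f ∈ R → g ∈ R →
      StraightLine I (n + 1) (insert (fun x => Max.max (f x) (g x)) R)

open Classical in
/-- The numbers available to the learner in layer `h` of interval `m`, as functions of the record:
the features of the states visited so far (for all actions, and for the actions taken in previous
intervals), which of these states are the goal, and the costs observed in previous intervals. -/
def observations {S : Type u} {A : Type v} {d : ℕ} (φ : S → A → EuclideanSpace ℝ (Fin d))
    (H m h : ℕ) : Set (Record S A → ℝ) :=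
  {f | ∃ m' h', ((m' < m ∧ h' ≤ H) ∨ (m' = m ∧ h' ≤ h)) ∧
      ((∃ a i, f = fun r => FHSSP.feature φ (r.state m' h') a i) ∨
        f = fun r => if r.state m' h' = none then 1 else 0)} ∪
  {f | ∃ m' h', m' < m ∧ h' < H ∧
      ((∃ i, f = fun r => FHSSP.visited φ r m' h' i) ∨ f = fun r => r.cost m' h')}

end

/-! Write `b` for the largest value of the comparator `π`. The run is cut into intervals of `H`
layers, each treated as a finite-horizon problem with terminal cost `2 * b` off the goal. Three
facts carry the regret bound.

Confidence. In a linear instance, cost plus expected continuation value is linear in the features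
(`SSP.exists_weight`), so Bellman backups can be learned by ridge regression. For a fixed
continuation function the regression error is a self-normalized martingale, controlled by an
exponential supermartingale built from the rank-one updates of the inverse Gram matrix
(`IsRun.measure_form_noiseSum_le`). The functions actually used depend on the data, so a union bound
is taken over a finite net of the `d + d * d` parameters of a value function
(`FHSSP.exists_mem_net`). Outside an event of probability `δ`, all estimates are correct up to the
bonus (`IsRun.measure_not_confident_le`).

Interval regret. On the good event the estimates lie below the finite-horizon values of `π`
(`Trajectory.Confident.ofReal_valueToGo_le`), and these lie strictly below `3 * b`, with `cmin` to
spare (`SSP.horizonValue_add_le`). So the upper truncation never acts on the estimated values, and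
the Bellman gap at the action played is at most twice the bonus. The Gram matrix is frozen during an
interval. Either its log-determinant grows by at most `1 / 2` there, and the frozen bonus is
comparable to the up-to-date one, or the trivial bound on the gaps is charged to the growth. The
total growth is of order `d` up to a logarithm (`Ridge.sum_gain_le`). With Azuma's inequality for
the noise, `n` intervals have regret of order `√n` plus a lower-order term
(`Trajectory.Confident.sum_interval_le`).

Number of intervals. Within `H` steps `π` misses the goal with probability at most `1 / (2 * K)`
(`SSP.survival_horizon_le`), so estimates at the start of an interval are at most `3 / 2 * b`,
whereas an interval that misses the goal is charged `2 * b`. Hence the regret also grows linearly in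
`n` (`Trajectory.mul_le_sum_interval`). Comparison with the upper bound limits `n` to order `K + d ^
3 * H` up to logarithms, which also shows that all episodes end. The terminal cost of an interval
pays for the initial estimate of the next one, so that only `K` initial estimates remain to be
compared with the optimal value (`IsRun.sum_sub_terminalCost_le`).

Efficiency holds because the inverse is computed by rank-one updates and backward induction
evaluates value functions only at states already seen (`FHSSP.exists_straightLine`). -/

noncomputable section

open Matrix

/-! ## Ridge regression: rank-one updates -/

namespace Ridge

variable {n : Type*} [Fintype n] [DecidableEq n]

/-- Regularized Gram matrix of the first `t` vectors of a sequence. -/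
def gram (v : ℕ → n → ℝ) (t : ℕ) : Matrix n n ℝ :=
  1 + ∑ s ∈ Finset.range t, vecMulVec (v s) (v s)

/-- The inverse of the Gram matrix, computed by rank-one updates. -/
def inv (v : ℕ → n → ℝ) : ℕ → Matrix n n ℝ
  | 0 => 1
  | t + 1 => inv v t - (1 + v t ⬝ᵥ inv v t *ᵥ v t)⁻¹ •
      vecMulVec (inv v t *ᵥ v t) (inv v t *ᵥ v t)

/-- The quadratic form of the inverse Gram matrix. -/
def form (v : ℕ → n → ℝ) (t : ℕ) (x : n → ℝ) : ℝ := x ⬝ᵥ inv v t *ᵥ x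

variable (v : ℕ → n → ℝ)

lemma inv_transpose (t : ℕ) : (inv v t)ᵀ = inv v t := by
  induction t with
  | zero => simp [inv]
  | succ t ih => simp [inv, ih, transpose_vecMulVec]

lemma dotProduct_inv_comm (t : ℕ) (x y : n → ℝ) :
    x ⬝ᵥ inv v t *ᵥ y = y ⬝ᵥ inv v t *ᵥ x := by
  rw [dotProduct_mulVec, ← mulVec_transpose, inv_transpose, dotProduct_comm]

lemma dotProduct_inv_succ (t : ℕ) (x y : n → ℝ) :
    x ⬝ᵥ inv v (t + 1) *ᵥ y = x ⬝ᵥ inv v t *ᵥ y -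
      (v t ⬝ᵥ inv v t *ᵥ x) * (v t ⬝ᵥ inv v t *ᵥ y) / (1 + form v t (v t)) := by
  rw [inv, sub_mulVec, smul_mulVec, vecMulVec_mulVec, dotProduct_sub, dotProduct_smul,
    dotProduct_comm (inv v t *ᵥ v t) y, dotProduct_inv_comm v t y]
  simp only [form, op_smul_eq_smul, dotProduct_smul, smul_eq_mul, div_eq_inv_mul]
  rw [dotProduct_inv_comm v t x (v t)]
  ring

lemma form_smul (t : ℕ) (c : ℝ) (x : n → ℝ) : form v t (c • x) = c ^ 2 * form v t x := by
  simp only [form, mulVec_smul, dotProduct_smul, smul_dotProduct, smul_eq_mul]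
  ring

lemma form_add (t : ℕ) (x y : n → ℝ) :
    form v t (x + y) = form v t x + 2 * (x ⬝ᵥ inv v t *ᵥ y) + form v t y := by
  simp only [form, mulVec_add, dotProduct_add, add_dotProduct, dotProduct_inv_comm v t y x]
  ring

lemma form_succ (t : ℕ) (x : n → ℝ) :
    form v (t + 1) x =
      form v t x - (v t ⬝ᵥ inv v t *ᵥ x) ^ 2 / (1 + form v t (v t)) := by
  rw [form, dotProduct_inv_succ, ← form]
  ring

/-- Cauchy–Schwarz through the discriminant of `c ↦ form v t (c • x + y)`. Nonnegativity is a
hypothesis because the lemma is needed inside the induction that proves it. -/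
lemma sq_dotProduct_inv_le_of_nonneg {t : ℕ} (h : ∀ x, 0 ≤ form v t x) (x y : n → ℝ) :
    (x ⬝ᵥ inv v t *ᵥ y) ^ 2 ≤ form v t x * form v t y := by
  have key : ∀ c : ℝ, 0 ≤ form v t x * (c * c) + (2 * (x ⬝ᵥ inv v t *ᵥ y)) * c + form v t y := by
    intro c
    have := h (c • x + y)
    rw [form_add, form_smul, smul_dotProduct, smul_eq_mul] at this
    linarith
  have := discrim_le_zero key
  rw [discrim] at this
  linarith

/-- The term subtracted in a rank-one update is dominated by the previous form, by Cauchy–Schwarz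
for that form. -/
lemma form_nonneg (t : ℕ) (x : n → ℝ) : 0 ≤ form v t x := by
  induction t generalizing x with
  | zero =>
    simp only [form, inv, one_mulVec]
    exact Finset.sum_nonneg fun i _ => mul_self_nonneg _
  | succ t ih =>
    rw [form_succ, sub_nonneg, div_le_iff₀ (by linarith [ih (v t)])]
    have := sq_dotProduct_inv_le_of_nonneg v ih (v t) x
    nlinarith [ih x]

lemma sq_dotProduct_inv_le (t : ℕ) (x y : n → ℝ) :
    (x ⬝ᵥ inv v t *ᵥ y) ^ 2 ≤ form v t x * form v t y :=
  sq_dotProduct_inv_le_of_nonneg v (form_nonneg v t) x y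

lemma abs_dotProduct_inv_le (t : ℕ) (x y : n → ℝ) :
    |x ⬝ᵥ inv v t *ᵥ y| ≤ √(form v t x) * √(form v t y) := by
  rw [← Real.sqrt_mul (form_nonneg v t x)]
  exact Real.abs_le_sqrt (sq_dotProduct_inv_le v t x y)

lemma form_add_le (t : ℕ) (x y : n → ℝ) :
    form v t (x + y) ≤ 2 * form v t x + 2 * form v t y := by
  have h1 := form_add v t x y
  have h2 := form_add v t x ((-1 : ℝ) • y)
  have h3 := form_nonneg v t (x + (-1 : ℝ) • y)
  rw [form_smul, mulVec_smul, dotProduct_smul, smul_eq_mul] at h2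
  linarith

lemma form_antitone (x : n → ℝ) : Antitone fun t => form v t x := by
  refine antitone_nat_of_succ_le fun t => ?_
  rw [form_succ]
  have : 0 ≤ (v t ⬝ᵥ inv v t *ᵥ x) ^ 2 / (1 + form v t (v t)) :=
    div_nonneg (sq_nonneg _) (by linarith [form_nonneg v t (v t)])
  linarith

lemma form_le (t : ℕ) (x : n → ℝ) : form v t x ≤ x ⬝ᵥ x := by
  have := form_antitone v x (Nat.zero_le t)
  simpa [form, inv] using this

lemma inv_apply_eq (t : ℕ) (i j : n) :
    inv v t i j = Pi.single i 1 ⬝ᵥ inv v t *ᵥ Pi.single j 1 := by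
  simp

lemma abs_inv_apply_le (t : ℕ) (i j : n) : |inv v t i j| ≤ 1 := by
  rw [inv_apply_eq]
  have h : ∀ i : n, √(form v t (Pi.single i 1)) ≤ 1 := fun i => by
    rw [Real.sqrt_le_one]
    simpa using form_le v t (Pi.single i 1)
  exact (abs_dotProduct_inv_le v t _ _).trans (mul_le_one₀ (h i) (Real.sqrt_nonneg _) (h j))

/-- How the quadratic form of a weighted sum of the vectors grows in one step. -/
lemma form_succ_add_smul (t : ℕ) (x : n → ℝ) (c : ℝ) :
    form v (t + 1) (x + c • v t) = form v t x
      + (2 * c * (v t ⬝ᵥ inv v t *ᵥ x) - (v t ⬝ᵥ inv v t *ᵥ x) ^ 2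
        + c ^ 2 * form v t (v t)) / (1 + form v t (v t)) := by
  have h : 0 < 1 + form v t (v t) := by linarith [form_nonneg v t (v t)]
  rw [form_succ, form_add, form_smul, mulVec_smul, mulVec_add, mulVec_smul, dotProduct_add,
    dotProduct_smul, dotProduct_smul, smul_eq_mul, smul_eq_mul, dotProduct_inv_comm v t x, ← form]
  field_simp
  ring

/-- Again Cauchy–Schwarz, now bounding from below what an update leaves over. Iterated in
`form_le_exp_mul`, it compares the frozen norm of an interval with the current one. -/
lemma form_le_succ (t : ℕ) (x : n → ℝ) :
    form v t x ≤ (1 + form v t (v t)) * form v (t + 1) x := by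
  have h : 0 < 1 + form v t (v t) := by linarith [form_nonneg v t (v t)]
  have h2 := sq_dotProduct_inv_le v t (v t) x
  rw [form_succ, mul_sub, mul_div_cancel₀ _ h.ne']
  linarith

/-- The growth of the logarithm of the determinant of the Gram matrix in one step. -/
def gain (t : ℕ) : ℝ := Real.log (1 + form v t (v t))

lemma gain_nonneg (t : ℕ) : 0 ≤ gain v t :=
  Real.log_nonneg (by linarith [form_nonneg v t (v t)])

lemma exp_gain (t : ℕ) : Real.exp (gain v t) = 1 + form v t (v t) :=
  Real.exp_log (by linarith [form_nonneg v t (v t)])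

lemma form_le_exp_mul (s k : ℕ) (x : n → ℝ) :
    form v s x ≤ Real.exp (∑ i ∈ Finset.range k, gain v (s + i)) * form v (s + k) x := by
  induction k with
  | zero => simp
  | succ k ih =>
    rw [Finset.sum_range_succ, Real.exp_add, exp_gain, mul_assoc, ← add_assoc]
    exact ih.trans (mul_le_mul_of_nonneg_left (form_le_succ v (s + k) x) (Real.exp_nonneg _))

lemma gram_succ {n : Type*} [DecidableEq n] (v : ℕ → n → ℝ) (t : ℕ) :
    gram v (t + 1) = gram v t + vecMulVec (v t) (v t) := by
  rw [gram, gram, Finset.sum_range_succ, add_assoc]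

/-- The Sherman–Morrison formula. -/
lemma gram_mul_inv (t : ℕ) : gram v t * inv v t = 1 := by
  induction t with
  | zero => simp [gram, inv]
  | succ t ih =>
    have h : 1 + form v t (v t) ≠ 0 := by linarith [form_nonneg v t (v t)]
    have e1 : gram v t * vecMulVec (inv v t *ᵥ v t) (inv v t *ᵥ v t)
        = vecMulVec (v t) (inv v t *ᵥ v t) := by
      rw [mul_vecMulVec, mulVec_mulVec, ih, one_mulVec]
    have e2 : vecMulVec (v t) (v t) * inv v t = vecMulVec (v t) (inv v t *ᵥ v t) := by
      rw [vecMulVec_mul, ← mulVec_transpose, inv_transpose]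
    have e3 : vecMulVec (v t) (v t) * vecMulVec (inv v t *ᵥ v t) (inv v t *ᵥ v t)
        = form v t (v t) • vecMulVec (v t) (inv v t *ᵥ v t) := by
      rw [vecMulVec_mul_vecMulVec, form, vecMulVec_smul]
    rw [gram_succ, inv, ← form, add_mul, mul_sub, mul_sub, ih, mul_smul_comm, mul_smul_comm,
      e1, e2, e3, smul_smul]
    have : (1 + form v t (v t))⁻¹ * form v t (v t) = 1 - (1 + form v t (v t))⁻¹ := by
      field_simp; ring
    rw [this, sub_smul, one_smul]
    abel

lemma inv_eq (t : ℕ) : (gram v t)⁻¹ = inv v t :=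
  Matrix.inv_eq_right_inv (gram_mul_inv v t)

lemma inv_mul_gram (t : ℕ) : inv v t * gram v t = 1 :=
  _root_.mul_eq_one_comm.mp (gram_mul_inv v t)

/-- The matrix determinant lemma: each update multiplies the determinant by `1 + form v t (v t)`. -/
lemma det_gram (t : ℕ) : (gram v t).det = Real.exp (∑ s ∈ Finset.range t, gain v s) := by
  induction t with
  | zero => simp [gram]
  | succ t ih =>
    have hu : IsUnit (gram v t).det := by
      rw [ih]; exact (Real.exp_pos _).ne'.isUnit
    rw [gram_succ, Finset.sum_range_succ, Real.exp_add, exp_gain, ← ih,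
      vecMulVec_eq Unit, det_add_replicateCol_mul_replicateRow hu, inv_eq]
    congr 1
    rw [det_unique, Matrix.add_apply, one_apply_eq, Matrix.mul_assoc, ← replicateCol_mulVec,
      replicateRow_mul_replicateCol_apply, form]

lemma gram_posSemidef (t : ℕ) : (gram v t).PosSemidef := by
  refine PosSemidef.add PosSemidef.one (posSemidef_sum _ fun s _ => ?_)
  simpa using posSemidef_vecMulVec_self_star (v s)

lemma trace_gram_le (hv : ∀ t, v t ⬝ᵥ v t ≤ 1) (t : ℕ) :
    (gram v t).trace ≤ Fintype.card n + t := by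
  rw [gram, trace_add, trace_one, trace_sum]
  gcongr
  calc _ ≤ ∑ s ∈ Finset.range t, (1 : ℝ) :=
        Finset.sum_le_sum fun s _ => by rw [trace_vecMulVec]; exact hv s
    _ = t := by simp

/-- The elliptical potential bound. The sum is a log-determinant, and every eigenvalue of a positive
semidefinite matrix is at most its trace, which grows by at most one per step. -/
lemma sum_gain_le (hv : ∀ t, v t ⬝ᵥ v t ≤ 1) (t : ℕ) :
    ∑ s ∈ Finset.range t, gain v s ≤ Fintype.card n * Real.log (Fintype.card n + t) := by
  rcases isEmpty_or_nonempty n with hn | hn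
  · have : ∀ s, gain v s = 0 := fun s => by simp [gain, form]
    simp [this]
  have hp := gram_posSemidef v t
  have h1 := hp.isHermitian.det_eq_prod_eigenvalues
  have h2 := hp.isHermitian.trace_eq_sum_eigenvalues
  simp only [RCLike.ofReal_real_eq_id, id_eq] at h1 h2
  have h3 : ∀ i, hp.isHermitian.eigenvalues i ≤ Fintype.card n + t := fun i =>
    ((Finset.single_le_sum (fun i _ => hp.eigenvalues_nonneg i) (Finset.mem_univ i)).trans
      h2.ge).trans (trace_gram_le v hv t)
  have h4 : (gram v t).det ≤ (Fintype.card n + t : ℝ) ^ Fintype.card n := by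
    rw [h1]
    refine (Finset.prod_le_prod (fun i _ => hp.eigenvalues_nonneg i) fun i _ => h3 i).trans ?_
    simp
  rw [← Real.log_pow, ← Real.log_exp (∑ s ∈ Finset.range t, gain v s), ← det_gram]
  exact Real.log_le_log (by rw [det_gram]; exact Real.exp_pos _) h4

end Ridge

end

/-! ### The regression of the algorithm in a single time index -/

noncomputable section

open Matrix

/-- Layer `h` of interval `m` is time `m * H + h`. This translates the double sums of the algorithm
into sums along the filtration. -/
lemma Finset.sum_range_mul_eq_sum_div_mod {β : Type*} [AddCommMonoid β] (f : ℕ → ℕ → β)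
    (m : ℕ) {H : ℕ} (hH : 0 < H) :
    ∑ t ∈ Finset.range (m * H), f (t / H) (t % H)
      = ∑ i ∈ Finset.range m, ∑ h ∈ Finset.range H, f i h := by
  induction m with
  | zero => simp
  | succ m ih =>
    rw [Nat.add_mul, one_mul, Finset.sum_range_add, Finset.sum_range_succ, ih]
    congr 1
    refine Finset.sum_congr rfl fun h hh => ?_
    have hh := Finset.mem_range.mp hh
    rw [mul_comm, Nat.mul_add_div hH, Nat.mul_add_mod, Nat.div_eq_of_lt hh, Nat.mod_eq_of_lt hh,
      add_zero]

namespace FHSSP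

variable {S : Type u} {A : Type v} {d : ℕ}

/-- The visited features, numbered consecutively. -/
def visitedSeq (φ : S → A → EuclideanSpace ℝ (Fin d)) (r : Record S A) (H t : ℕ) : Fin d → ℝ :=
  visited φ r (t / H) (t % H)

lemma gram_eq (φ : S → A → EuclideanSpace ℝ (Fin d)) (p : FHParams) (r : Record S A) (m : ℕ)
    (hH : 0 < p.H) : gram φ p r m = Ridge.gram (visitedSeq φ r p.H) (m * p.H) := by
  rw [gram, Ridge.gram, ← Finset.sum_range_mul_eq_sum_div_mod _ m hH]
  rfl

lemma gram_inv_eq (φ : S → A → EuclideanSpace ℝ (Fin d)) (p : FHParams) (r : Record S A) (m : ℕ)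
    (hH : 0 < p.H) : (gram φ p r m)⁻¹ = Ridge.inv (visitedSeq φ r p.H) (m * p.H) := by
  rw [gram_eq φ p r m hH, Ridge.inv_eq]

lemma weight_eq (φ : S → A → EuclideanSpace ℝ (Fin d)) (p : FHParams) (r : Record S A) (m : ℕ)
    (V : Option S → ℝ) (hH : 0 < p.H) :
    weight φ p r m V = Ridge.inv (visitedSeq φ r p.H) (m * p.H) *ᵥ
      ∑ t ∈ Finset.range (m * p.H),
        (r.cost (t / p.H) (t % p.H) + V (r.state (t / p.H) (t % p.H + 1))) •
          visitedSeq φ r p.H t := by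
  rw [weight, gram_inv_eq φ p r m hH, ← Finset.sum_range_mul_eq_sum_div_mod _ m hH]
  rfl

lemma rawQ_eq (φ : S → A → EuclideanSpace ℝ (Fin d)) (p : FHParams) (r : Record S A) (m : ℕ)
    (V : Option S → ℝ) (hH : 0 < p.H) (x : Option S) (a : A) :
    rawQ φ p r m V x a = feature φ x a ⬝ᵥ weight φ p r m V
      - beta d p m * √(Ridge.form (visitedSeq φ r p.H) (m * p.H) (feature φ x a)) := by
  rw [rawQ, gram_inv_eq φ p r m hH, Ridge.form]

end FHSSP

/-! ## Composition of straight-line programs -/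

/-- Any program that has computed `A` can be continued with at most `k` instructions that
compute `B`. -/
def Computes {D : Type w} (I A : Set (D → ℝ)) (k : ℕ) (B : Set (D → ℝ)) : Prop :=
  ∀ n R, StraightLine I n R → A ⊆ R →
    ∃ n' R', StraightLine I n' R' ∧ n' ≤ n + k ∧ R ⊆ R' ∧ B ⊆ R'

namespace Computes

variable {D : Type w} {I A B C : Set (D → ℝ)} {k l N : ℕ} {f g : D → ℝ}

lemma of_subset (h : B ⊆ A) : Computes I A 0 B :=
  fun n R hR hA => ⟨n, R, hR, le_rfl, subset_rfl, h.trans hA⟩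

lemma mem (h : f ∈ A) : Computes I A 0 {f} := of_subset (by simpa using h)

lemma mono_cost (h : Computes I A k B) (hk : k ≤ l) : Computes I A l B := fun n R hR hA => by
  obtain ⟨n', R', h1, h2, h3⟩ := h n R hR hA
  exact ⟨n', R', h1, by omega, h3⟩

lemma mono (h : Computes I A k B) {A' : Set (D → ℝ)} (hA' : A ⊆ A') : Computes I A' k B :=
  fun n R hR hA => h n R hR (hA'.trans hA)

lemma trans (h : Computes I A k B) (h' : Computes I (A ∪ B) l C) :
    Computes I A (k + l) (B ∪ C) := fun n R hR hA => by
  obtain ⟨n1, R1, h1, h2, h3, h4⟩ := h n R hR hA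
  obtain ⟨n2, R2, h5, h6, h7, h8⟩ := h' n1 R1 h1 (Set.union_subset (hA.trans h3) h4)
  exact ⟨n2, R2, h5, by omega, h3.trans h7, Set.union_subset (h4.trans h7) h8⟩

lemma union (h : Computes I A k B) (h' : Computes I A l C) : Computes I A (k + l) (B ∪ C) :=
  h.trans (h'.mono Set.subset_union_left)

lemma biUnion {ι : Type*} (s : Finset ι) {B : ι → Set (D → ℝ)}
    (h : ∀ i ∈ s, Computes I A k (B i)) : Computes I A (s.card * k) {f | ∃ i ∈ s, f ∈ B i} := by
  classical
  induction s using Finset.induction_on with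
  | empty => exact (of_subset (by simp)).mono_cost (Nat.zero_le _)
  | insert i s hi ih =>
    have := (ih fun j hj => h j (Finset.mem_insert_of_mem hj)).union
      (h i (Finset.mem_insert_self _ _))
    intro n R hR hA
    obtain ⟨n', R', h1, h2, h3, h4⟩ := this n R hR hA
    refine ⟨n', R', h1, ?_, h3, ?_⟩
    · rw [Finset.card_insert_of_notMem hi]; linarith
    · rintro f ⟨j, hj, hf⟩
      rcases Finset.mem_insert.mp hj with rfl | hj
      · exact h4 (Or.inr hf)
      · exact h4 (Or.inl ⟨j, hj, hf⟩)

lemma read (h : f ∈ I) : Computes I A 1 {f} := fun n R hR _ =>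
  ⟨n + 1, _, hR.read h, le_rfl, Set.subset_insert _ _, by simp⟩

lemma const (c : ℝ) : Computes I A 1 {fun _ => c} := fun n R hR _ =>
  ⟨n + 1, _, hR.const c, le_rfl, Set.subset_insert _ _, by simp⟩

lemma binary {op : ℝ → ℝ → ℝ}
    (hop : ∀ {n R} {f g : D → ℝ}, StraightLine I n R → f ∈ R → g ∈ R →
      StraightLine I (n + 1) (insert (fun x => op (f x) (g x)) R))
    (hf : Computes I A k {f}) (hg : Computes I A l {g}) :
    Computes I A (k + l + 1) {fun x => op (f x) (g x)} := fun n R hR hA => by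
  obtain ⟨n', R', h1, h2, h3, h4⟩ := hf.union hg n R hR hA
  refine ⟨n' + 1, _, hop h1 (h4 (Or.inl rfl)) (h4 (Or.inr rfl)), by omega,
    h3.trans (Set.subset_insert _ _), by simp⟩

lemma add (hf : Computes I A k {f}) (hg : Computes I A l {g}) :
    Computes I A (k + l + 1) {fun x => f x + g x} := binary StraightLine.add hf hg

lemma sub (hf : Computes I A k {f}) (hg : Computes I A l {g}) :
    Computes I A (k + l + 1) {fun x => f x - g x} := binary StraightLine.sub hf hg

lemma mul (hf : Computes I A k {f}) (hg : Computes I A l {g}) :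
    Computes I A (k + l + 1) {fun x => f x * g x} := binary StraightLine.mul hf hg

lemma div (hf : Computes I A k {f}) (hg : Computes I A l {g}) :
    Computes I A (k + l + 1) {fun x => f x / g x} := binary StraightLine.div hf hg

lemma inf (hf : Computes I A k {f}) (hg : Computes I A l {g}) :
    Computes I A (k + l + 1) {fun x => min (f x) (g x)} := binary StraightLine.min hf hg

lemma sup (hf : Computes I A k {f}) (hg : Computes I A l {g}) :
    Computes I A (k + l + 1) {fun x => max (f x) (g x)} := binary StraightLine.max hf hg

lemma sqrt (hf : Computes I A k {f}) : Computes I A (k + 1) {fun x => √(f x)} :=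
  fun n R hR hA => by
  obtain ⟨n', R', h1, h2, h3, h4⟩ := hf n R hR hA
  exact ⟨n' + 1, _, h1.sqrt (h4 rfl), by omega, h3.trans (Set.subset_insert _ _), by simp⟩

lemma sum {ι : Type*} (s : Finset ι) {f : ι → D → ℝ} (h : ∀ i ∈ s, Computes I A k {f i})
    (hs : s.card ≤ N) (hN : 1 ≤ N) : Computes I A (N * (k + 2)) {fun x => ∑ i ∈ s, f i x} := by
  classical
  -- The final `1` loads the empty sum; `1 ≤ N` absorbs it later.
  have key : Computes I A (s.card * (k + 1) + 1) {fun x => ∑ i ∈ s, f i x} := by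
    clear hs
    induction s using Finset.induction_on with
    | empty => simpa using const (I := I) (A := A) 0
    | insert i s hi ih =>
      simp only [Finset.sum_insert hi]
      refine ((h i (Finset.mem_insert_self _ _)).add
        (ih fun j hj => h j (Finset.mem_insert_of_mem hj))).mono_cost ?_
      rw [Finset.card_insert_of_notMem hi]; linarith
  refine key.mono_cost ?_
  nlinarith [Nat.mul_le_mul_right (k + 1) hs]

lemma inf' {ι : Type*} (s : Finset ι) (hs' : s.Nonempty) {f : ι → D → ℝ}
    (h : ∀ i ∈ s, Computes I A k {f i}) (hs : s.card ≤ N) :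
    Computes I A (N * (k + 1)) {fun x => s.inf' hs' fun i => f i x} := by
  classical
  have key : Computes I A (s.card * (k + 1)) {fun x => s.inf' hs' fun i => f i x} := by
    clear hs
    induction hs' using Finset.Nonempty.cons_induction with
    | singleton i =>
      simp only [Finset.inf'_singleton, Finset.card_singleton, one_mul]
      exact (h i (by simp)).mono_cost (Nat.le_succ k)
    | cons i s hi hs' ih =>
      simp only [Finset.inf'_cons hs']
      refine ((h i (Finset.mem_cons_self _ _)).inf
        (ih fun j hj => h j (Finset.mem_cons_of_mem hj))).mono_cost ?_
      rw [Finset.card_cons]; linarith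
  exact key.mono_cost (Nat.mul_le_mul_right _ hs)

lemma dotProduct {d : ℕ} {x y : D → Fin d → ℝ} (hx : ∀ i, Computes I A k {fun r => x r i})
    (hy : ∀ i, Computes I A l {fun r => y r i}) (hd : d ≤ N) (hN : 1 ≤ N) :
    Computes I A (N * (k + l + 3)) {fun r => x r ⬝ᵥ y r} :=
  sum Finset.univ (fun i _ => (hx i).mul (hy i)) (by simpa using hd) hN

end Computes

/-- Iterated stages of a program. -/
lemma Computes.iterate {D : Type w} {I : Set (D → ℝ)} {E : Set (D → ℝ)} {B : ℕ → Set (D → ℝ)}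
    {k₀ k T : ℕ} (h0 : Computes I E k₀ (B 0))
    (h : ∀ t < T, Computes I (E ∪ B t) k (B (t + 1))) : Computes I E (k₀ + T * k) (B T) := by
  induction T with
  | zero => simpa using h0
  | succ T ih =>
    have := (ih fun t ht => h t (by omega)).trans (h T (by omega))
    intro n R hR hA
    obtain ⟨n', R', h1, h2, h3, h4⟩ := this n R hR hA
    exact ⟨n', R', h1, by linarith, h3, Set.subset_union_right.trans h4⟩

/-! ## The algorithm as a straight-line program -/

namespace FHSSP

variable {S : Type u} {A : Type v} {d : ℕ}

/-- Rank-one updates give `T` stages, each keeping only the matrix entries. In a stage, each of at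
most `N ^ 2` entries recomputes the matrix-vector products it needs within `21 * N ^ 2`
instructions, whence the generous `21 * N ^ 4`. -/
lemma computes_inv {D : Type w} {I : Set (D → ℝ)} (v : D → ℕ → Fin d → ℝ) (T N : ℕ)
    (hv : ∀ t < T, ∀ i, (fun r => v r t i) ∈ I) (hd : d ≤ N) (hN : 1 ≤ N) :
    Computes I ∅ (N ^ 2 + T * (21 * N ^ 4)) {f | ∃ i j, f = fun r => Ridge.inv (v r) T i j} := by
  have entries : ∀ {E : Set (D → ℝ)} {k : ℕ} {F : Fin d → Fin d → D → ℝ},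
      (∀ i j, Computes I E k {F i j}) → Computes I E (N ^ 2 * k) {f | ∃ i j, f = F i j} := by
    intro E k F h
    have := Computes.biUnion (Finset.univ : Finset (Fin d × Fin d)) (B := fun q => {F q.1 q.2})
      fun q _ => h q.1 q.2
    intro n R hR hA
    obtain ⟨n', R', h1, h2, h3, h4⟩ := this n R hR hA
    refine ⟨n', R', h1, h2.trans ?_, h3, ?_⟩
    · have : (Finset.univ : Finset (Fin d × Fin d)).card ≤ N ^ 2 := by
        simpa [sq] using Nat.mul_le_mul hd hd
      gcongr
    · rintro f ⟨i, j, rfl⟩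
      exact h4 ⟨(i, j), Finset.mem_univ _, rfl⟩
  refine Computes.iterate (B := fun t => {f | ∃ i j, f = fun r => Ridge.inv (v r) t i j}) ?_ ?_
  · have := entries (F := fun i j _ => (1 : Matrix (Fin d) (Fin d) ℝ) i j)
      fun i j => Computes.const (I := I) (A := ∅) _
    rwa [mul_one] at this
  · intro t ht
    rw [Set.empty_union]
    set E := {f | ∃ i j, f = fun r => Ridge.inv (v r) t i j}
    have hW : ∀ i j, Computes I E 0 {fun r => Ridge.inv (v r) t i j} :=
      fun i j => Computes.mem ⟨i, j, rfl⟩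
    have hx : ∀ i, Computes I E 1 {fun r => v r t i} := fun i => Computes.read (hv t ht i)
    have hWx : ∀ i, Computes I E (N * (0 + 1 + 3)) {fun r => (Ridge.inv (v r) t *ᵥ v r t) i} :=
      fun i => Computes.dotProduct (hW i) hx hd hN
    have hu : Computes I E (N * (1 + N * (0 + 1 + 3) + 3))
        {fun r => v r t ⬝ᵥ Ridge.inv (v r) t *ᵥ v r t} := Computes.dotProduct hx hWx hd hN
    refine (entries (k := 21 * N ^ 2) fun i j => ?_).mono_cost (by ring_nf; rfl)
    have := (hW i j).sub (((hWx i).mul (hWx j)).div ((Computes.const 1).add hu))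
    convert this.mono_cost (l := 21 * N ^ 2) ?_ using 2
    · ext r
      simp only [Ridge.inv, Matrix.sub_apply, Matrix.smul_apply, vecMulVec_apply, smul_eq_mul]
      rw [div_eq_inv_mul]
    · nlinarith

/-- The regression needs `V` only at states reached in earlier intervals, so finitely many registers
stand for the whole function `V`. The bonus coefficient is independent of the record and is loaded
as a constant. -/
lemma computes_truncQ [Fintype A] {D : Type w} {I E : Set (D → ℝ)}
    {φ : S → A → EuclideanSpace ℝ (Fin d)} {p : FHParams} {m N : ℕ}
    (rec : D → Record S A) (V : D → Option S → ℝ) (x : D → Option S) (a : A)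
    (hx : ∀ i, (fun r => feature φ (x r) a i) ∈ I)
    (hv : ∀ t < m * p.H, ∀ i, (fun r => visitedSeq φ (rec r) p.H t i) ∈ I)
    (hc : ∀ t < m * p.H, (fun r => (rec r).cost (t / p.H) (t % p.H)) ∈ I)
    (hV : ∀ t < m * p.H, (fun r => V r ((rec r).state (t / p.H) (t % p.H + 1))) ∈ E)
    (hW : ∀ i j, (fun r => Ridge.inv (visitedSeq φ (rec r) p.H) (m * p.H) i j) ∈ E)
    (hH : 0 < p.H) (hd : d ≤ N) (hm : m * p.H ≤ N) (hN : 1 ≤ N) :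
    Computes I E (29 * N ^ 3) {fun r => truncQ φ p (rec r) m (V r) (x r) a} := by
  have hx' : ∀ i, Computes I E 1 {fun r => feature φ (x r) a i} := fun i => .read (hx i)
  have hw : ∀ i, Computes I E (N * (0 + N * (1 + 0 + 1 + 1 + 1 + 2) + 3))
      {fun r => weight φ p (rec r) m (V r) i} := by
    intro i
    simp only [weight_eq _ _ _ _ _ hH]
    refine Computes.dotProduct (fun j => .mem (hW i j)) (fun j => ?_) hd hN
    simp only [Finset.sum_apply, Pi.smul_apply, smul_eq_mul]
    refine Computes.sum _ (fun t ht => ?_) (by simpa using hm) hN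
    have ht := Finset.mem_range.mp ht
    exact ((Computes.read (hc t ht)).add (.mem (hV t ht))).mul (.read (hv t ht j))
  have hq : Computes I E (N * (1 + N * (0 + 1 + 3) + 3))
      {fun r => Ridge.form (visitedSeq φ (rec r) p.H) (m * p.H) (feature φ (x r) a)} :=
    Computes.dotProduct hx'
      (fun i => Computes.dotProduct (fun j => .mem (hW i j)) hx' hd hN) hd hN
  have := ((((Computes.dotProduct hx' hw hd hN).sub
    ((Computes.const (beta d p m)).mul hq.sqrt)).sup (Computes.const 0)).inf (Computes.const p.B))
  convert this.mono_cost (l := 29 * N ^ 3) ?_ using 2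
  · ext r
    rw [truncQ, rawQ_eq _ _ _ _ _ hH]
  · nlinarith [Nat.mul_le_mul_left (N * N) hN, Nat.mul_le_mul_left N hN]

/-- Backward induction closes on the values at the states reached so far: these, with the inverse
Gram matrix, determine the values one layer earlier at the same states. `N` bounds `d`, `|A|`, `H`
and `m * H` at once. At most `N` layers, `N` states and `N` actions at `29 * N ^ 3` instructions
each give the exponent `6`. -/
theorem exists_straightLine [Fintype A] [Nonempty A] (φ : S → A → EuclideanSpace ℝ (Fin d))
    (p : FHParams) (m h : ℕ) (hd : 1 ≤ d) (hh : h < p.H) :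
    ∃ (n : ℕ) (R : Set (Record S A → ℝ)),
      StraightLine (observations φ p.H m h) n R ∧
      n ≤ 100 * (d * Fintype.card A * p.H * (m + 1)) ^ 6 ∧
      ∀ a, (fun r : Record S A => Q φ p r m h (r.state m h) a) ∈ R := by
  have hH : 0 < p.H := by omega
  have hA : 0 < Fintype.card A := Fintype.card_pos
  set N := d * Fintype.card A * p.H * (m + 1) with hNdef
  have hN : 1 ≤ N := Nat.one_le_iff_ne_zero.mpr (by positivity)
  have hdN : d ≤ N := Nat.le_of_dvd hN ⟨Fintype.card A * p.H * (m + 1), by rw [hNdef]; ring⟩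
  have hAN : Fintype.card A ≤ N := Nat.le_of_dvd hN ⟨d * p.H * (m + 1), by rw [hNdef]; ring⟩
  have hHN : p.H ≤ N := Nat.le_of_dvd hN ⟨d * Fintype.card A * (m + 1), by rw [hNdef]; ring⟩
  have hmN : m * p.H ≤ N :=
    (Nat.mul_le_mul_right _ (Nat.le_add_right m 1)).trans
      (Nat.le_of_dvd hN ⟨d * Fintype.card A, by rw [hNdef]; ring⟩)
  set I := observations φ p.H m h with hI
  have hlt : ∀ t < m * p.H, t / p.H < m ∧ t % p.H < p.H := fun t ht =>
    ⟨Nat.div_lt_of_lt_mul (by rwa [mul_comm]), Nat.mod_lt _ hH⟩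
  have hv : ∀ t < m * p.H, ∀ i, (fun r => visitedSeq φ r p.H t i) ∈ I := fun t ht i =>
    Or.inr ⟨_, _, (hlt t ht).1, (hlt t ht).2, Or.inl ⟨i, rfl⟩⟩
  have hc : ∀ t < m * p.H, (fun r : Record S A => r.cost (t / p.H) (t % p.H)) ∈ I := fun t ht =>
    Or.inr ⟨_, _, (hlt t ht).1, (hlt t ht).2, Or.inr rfl⟩
  have hx : ∀ t < m * p.H, ∀ a i,
      (fun r => feature φ (r.state (t / p.H) (t % p.H + 1)) a i) ∈ I := fun t ht a i =>
    Or.inl ⟨_, _, Or.inl ⟨(hlt t ht).1, (hlt t ht).2⟩, Or.inl ⟨a, i, rfl⟩⟩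
  set EW : Set (Record S A → ℝ) :=
    {f | ∃ i j, f = fun r => Ridge.inv (visitedSeq φ r p.H) (m * p.H) i j} with hEW
  have hWc : Computes I ∅ (N ^ 2 + m * p.H * (21 * N ^ 4)) EW := computes_inv _ _ _ hv hdN hN
  set EV : ℕ → Set (Record S A → ℝ) := fun j => {f | ∃ t ∈ Finset.range (m * p.H),
    f ∈ ({fun r => valueToGo φ p r m j (r.state (t / p.H) (t % p.H + 1))} :
      Set (Record S A → ℝ))} with hEV
  -- The terminal cost is `cf * (1 - goal indicator)`, five instructions for each state.
  have hbase : Computes I EW ((Finset.range (m * p.H)).card * 5) (EV 0) := by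
    refine Computes.biUnion _ fun t ht => ?_
    have ht := Finset.mem_range.mp ht
    classical
    have hr : (fun r : Record S A =>
        if r.state (t / p.H) (t % p.H + 1) = none then (1 : ℝ) else 0) ∈ I :=
      Or.inl ⟨_, _, Or.inl ⟨(hlt t ht).1, (hlt t ht).2⟩, Or.inr (by ext r; congr)⟩
    have := (Computes.const (A := EW) p.cf).mul ((Computes.const 1).sub (.read hr))
    convert this using 2
    ext r
    rcases h : r.state (t / p.H) (t % p.H + 1) <;> simp [valueToGo, terminalCost]
  have hstep : ∀ j < p.H - (h + 1),
      Computes I (EW ∪ EV j) (N * (N * (29 * N ^ 3 + 1))) (EV (j + 1)) := by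
    intro j _
    refine (Computes.biUnion (k := N * (29 * N ^ 3 + 1)) _ fun t ht => ?_).mono_cost
      (by gcongr; simpa using hmN)
    have ht := Finset.mem_range.mp ht
    refine Computes.inf' Finset.univ Finset.univ_nonempty (fun a _ => ?_)
      (by simpa using hAN)
    refine computes_truncQ id _ _ a (hx t ht a) hv hc (fun t ht => ?_) (fun i j => ?_) hH hdN
      hmN hN
    · exact Or.inr ⟨t, Finset.mem_range.mpr ht, rfl⟩
    · exact Or.inl ⟨i, j, rfl⟩
  have hVc := Computes.iterate hbase hstep
  have hQ : Computes I (EW ∪ EV (p.H - (h + 1))) (Fintype.card A * (29 * N ^ 3))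
      {f | ∃ a ∈ (Finset.univ : Finset A), f ∈ ({fun r => Q φ p r m h (r.state m h) a} :
        Set (Record S A → ℝ))} := by
    refine Computes.biUnion _ fun a _ => ?_
    refine computes_truncQ id _ _ a (fun i => ?_) hv hc (fun t ht => ?_) (fun i j => ?_) hH hdN
      hmN hN
    · exact Or.inl ⟨m, h, Or.inr ⟨rfl, le_rfl⟩, Or.inl ⟨a, i, rfl⟩⟩
    · exact Or.inr ⟨t, Finset.mem_range.mpr ht, rfl⟩
    · exact Or.inl ⟨i, j, rfl⟩
  have hall := hWc.trans ((hVc.trans hQ).mono (by simp))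
  obtain ⟨n, R, h1, h2, -, h4⟩ := hall 0 ∅ StraightLine.nil (by simp)
  refine ⟨n, R, h1, h2.trans ?_, fun a => h4 (Or.inr (Or.inr ⟨a, Finset.mem_univ a, rfl⟩))⟩
  rw [Finset.card_range]
  have e1 : m * p.H * (21 * N ^ 4) ≤ N * (21 * N ^ 4) := Nat.mul_le_mul_right _ hmN
  have e2 : (p.H - (h + 1)) * (N * (N * (29 * N ^ 3 + 1))) ≤ N * (N * (N * (29 * N ^ 3 + 1))) :=
    Nat.mul_le_mul_right _ (by omega)
  have e3 : Fintype.card A * (29 * N ^ 3) ≤ N * (29 * N ^ 3) := Nat.mul_le_mul_right _ hAN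
  have p1 : N ≤ N ^ 6 := Nat.le_self_pow (by norm_num) N
  have p2 : N ^ 2 ≤ N ^ 6 := Nat.pow_le_pow_right hN (by norm_num)
  have p3 : N ^ 3 ≤ N ^ 6 := Nat.pow_le_pow_right hN (by norm_num)
  have p4 : N ^ 4 ≤ N ^ 6 := Nat.pow_le_pow_right hN (by norm_num)
  have p5 : N ^ 5 ≤ N ^ 6 := Nat.pow_le_pow_right hN (by norm_num)
  ring_nf at e1 e2 e3 ⊢
  ring_nf at hmN
  linarith

end FHSSP

end

noncomputable section

open Matrix

/-! ## Measurability on the state space with the goal -/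

section OptionMeasurable

variable {S : Type u} [MeasurableSpace S]

lemma measurable_option_iff {β : Type*} [MeasurableSpace β] {f : Option S → β} :
    Measurable f ↔ Measurable fun s => f (some s) := Iff.rfl

lemma measurable_option_some : Measurable (some : S → Option S) := fun _ h => h

lemma measurableSet_singleton_none : MeasurableSet ({none} : Set (Option S)) := by
  change MeasurableSet (some ⁻¹' ({none} : Set (Option S)))
  convert MeasurableSet.empty
  ext; simp

end OptionMeasurable

namespace SSP

variable {S : Type u} {A : Type v} [MeasurableSpace S]

lemma step_some (M : SSP S A) (a : A) (s : S) : M.step a (some s) = M.trans a s := rfl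

lemma step_none (M : SSP S A) (a : A) : M.step a none = Measure.dirac none := rfl

lemma measurable_step (M : SSP S A) (a : A) : Measurable (M.step a) :=
  measurable_option_iff.mpr (M.trans a).measurable

instance (M : SSP S A) (a : A) (x : Option S) : IsProbabilityMeasure (M.step a x) := by
  have := M.isMarkov a
  cases x with
  | none => rw [step_none]; infer_instance
  | some s => rw [step_some]; infer_instance

/-- The transition law as a Markov kernel from state-action pairs. -/
def stepKernel [MeasurableSpace A] [MeasurableSingletonClass A] [Countable A] (M : SSP S A) :
    Kernel (Option S × A) (Option S) where
  toFun q := M.step q.2 q.1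
  measurable' := measurable_from_prod_countable_left fun a => M.measurable_step a

instance [MeasurableSpace A] [MeasurableSingletonClass A] [Countable A] (M : SSP S A) :
    IsMarkovKernel M.stepKernel := ⟨fun q => inferInstanceAs (IsProbabilityMeasure (M.step q.2 q.1))⟩

end SSP

/-! ## Disintegration along a kernel -/

/-- Rectangles determine the joint law of `f` and `X`, which is therefore a composition-product. The
integrands met later depend jointly on past and next state, so conditional probabilities of single
events do not suffice. -/
lemma lintegral_eq_of_forall_measure_inter {Ω Ω' Y : Type*} {mΩ : MeasurableSpace Ω}
    {mΩ' : MeasurableSpace Ω'} {mY : MeasurableSpace Y} {P : Measure Ω} [IsFiniteMeasure P]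
    {f : Ω → Ω'} (hf : Measurable f) {X : Ω → Y} (hX : Measurable X) (κ : Kernel Ω' Y)
    [IsMarkovKernel κ]
    (h : ∀ F E, MeasurableSet F → MeasurableSet E →
      P (f ⁻¹' F ∩ X ⁻¹' E) = ∫⁻ ω in f ⁻¹' F, κ (f ω) E ∂P)
    {G : Ω' × Y → ENNReal} (hG : Measurable G) :
    ∫⁻ ω, G (f ω, X ω) ∂P = ∫⁻ ω, ∫⁻ x, G (f ω, x) ∂κ (f ω) ∂P := by
  have key : P.map (fun ω => (f ω, X ω)) = (P.map f) ⊗ₘ κ := by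
    have := Measure.isFiniteMeasure_map P (fun ω => (f ω, X ω))
    refine Measure.ext_prod fun {F E} hF hE => ?_
    rw [Measure.map_apply (hf.prodMk hX) (hF.prod hE), Measure.compProd_apply_prod hF hE,
      setLIntegral_map hF (κ.measurable_coe hE) hf]
    exact h F E hF hE
  rw [← lintegral_map hG (hf.prodMk hX), key, Measure.lintegral_compProd hG,
    lintegral_map hG.lintegral_kernel_prod_right' hf]

/-! ## Linear instances -/

/-- Each coordinate is a signed measure of finite total variation, and the norm is at most the sum
of the coordinates. Finiteness makes bounded functions integrable and permits dominated convergence.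
-/
lemma MeasureTheory.VectorMeasure.isFiniteMeasure_variation_euclideanSpace {X : Type*}
    {mX : MeasurableSpace X} {d : ℕ} (μ : VectorMeasure X (EuclideanSpace ℝ (Fin d))) :
    IsFiniteMeasure μ.variation := by
  let c : Fin d → SignedMeasure X := fun i =>
    μ.mapRange (EuclideanSpace.proj (𝕜 := ℝ) i).toLinearMap.toAddMonoidHom
      (EuclideanSpace.proj (𝕜 := ℝ) i).continuous
  refine isFiniteMeasure_of_le (∑ i, (c i).totalVariation) ?_
  refine VectorMeasure.variation_le_of_forall_enorm_le fun E hE => ?_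
  have h1 : ‖μ E‖ ≤ ∑ i, ‖c i E‖ := by
    have h0 : μ E = ∑ i, c i E • EuclideanSpace.single i (1 : ℝ) := by
      ext j
      have hc : ∀ i, c i E = (μ E).ofLp i := fun i => rfl
      simp [hc, Pi.single_apply]
    calc ‖μ E‖ = ‖∑ i, c i E • EuclideanSpace.single i (1 : ℝ)‖ := by rw [← h0]
      _ ≤ ∑ i, ‖c i E • EuclideanSpace.single i (1 : ℝ)‖ := norm_sum_le _ _
      _ = ∑ i, ‖c i E‖ := by simp [norm_smul]
  calc ‖μ E‖ₑ = ENNReal.ofReal ‖μ E‖ := (ofReal_norm _).symm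
    _ ≤ ENNReal.ofReal (∑ i, ‖c i E‖) := ENNReal.ofReal_le_ofReal h1
    _ = ∑ i, ‖c i E‖ₑ := by
      rw [ENNReal.ofReal_sum_of_nonneg fun _ _ => norm_nonneg _]
      simp only [ofReal_norm]
    _ ≤ ∑ i, (c i).totalVariation E := Finset.sum_le_sum fun i _ =>
      SignedMeasure.enorm_le_totalVariation (c i) E
    _ = (∑ i, (c i).totalVariation) E := by simp

/-- If a finite measure is a linear image of a vector measure, so are the integrals of bounded
functions. -/
lemma integral_eq_inner_integral {X : Type*} {mX : MeasurableSpace X} {d : ℕ}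
    {μ : VectorMeasure X (EuclideanSpace ℝ (Fin d))} {ν : Measure X} [IsFiniteMeasure ν]
    {z : EuclideanSpace ℝ (Fin d)}
    (h : ∀ E, MeasurableSet E → ν.real E = inner ℝ z (μ E)) {f : X → ℝ} (hf : Measurable f)
    {b : ℝ} (hb : ∀ x, |f x| ≤ b) :
    ∫ x, f x ∂ν = inner ℝ z (μ.integral f (ContinuousLinearMap.lsmul ℝ ℝ)) := by
  have := μ.isFiniteMeasure_variation_euclideanSpace
  have simple : ∀ g : SimpleFunc X ℝ,
      ∫ x, g x ∂ν = inner ℝ z (μ.integral g (ContinuousLinearMap.lsmul ℝ ℝ)) := by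
    intro g
    induction g using SimpleFunc.induction with
    | const c hs =>
      classical
      have e : ∀ s : Set X, s.piecewise (Function.const X c) (Function.const X 0)
          = s.indicator fun _ => c := fun s => Set.piecewise_eq_indicator
      rw [SimpleFunc.coe_piecewise, SimpleFunc.coe_const, SimpleFunc.coe_const, e,
        VectorMeasure.integral_indicator_const c hs, integral_indicator_const c hs]
      simp [h _ hs, inner_smul_right, mul_comm]
    | add hd hf hg =>
      rename_i f g
      have e1 : μ.Integrable f := f.integrable_of_isFiniteMeasure
      have e2 : μ.Integrable g := g.integrable_of_isFiniteMeasure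
      rw [SimpleFunc.coe_add, VectorMeasure.integral_add e1 e2, inner_add_right, ← hf, ← hg]
      exact integral_add f.integrable_of_isFiniteMeasure g.integrable_of_isFiniteMeasure
  have hsm : StronglyMeasurable f := hf.stronglyMeasurable
  have hb0 : ∀ x, ‖f x‖ ≤ b := hb
  rcases isEmpty_or_nonempty X with hX | ⟨⟨x₀⟩⟩
  · have : f = (0 : SimpleFunc X ℝ) := by ext x; exact hX.elim x
    rw [this]; exact simple 0
  have hbn : 0 ≤ b := (norm_nonneg _).trans (hb0 x₀)
  have t1 : Tendsto (fun n => ∫ x, hsm.approxBounded b n x ∂ν) atTop (𝓝 (∫ x, f x ∂ν)) :=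
    tendsto_integral_of_dominated_convergence (fun _ => b)
      (fun n => (SimpleFunc.stronglyMeasurable _).aestronglyMeasurable) (integrable_const b)
      (fun n => ae_of_all _ fun x => hsm.norm_approxBounded_le hbn n x)
      (ae_of_all _ fun x => hsm.tendsto_approxBounded_of_norm_le (hb0 x))
  have t2 : Tendsto (fun n => μ.integral (hsm.approxBounded b n) (ContinuousLinearMap.lsmul ℝ ℝ))
      atTop (𝓝 (μ.integral f (ContinuousLinearMap.lsmul ℝ ℝ))) :=
    VectorMeasure.tendsto_integral_of_dominated_convergence (fun _ => b)
      (fun n => (SimpleFunc.stronglyMeasurable _).aestronglyMeasurable) (integrable_const b)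
      (fun n => ae_of_all _ fun x => hsm.norm_approxBounded_le hbn n x)
      (ae_of_all _ fun x => hsm.tendsto_approxBounded_of_norm_le (hb0 x))
  refine tendsto_nhds_unique t1 ?_
  simp only [simple]
  exact tendsto_const_nhds.inner t2

namespace SSP

variable {S : Type u} {A : Type v} [MeasurableSpace S] {M : SSP S A} {d : ℕ}
  {φ : S → A → EuclideanSpace ℝ (Fin d)}

open FHSSP

lemma feature_dotProduct_self_le (hφ : M.IsLinear φ) (x : Option S) (a : A) :
    feature φ x a ⬝ᵥ feature φ x a ≤ 1 := by
  cases x with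
  | none => simp [feature]
  | some s =>
    have h := hφ.2.1 s a
    have : feature φ (some s) a ⬝ᵥ feature φ (some s) a = ‖φ s a‖ ^ 2 := by
      rw [EuclideanSpace.real_norm_sq_eq, dotProduct]
      simp [feature, sq]
    rw [this]
    exact pow_le_one₀ (norm_nonneg _) h

lemma measurable_feature (hφ : M.IsLinear φ) (a : A) (i : Fin d) :
    Measurable fun x => feature φ x a i := by
  refine measurable_option_iff.mpr ?_
  exact (EuclideanSpace.proj (𝕜 := ℝ) i).continuous.measurable.comp (hφ.1 a)

lemma measurable_stepCost (hφ : M.IsLinear φ) (a : A) : Measurable fun x => M.stepCost x a := by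
  obtain ⟨h1, -, θ, μ, -, h2, -⟩ := hφ
  refine measurable_option_iff.mpr ?_
  simp only [stepCost, h2]
  exact (h1 a).inner_const

lemma stepCost_mem (x : Option S) (a : A) : M.stepCost x a ∈ Set.Icc (0 : ℝ) 1 := by
  cases x with
  | none => simp [stepCost]
  | some s => exact ⟨M.cmin_pos.le.trans (M.cost_mem s a).1, (M.cost_mem s a).2⟩

/-- In a linear instance, cost plus expected continuation value is linear in the features. -/
lemma exists_weight (hφ : M.IsLinear φ) {V : Option S → ℝ} (hV : Measurable V) {b : ℝ}
    (hb : ∀ x, |V x| ≤ b) (h0 : V none = 0) :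
    ∃ z : Fin d → ℝ, z ⬝ᵥ z ≤ d * (1 + b) ^ 2 ∧
      ∀ x a, feature φ x a ⬝ᵥ z = M.stepCost x a + ∫ y, V y ∂M.step a x := by
  obtain ⟨-, -, θ, μ, hθ, hc, hP, hμ⟩ := hφ
  set y := μ.integral V (ContinuousLinearMap.lsmul ℝ ℝ) with hy
  have hb0 : 0 ≤ b := (abs_nonneg _).trans (hb none)
  -- The weight is the cost parameter plus the integral of `V` against the vector measure. At the
  -- goal the features vanish, which is consistent because `V none = 0`.
  refine ⟨(θ + y).ofLp, ?_, ?_⟩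
  · have e : (θ + y).ofLp ⬝ᵥ (θ + y).ofLp = ‖θ + y‖ ^ 2 := by
      rw [EuclideanSpace.real_norm_sq_eq, dotProduct]
      simp only [sq]
    have h1 : ‖θ + y‖ ≤ √d * (1 + b) := by
      calc ‖θ + y‖ ≤ ‖θ‖ + ‖y‖ := norm_add_le _ _
        _ ≤ √d + √d * b := add_le_add hθ (hμ V hV b hb)
        _ = _ := by ring
    calc _ = ‖θ + y‖ ^ 2 := e
      _ ≤ (√d * (1 + b)) ^ 2 := by gcongr
      _ = _ := by rw [mul_pow, Real.sq_sqrt (Nat.cast_nonneg d)]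
  · intro x a
    cases x with
    | none => simp [feature, stepCost, step_none, integral_dirac' _ _ hV.stronglyMeasurable, h0]
    | some s =>
      have := M.isMarkov a
      rw [step_some, integral_eq_inner_integral (hP s a) hV hb]
      simp only [stepCost, hc]
      rw [← inner_add_right, ← hy, EuclideanSpace.inner_eq_star_dotProduct, dotProduct_comm]
      simp [feature]

end SSP

end

noncomputable section

open Matrix

/-! ## Measurability of the ridge quantities -/

namespace Ridge

variable {Ω' : Type*} {mΩ' : MeasurableSpace Ω'} {d : ℕ}

lemma measurable_dotProduct {f g : Ω' → Fin d → ℝ} (hf : Measurable f) (hg : Measurable g) :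
    Measurable fun ω => f ω ⬝ᵥ g ω := by
  simp only [dotProduct]
  fun_prop

lemma measurable_inv {v : Ω' → ℕ → Fin d → ℝ} {t : ℕ} (hv : ∀ s < t, Measurable fun ω => v ω s)
    (i j : Fin d) : Measurable fun ω => inv (v ω) t i j := by
  induction t generalizing i j with
  | zero => exact measurable_const
  | succ t ih =>
    have ih := ih fun s hs => hv s (by omega)
    have hx := hv t (by omega)
    have hWx : Measurable fun ω => inv (v ω) t *ᵥ v ω t :=
      measurable_pi_lambda _ fun i => measurable_dotProduct (measurable_pi_lambda _ (ih i)) hx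
    simp only [inv, Matrix.sub_apply, Matrix.smul_apply, vecMulVec_apply, smul_eq_mul]
    exact (ih i j).sub (((measurable_dotProduct hx hWx).const_add 1).inv.mul
      (((measurable_pi_apply i).comp hWx).mul ((measurable_pi_apply j).comp hWx)))

lemma measurable_inv_mulVec {v : Ω' → ℕ → Fin d → ℝ} {t : ℕ}
    (hv : ∀ s < t, Measurable fun ω => v ω s) {y : Ω' → Fin d → ℝ} (hy : Measurable y) :
    Measurable fun ω => inv (v ω) t *ᵥ y ω :=
  measurable_pi_lambda _ fun i =>
    measurable_dotProduct (measurable_pi_lambda _ (measurable_inv hv i)) hy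

lemma measurable_form {v : Ω' → ℕ → Fin d → ℝ} {t : ℕ} (hv : ∀ s < t, Measurable fun ω => v ω s)
    {y : Ω' → Fin d → ℝ} (hy : Measurable y) : Measurable fun ω => form (v ω) t (y ω) :=
  measurable_dotProduct hy (measurable_inv_mulVec hv hy)

lemma measurable_gain {v : Ω' → ℕ → Fin d → ℝ} {t : ℕ} (hv : ∀ s ≤ t, Measurable fun ω => v ω s) :
    Measurable fun ω => gain (v ω) t :=
  ((measurable_form (fun s hs => hv s hs.le) (hv t le_rfl)).const_add 1).log

end Ridge

lemma ProbabilityTheory.Kernel.measurable_integral {Ω' Y : Type*} {mΩ' : MeasurableSpace Ω'}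
    {mY : MeasurableSpace Y} (κ : Kernel Ω' Y) [IsMarkovKernel κ] {f : Ω' × Y → ℝ}
    (hf : Measurable f) : Measurable fun ω => ∫ y, f (ω, y) ∂κ ω :=
  (hf.stronglyMeasurable.integral_kernel_prod_right' (κ := κ)).measurable

lemma measurable_prodMk_of_le {Ω Y : Type*} {m m' : MeasurableSpace Ω} {mY : MeasurableSpace Y}
    (h : m' ≤ m) {X : Ω → Y} (hX : Measurable[m] X) :
    Measurable[m, m'.prod mY] fun ω => (ω, X ω) :=
  Measurable.prod (measurable_id'' h) hX

namespace SSP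

variable {S : Type u} {A : Type v} [MeasurableSpace S] [MeasurableSpace A]
  [MeasurableSingletonClass A] [Countable A] {Ω' : Type*} {mΩ' : MeasurableSpace Ω'}

/-- The transition kernel at a random state and action. -/
def kernelAt (M : SSP S A) {x : Ω' → Option S} {a : Ω' → A} (hx : Measurable x)
    (ha : Measurable a) : Kernel Ω' (Option S) :=
  M.stepKernel.comap (fun ω => (x ω, a ω)) (hx.prodMk ha)

instance (M : SSP S A) {x : Ω' → Option S} {a : Ω' → A} (hx : Measurable x)
    (ha : Measurable a) : IsMarkovKernel (M.kernelAt hx ha) :=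
  inferInstanceAs (IsMarkovKernel (Kernel.comap _ _ _))

end SSP

/-! ## Hoeffding's lemma -/

lemma lintegral_exp_mul_sub_integral_le {X : Type*} {mX : MeasurableSpace X} (ν : Measure X)
    [IsProbabilityMeasure ν] {f : X → ℝ} (hf : Measurable f) {a b : ℝ}
    (h : ∀ x, f x ∈ Set.Icc a (a + b)) (c : ℝ) :
    ∫⁻ x, ENNReal.ofReal (Real.exp (c * (f x - ∫ y, f y ∂ν))) ∂ν
      ≤ ENNReal.ofReal (Real.exp (c ^ 2 * b ^ 2 / 8)) := by
  have hs := hasSubgaussianMGF_of_mem_Icc (μ := ν) hf.aemeasurable (ae_of_all _ h)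
  rw [← ofReal_integral_eq_lintegral_ofReal (hs.integrable_exp_mul c)
    (ae_of_all _ fun x => (Real.exp_pos _).le)]
  refine ENNReal.ofReal_le_ofReal ((hs.mgf_le c).trans (Real.exp_le_exp.mpr (le_of_eq ?_)))
  have : ((‖a + b - a‖₊ : ℝ)) ^ 2 = b ^ 2 := by simp
  push_cast at *
  rw [div_pow, this]
  ring

/-! ## The run, layer after layer -/

namespace Trajectory

variable {S : Type u} {A : Type v} {Ω : Type w}

/-- The state at time `t`, before the transition. -/
def cur (X : Trajectory S A Ω) (H t : ℕ) (ω : Ω) : Option S := X.state (t / H) (t % H) ω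

/-- The action at time `t`. -/
def act (X : Trajectory S A Ω) (H t : ℕ) (ω : Ω) : A := X.action (t / H) (t % H) ω

/-- The state reached by the transition at time `t`. -/
def next (X : Trajectory S A Ω) (H t : ℕ) (ω : Ω) : Option S := X.state (t / H) (t % H + 1) ω

variable [MeasurableSpace S]

/-- The law of the next state at time `t`. -/
def nextLaw (X : Trajectory S A Ω) (M : SSP S A) (H t : ℕ) (ω : Ω) : Measure (Option S) :=
  M.step (X.act H t ω) (X.cur H t ω)

instance (X : Trajectory S A Ω) (M : SSP S A) (H t : ℕ) (ω : Ω) :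
    IsProbabilityMeasure (X.nextLaw M H t ω) :=
  inferInstanceAs (IsProbabilityMeasure (M.step _ _))

end Trajectory

namespace IsRun

variable {S : Type u} {A : Type v} {Ω : Type w} [MeasurableSpace S] [MeasurableSpace A]
  [Fintype A] [Nonempty A] {mΩ : MeasurableSpace Ω} {d : ℕ}
  {M : SSP S A} {φ : S → A → EuclideanSpace ℝ (Fin d)} {p : FHParams} {K : ℕ} {P : Measure Ω}
  {ℱ : Filtration ℕ mΩ} {X : Trajectory S A Ω}

lemma measurable_cur (hX : IsRun M φ p K P ℱ X) (hH : 0 < p.H) {s t : ℕ} (hst : s ≤ t) :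
    Measurable[ℱ t] (X.cur p.H s) := by
  have h := hX.measurable_state (s / p.H) (s % p.H) (Nat.mod_lt s hH).le
  rw [Nat.div_add_mod'] at h
  exact h.mono (ℱ.mono hst) le_rfl

lemma measurable_act (hX : IsRun M φ p K P ℱ X) (hH : 0 < p.H) {s t : ℕ} (hst : s ≤ t) :
    Measurable[ℱ t] (X.act p.H s) := by
  have h := hX.measurable_action (s / p.H) (s % p.H) (Nat.mod_lt s hH)
  rw [Nat.div_add_mod'] at h
  exact h.mono (ℱ.mono hst) le_rfl

/-- In the last layer, `next` is the end state of the interval, which may differ from `cur` at the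
following time because an episode may restart. Hence `measurable_state` is used with `h = H`
allowed. -/
lemma measurable_next (hX : IsRun M φ p K P ℱ X) (hH : 0 < p.H) {s t : ℕ} (hst : s < t) :
    Measurable[ℱ t] (X.next p.H s) := by
  have h := hX.measurable_state (s / p.H) (s % p.H + 1) (Nat.mod_lt s hH)
  rw [← add_assoc, Nat.div_add_mod'] at h
  exact h.mono (ℱ.mono hst) le_rfl

variable [MeasurableSingletonClass A]

lemma measurable_visited (hX : IsRun M φ p K P ℱ X) (hφ : M.IsLinear φ) (hH : 0 < p.H) {s t : ℕ}
    (hst : s ≤ t) : Measurable[ℱ t] fun ω => FHSSP.visitedSeq φ (X.record M ω) p.H s := by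
  have h1 : Measurable fun q : Option S × A => FHSSP.feature φ q.1 q.2 :=
    measurable_from_prod_countable_left fun a =>
      measurable_pi_lambda _ fun i => SSP.measurable_feature hφ a i
  exact h1.comp ((hX.measurable_cur hH hst).prodMk (hX.measurable_act hH hst))

lemma measurable_cost (hX : IsRun M φ p K P ℱ X) (hφ : M.IsLinear φ) (hH : 0 < p.H) {s t : ℕ}
    (hst : s ≤ t) : Measurable[ℱ t] fun ω => M.stepCost (X.cur p.H s ω) (X.act p.H s ω) := by
  have h1 : Measurable fun q : Option S × A => M.stepCost q.1 q.2 :=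
    measurable_from_prod_countable_left fun a => SSP.measurable_stepCost hφ a
  exact h1.comp ((hX.measurable_cur hH hst).prodMk (hX.measurable_act hH hst))

lemma measurable_integral_nextLaw (hX : IsRun M φ p K P ℱ X) (hH : 0 < p.H) (t : ℕ)
    {f : Ω × Option S → ℝ} (hf : Measurable[(ℱ t).prod inferInstance] f) :
    Measurable[ℱ t] fun ω => ∫ y, f (ω, y) ∂X.nextLaw M p.H t ω :=
  (M.kernelAt (hX.measurable_cur hH le_rfl) (hX.measurable_act hH le_rfl)).measurable_integral hf

variable [IsProbabilityMeasure P]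

/-- Given the past, the next state follows the transition law. -/
lemma lintegral_next (hX : IsRun M φ p K P ℱ X) (hH : 0 < p.H) (t : ℕ)
    {G : Ω × Option S → ENNReal} (hG : Measurable[(ℱ t).prod inferInstance] G) :
    ∫⁻ ω, G (ω, X.next p.H t ω) ∂P = ∫⁻ ω, ∫⁻ x, G (ω, x) ∂X.nextLaw M p.H t ω ∂P := by
  have hnext : Measurable (X.next p.H t) :=
    (hX.measurable_next hH (Nat.lt_succ_self t)).mono (ℱ.le _) le_rfl
  refine lintegral_eq_of_forall_measure_inter (f := id) (measurable_id'' (ℱ.le t)) hnext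
    (M.kernelAt (hX.measurable_cur hH le_rfl) (hX.measurable_act hH le_rfl)) ?_ hG
  intro F E hF hE
  have htr := hX.transition (t / p.H) (t % p.H) (Nat.mod_lt t hH) E hE
  rw [Nat.div_add_mod'] at htr
  have hint : Integrable (fun ω => E.indicator (fun _ => (1 : ℝ)) (X.next p.H t ω)) P := by
    refine Integrable.of_bound (C := 1)
      ((measurable_const.indicator hE).comp hnext).aestronglyMeasurable (ae_of_all _ fun ω => ?_)
    by_cases h : X.next p.H t ω ∈ E <;> simp [h]
  have e1 := setIntegral_condExp (ℱ.le t) hint hF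
  have e2 : ∫ ω in F, E.indicator (fun _ => (1 : ℝ)) (X.next p.H t ω) ∂P
      = P.real (F ∩ X.next p.H t ⁻¹' E) := by
    have : (fun ω => E.indicator (fun _ => (1 : ℝ)) (X.next p.H t ω))
        = (X.next p.H t ⁻¹' E).indicator fun _ => (1 : ℝ) := rfl
    rw [this, setIntegral_indicator (hnext hE)]
    simp
  have e3 : ∫ ω in F, (P[fun ω => E.indicator (fun _ => (1 : ℝ)) (X.next p.H t ω) | ℱ t]) ω ∂P
      = ∫ ω in F, (X.nextLaw M p.H t ω).real E ∂P :=
    setIntegral_congr_ae (ℱ.le t F hF) (htr.mono fun ω h _ => h)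
  have hm : Measurable fun ω => X.nextLaw M p.H t ω E :=
    ((M.kernelAt (hX.measurable_cur hH le_rfl) (hX.measurable_act hH le_rfl)).measurable_coe
      hE).mono (ℱ.le t) le_rfl
  have e4 : ∫ ω in F, (X.nextLaw M p.H t ω).real E ∂P
      = (∫⁻ ω in F, X.nextLaw M p.H t ω E ∂P).toReal :=
    integral_toReal hm.aemeasurable (ae_of_all _ fun ω => measure_lt_top _ _)
  have e5 : (P (F ∩ X.next p.H t ⁻¹' E)).toReal
      = (∫⁻ ω in F, X.nextLaw M p.H t ω E ∂P).toReal := by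
    rw [← e4, ← e3, e1, e2]; rfl
  have hfin : ∫⁻ ω in F, X.nextLaw M p.H t ω E ∂P ≠ ⊤ := by
    refine ne_top_of_le_ne_top (b := P F) (measure_ne_top _ _) ?_
    calc _ ≤ ∫⁻ ω in F, 1 ∂P := lintegral_mono fun ω => prob_le_one
      _ = P F := by simp
  exact (ENNReal.toReal_eq_toReal_iff' (measure_ne_top _ _) hfin).mp e5

/-- Chernoff's bound for an exponential supermartingale. -/
lemma measure_le_exp_neg (hX : IsRun M φ p K P ℱ X) (hH : 0 < p.H) {E : ℕ → Ω → ℝ}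
    {D : ℕ → Ω × Option S → ℝ} (h0 : ∀ ω, E 0 ω = 0)
    (hD : ∀ t, Measurable[(ℱ t).prod inferInstance] (D t))
    (hED : ∀ t ω, E (t + 1) ω = D t (ω, X.next p.H t ω))
    (hstep : ∀ t ω, ∫⁻ x, ENNReal.ofReal (Real.exp (D t (ω, x))) ∂X.nextLaw M p.H t ω
      ≤ ENNReal.ofReal (Real.exp (E t ω))) (T : ℕ) (L : ℝ) :
    P {ω | L ≤ E T ω} ≤ ENNReal.ofReal (Real.exp (-L)) := by
  have hle : ∀ t, ∫⁻ ω, ENNReal.ofReal (Real.exp (E t ω)) ∂P ≤ 1 := by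
    intro t
    induction t with
    | zero => simp [h0]
    | succ t ih =>
      refine le_trans ?_ ih
      simp only [hED]
      rw [hX.lintegral_next hH t (G := fun q => ENNReal.ofReal (Real.exp (D t q)))
        (Real.measurable_exp.comp (hD t)).ennreal_ofReal]
      exact lintegral_mono fun ω => hstep t ω
  have hm : Measurable (E T) := by
    cases T with
    | zero => simp only [funext h0]; exact measurable_const
    | succ t =>
      have h1 : Measurable[mΩ, (ℱ t).prod inferInstance] fun ω => (ω, X.next p.H t ω) :=
        measurable_prodMk_of_le (ℱ.le t)
          ((hX.measurable_next hH (Nat.lt_succ_self t)).mono (ℱ.le _) le_rfl)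
      exact (funext (hED t) : E (t + 1) = _) ▸ (hD t).comp h1
  have hset : {ω | L ≤ E T ω}
      ⊆ {ω | ENNReal.ofReal (Real.exp L) ≤ ENNReal.ofReal (Real.exp (E T ω))} := fun ω hω =>
    ENNReal.ofReal_le_ofReal (Real.exp_le_exp.mpr hω)
  refine (measure_mono hset).trans ((meas_ge_le_lintegral_div
    (Real.measurable_exp.comp hm).ennreal_ofReal.aemeasurable
    (by simp [Real.exp_pos]) ENNReal.ofReal_ne_top).trans ?_)
  rw [Real.exp_neg, ENNReal.ofReal_inv_of_pos (Real.exp_pos _), ← one_div]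
  exact ENNReal.div_le_div_right (hle T) _

end IsRun

end

/-! ### Azuma's inequality and self-normalized concentration -/

noncomputable section

open Matrix

namespace IsRun

variable {S : Type u} {A : Type v} {Ω : Type w} [MeasurableSpace S] [MeasurableSpace A]
  [Fintype A] [Nonempty A] {mΩ : MeasurableSpace Ω} {d : ℕ}
  {M : SSP S A} {φ : S → A → EuclideanSpace ℝ (Fin d)} {p : FHParams} {K : ℕ} {P : Measure Ω}
  {ℱ : Filtration ℕ mΩ} {X : Trajectory S A Ω} [MeasurableSingletonClass A]
  [IsProbabilityMeasure P]

/-- Azuma's inequality for predictable continuation value functions. -/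
lemma measure_sum_noise_ge_le (hX : IsRun M φ p K P ℱ X) (hH : 0 < p.H)
    {V : ℕ → Ω → Option S → ℝ}
    (hV : ∀ t, Measurable[(ℱ t).prod inferInstance] fun q : Ω × Option S => V t q.1 q.2)
    {b : ℝ} (hb : 0 < b) (hVb : ∀ t ω x, V t ω x ∈ Set.Icc 0 b) {T : ℕ} (hT : 0 < T)
    {L : ℝ} (hL : 0 < L) :
    P {ω | b * √(T * L) ≤ ∑ t ∈ Finset.range T,
      (V t ω (X.next p.H t ω) - ∫ y, V t ω y ∂X.nextLaw M p.H t ω)}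
      ≤ ENNReal.ofReal (Real.exp (-L)) := by
  -- With this `c`, the threshold contributes `2 * L` to the exponent and the variance term costs `L
  -- / 2`, so at least `L` remains.
  set c : ℝ := 2 * √(L / T) / b with hc
  have hnoise : ∀ t, Measurable[(ℱ t).prod inferInstance] fun q : Ω × Option S =>
      V t q.1 q.2 - ∫ y, V t q.1 y ∂X.nextLaw M p.H t q.1 := fun t =>
    (hV t).sub ((hX.measurable_integral_nextLaw hH t (hV t)).comp
      (@measurable_fst _ _ (ℱ t) inferInstance))
  have hsum : ∀ t, Measurable[ℱ t] fun ω => ∑ s ∈ Finset.range t,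
      (c * (V s ω (X.next p.H s ω) - ∫ y, V s ω y ∂X.nextLaw M p.H s ω) - c ^ 2 * b ^ 2 / 8) := by
    intro t
    refine Finset.measurable_sum _ fun s hs => ?_
    have hs := Finset.mem_range.mp hs
    have h1 := (hnoise s).comp (measurable_prodMk_of_le (ℱ.mono hs.le)
      (hX.measurable_next hH hs))
    exact (h1.const_mul c).sub_const _
  have key := hX.measure_le_exp_neg (P := P) hH
    (E := fun t ω => ∑ s ∈ Finset.range t,
      (c * (V s ω (X.next p.H s ω) - ∫ y, V s ω y ∂X.nextLaw M p.H s ω) - c ^ 2 * b ^ 2 / 8))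
    (D := fun t q => ∑ s ∈ Finset.range t,
      (c * (V s q.1 (X.next p.H s q.1) - ∫ y, V s q.1 y ∂X.nextLaw M p.H s q.1)
        - c ^ 2 * b ^ 2 / 8) + (c * (V t q.1 q.2 - ∫ y, V t q.1 y ∂X.nextLaw M p.H t q.1)
        - c ^ 2 * b ^ 2 / 8))
    (by simp)
    (fun t => ((hsum t).comp (@measurable_fst _ _ (ℱ t) inferInstance)).add
      (((hnoise t).const_mul c).sub_const _))
    (fun t ω => by rw [Finset.sum_range_succ]) ?_ T L
  · refine (measure_mono fun ω hω => ?_).trans key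
    simp only [Set.mem_ofPred_eq] at hω ⊢
    rw [Finset.sum_sub_distrib, ← Finset.mul_sum, Finset.sum_const, Finset.card_range,
      nsmul_eq_mul]
    have hT' : (0 : ℝ) < T := by exact_mod_cast hT
    have hc0 : 0 < c := by positivity
    have h1 : c * (b * √(T * L)) = 2 * L := by
      rw [hc, Real.sqrt_div hL.le, Real.sqrt_mul hT'.le]
      field_simp
      rw [Real.sq_sqrt hL.le]
    have h2 : T * (c ^ 2 * b ^ 2 / 8) = L / 2 := by
      rw [hc, div_pow, mul_pow, Real.sq_sqrt (by positivity)]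
      field_simp
      norm_num
    have h3 := mul_le_mul_of_nonneg_left hω hc0.le
    linarith
  · intro t ω
    simp only
    set F := ∑ s ∈ Finset.range t,
      (c * (V s ω (X.next p.H s ω) - ∫ y, V s ω y ∂X.nextLaw M p.H s ω) - c ^ 2 * b ^ 2 / 8)
    have hVm : Measurable (V t ω) := (hV t).comp (@measurable_prodMk_left _ _ (ℱ t) _ ω)
    have h1 := lintegral_exp_mul_sub_integral_le (X.nextLaw M p.H t ω) hVm
      (a := 0) (b := b) (by simpa using hVb t ω) c
    have h2 : ∀ x, ENNReal.ofReal (Real.exp (F + (c * (V t ω x -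
        ∫ y, V t ω y ∂X.nextLaw M p.H t ω) - c ^ 2 * b ^ 2 / 8)))
        = ENNReal.ofReal (Real.exp (F - c ^ 2 * b ^ 2 / 8)) *
          ENNReal.ofReal (Real.exp (c * (V t ω x - ∫ y, V t ω y ∂X.nextLaw M p.H t ω))) := by
      intro x
      rw [← ENNReal.ofReal_mul (Real.exp_pos _).le, ← Real.exp_add]
      ring_nf
    simp only [h2]
    rw [lintegral_const_mul' _ _ ENNReal.ofReal_ne_top]
    refine (mul_le_mul_right h1 _).trans ?_
    rw [← ENNReal.ofReal_mul (Real.exp_pos _).le, ← Real.exp_add]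
    simp

/-- The sum of the noise in the observed continuation values, weighted with the features. -/
def _root_.Trajectory.noiseSum (X : Trajectory S A Ω) (M : SSP S A)
    (φ : S → A → EuclideanSpace ℝ (Fin d)) (H : ℕ) (V : Option S → ℝ) (T : ℕ) (ω : Ω) :
    Fin d → ℝ :=
  ∑ t ∈ Finset.range T, (V (X.next H t ω) - ∫ y, V y ∂X.nextLaw M H t ω) •
    FHSSP.visitedSeq φ (X.record M ω) H t

/-- The self-normalized concentration inequality for a fixed continuation value function. -/
lemma measure_form_noiseSum_le (hX : IsRun M φ p K P ℱ X) (hφ : M.IsLinear φ) (hH : 0 < p.H)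
    {V : Option S → ℝ} (hV : Measurable V) {b : ℝ} (hb : 0 < b)
    (hVb : ∀ x, V x ∈ Set.Icc 0 b) (T : ℕ) (L : ℝ) :
    P {ω | b ^ 2 * ∑ t ∈ Finset.range T, Ridge.gain (FHSSP.visitedSeq φ (X.record M ω) p.H) t
        + b ^ 2 / 2 * L
      ≤ Ridge.form (FHSSP.visitedSeq φ (X.record M ω) p.H) T (X.noiseSum M φ p.H V T ω)}
      ≤ ENNReal.ofReal (Real.exp (-L)) := by
  set v : Ω → ℕ → Fin d → ℝ := fun ω => FHSSP.visitedSeq φ (X.record M ω) p.H with hv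
  set N : ℕ → Ω → Fin d → ℝ := X.noiseSum M φ p.H V with hN
  have hvm : ∀ {s t : ℕ}, s ≤ t → Measurable[ℱ t] fun ω => v ω s := fun hst =>
    hX.measurable_visited hφ hH hst
  have hint : ∀ t, Measurable[ℱ t] fun ω => ∫ y, V y ∂X.nextLaw M p.H t ω := fun t =>
    hX.measurable_integral_nextLaw hH t (f := fun q => V q.2)
      (hV.comp (@measurable_snd _ _ (ℱ t) inferInstance))
  have hNm : ∀ t, Measurable[ℱ t] (N t) := by
    intro t
    simp only [hN]
    unfold Trajectory.noiseSum
    refine Finset.measurable_sum _ fun s hs => ?_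
    have hs := Finset.mem_range.mp hs
    exact ((hV.comp (hX.measurable_next hH hs)).sub
      ((hint s).mono (ℱ.mono hs.le) le_rfl)).smul (hvm hs.le)
  have hgm : ∀ t, Measurable[ℱ t] fun ω => ∑ s ∈ Finset.range (t + 1), Ridge.gain (v ω) s :=
    fun t => Finset.measurable_sum _ fun s hs =>
      @Ridge.measurable_gain _ (ℱ t) _ _ _ fun r hr =>
        hvm (hr.trans (Nat.lt_succ_iff.mp (Finset.mem_range.mp hs)))
  -- The supermartingale exponent is `2 / b ^ 2` times the squared norm of the noise minus `b ^ 2`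
  -- times the accumulated gain. It is verified step by step from the rank-one update, without
  -- averaging over directions.
  have key := hX.measure_le_exp_neg (P := P) hH
    (E := fun t ω => 2 / b ^ 2 * (Ridge.form (v ω) t (N t ω)
      - b ^ 2 * ∑ s ∈ Finset.range t, Ridge.gain (v ω) s))
    (D := fun t q => 2 / b ^ 2 * (Ridge.form (v q.1) (t + 1)
        (N t q.1 + (V q.2 - ∫ y, V y ∂X.nextLaw M p.H t q.1) • v q.1 t)
      - b ^ 2 * ∑ s ∈ Finset.range (t + 1), Ridge.gain (v q.1) s))
    (by simp [hN, Trajectory.noiseSum, Ridge.form]) ?_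
    (fun t ω => by
      have : N (t + 1) ω = N t ω + (V (X.next p.H t ω) - ∫ y, V y ∂X.nextLaw M p.H t ω) • v ω t :=
        Finset.sum_range_succ _ _
      rw [this]) ?_ T L
  · refine (measure_mono fun ω hω => ?_).trans key
    simp only [Set.mem_ofPred_eq] at hω ⊢
    have h1 : b ^ 2 / 2 * L ≤ Ridge.form (v ω) T (N T ω)
      - b ^ 2 * ∑ s ∈ Finset.range T, Ridge.gain (v ω) s := by linarith
    calc L = 2 / b ^ 2 * (b ^ 2 / 2 * L) := by field_simp
      _ ≤ _ := mul_le_mul_of_nonneg_left h1 (by positivity)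
  · intro t
    have hfst : Measurable[(ℱ t).prod inferInstance, ℱ t] (Prod.fst : Ω × Option S → Ω) :=
      @measurable_fst _ _ (ℱ t) inferInstance
    refine Measurable.const_mul (Measurable.sub ?_ (((hgm t).comp hfst).const_mul _)) _
    refine @Ridge.measurable_form _ ((ℱ t).prod inferInstance) _ (fun q => v q.1) _
      (fun s hs => (hvm (Nat.lt_succ_iff.mp hs)).comp hfst) _ ?_
    exact ((hNm t).comp hfst).add (((hV.comp (@measurable_snd _ _ (ℱ t) inferInstance)).sub
      ((hint t).comp hfst)).smul ((hvm le_rfl).comp hfst))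
  · intro t ω
    simp only
    rw [Finset.sum_range_succ]
    set m := ∫ y, V y ∂X.nextLaw M p.H t ω with hm
    set F := Ridge.form (v ω) t (N t ω) with hF
    set G := ∑ s ∈ Finset.range t, Ridge.gain (v ω) s
    set z := v ω t ⬝ᵥ Ridge.inv (v ω) t *ᵥ N t ω with hz
    set u := Ridge.form (v ω) t (v ω t) with hu
    have hu0 : 0 ≤ u := Ridge.form_nonneg _ _ _
    have hb2 : 0 < b ^ 2 := by positivity
    set c := 4 * z / (b ^ 2 * (1 + u)) with hc
    have hgain : 1 - (1 + u)⁻¹ ≤ Ridge.gain (v ω) t :=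
      Real.one_sub_inv_le_log_of_pos (by linarith)
    have hmI : m ∈ Set.Icc 0 b := by
      have hi : Integrable V (X.nextLaw M p.H t ω) :=
        Integrable.of_mem_Icc 0 b hV.aemeasurable (ae_of_all _ hVb)
      constructor
      · exact integral_nonneg fun x => (hVb x).1
      · calc m ≤ ∫ _, b ∂X.nextLaw M p.H t ω :=
              integral_mono hi (integrable_const b) fun x => (hVb x).2
          _ = b := by simp
    -- With noise `η = V x - m`, the form changes by `(2 * η * z - z ^ 2 + η ^ 2 * u) / (1 + u)`.
    -- The quadratic term in `η` is absorbed by the gain, because `u / (1 + u) ≤ log (1 + u)`. The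
    -- linear term is left to Hoeffding's lemma, whose cost `c ^ 2 * b ^ 2 / 8` is then paid by the
    -- term `-z ^ 2`.
    have hpt : ∀ x, 2 / b ^ 2 * (Ridge.form (v ω) (t + 1) (N t ω + (V x - m) • v ω t)
        - b ^ 2 * (G + Ridge.gain (v ω) t))
        ≤ (2 / b ^ 2 * (F - b ^ 2 * G) - 2 / b ^ 2 * (z ^ 2 / (1 + u))) + c * (V x - m) := by
      intro x
      rw [Ridge.form_succ_add_smul, ← hF, ← hz, ← hu]
      have hη : (V x - m) ^ 2 ≤ b ^ 2 :=
        sq_le_sq' (by linarith [(hVb x).1, hmI.2]) (by linarith [(hVb x).2, hmI.1])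
      have h1 : (V x - m) ^ 2 * u / (1 + u) ≤ b ^ 2 * Ridge.gain (v ω) t := by
        have e : u / (1 + u) = 1 - (1 + u)⁻¹ := by field_simp; ring
        rw [mul_div_assoc, e]
        exact mul_le_mul hη hgain (by rw [← e]; positivity) hb2.le
      have e2 : (2 / b ^ 2 * (F - b ^ 2 * G) - 2 / b ^ 2 * (z ^ 2 / (1 + u))) + c * (V x - m)
          - 2 / b ^ 2 * (F + (2 * (V x - m) * z - z ^ 2 + (V x - m) ^ 2 * u) / (1 + u)
            - b ^ 2 * (G + Ridge.gain (v ω) t))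
          = 2 / b ^ 2 * (b ^ 2 * Ridge.gain (v ω) t - (V x - m) ^ 2 * u / (1 + u)) := by
        rw [hc]; field_simp; ring
      have := mul_nonneg (show 0 ≤ 2 / b ^ 2 by positivity) (sub_nonneg.mpr h1)
      linarith
    have h1 := lintegral_exp_mul_sub_integral_le (X.nextLaw M p.H t ω) hV
      (a := 0) (b := b) (by simpa using hVb) c
    calc ∫⁻ x, ENNReal.ofReal (Real.exp (2 / b ^ 2 *
          (Ridge.form (v ω) (t + 1) (N t ω + (V x - m) • v ω t)
          - b ^ 2 * (G + Ridge.gain (v ω) t)))) ∂X.nextLaw M p.H t ω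
        ≤ ∫⁻ x, ENNReal.ofReal (Real.exp
            (2 / b ^ 2 * (F - b ^ 2 * G) - 2 / b ^ 2 * (z ^ 2 / (1 + u)))) *
            ENNReal.ofReal (Real.exp (c * (V x - m))) ∂X.nextLaw M p.H t ω := by
          refine lintegral_mono fun x => ?_
          rw [← ENNReal.ofReal_mul (Real.exp_pos _).le, ← Real.exp_add]
          exact ENNReal.ofReal_le_ofReal (Real.exp_le_exp.mpr (hpt x))
      _ ≤ ENNReal.ofReal (Real.exp
            (2 / b ^ 2 * (F - b ^ 2 * G) - 2 / b ^ 2 * (z ^ 2 / (1 + u)))) *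
            ENNReal.ofReal (Real.exp (c ^ 2 * b ^ 2 / 8)) := by
          rw [lintegral_const_mul' _ _ ENNReal.ofReal_ne_top]
          exact mul_le_mul_right h1 _
      _ ≤ ENNReal.ofReal (Real.exp (2 / b ^ 2 * (F - b ^ 2 * G))) := by
          rw [← ENNReal.ofReal_mul (Real.exp_pos _).le, ← Real.exp_add]
          refine ENNReal.ofReal_le_ofReal (Real.exp_le_exp.mpr ?_)
          have e3 : c ^ 2 * b ^ 2 / 8 = 2 / b ^ 2 * (z ^ 2 / (1 + u)) / (1 + u) := by
            rw [hc]; field_simp; ring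
          have h4 : 2 / b ^ 2 * (z ^ 2 / (1 + u)) / (1 + u) ≤ 2 / b ^ 2 * (z ^ 2 / (1 + u)) :=
            div_le_self (by positivity) (by linarith)
          linarith

end IsRun

end

noncomputable section

open Matrix

/-! ## The class of estimated value functions and its finite nets -/

lemma Finset.abs_inf'_sub_inf'_le {ι : Type*} {s : Finset ι} (hs : s.Nonempty) {f g : ι → ℝ} {ε : ℝ}
    (h : ∀ i ∈ s, |f i - g i| ≤ ε) : |s.inf' hs f - s.inf' hs g| ≤ ε := by
  rw [abs_sub_le_iff]
  constructor
  · rw [sub_le_iff_le_add', ← sub_le_iff_le_add]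
    refine Finset.le_inf' hs _ fun i hi => ?_
    linarith [Finset.inf'_le f hi, (abs_sub_le_iff.mp (h i hi)).1]
  · rw [sub_le_iff_le_add', ← sub_le_iff_le_add]
    refine Finset.le_inf' hs _ fun i hi => ?_
    linarith [Finset.inf'_le g hi, (abs_sub_le_iff.mp (h i hi)).2]

/-- Signs are unrestricted because the bonus matrices of grid points need not be positive
semidefinite. Replacing `y` by its positive part does not change its root. -/
lemma abs_sqrt_sub_sqrt_le {x y : ℝ} : |√x - √y| ≤ √|x - y| := by
  have key : ∀ {x y : ℝ}, √x - √y ≤ √|x - y| := by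
    intro x y
    rw [sub_le_iff_le_add]
    calc √x ≤ √(|x - y| + max y 0) :=
          Real.sqrt_le_sqrt (by linarith [le_abs_self (x - y), le_max_left y 0])
      _ ≤ √|x - y| + √(max y 0) := by
        rw [Real.sqrt_le_left (by positivity)]
        have h1 := Real.sq_sqrt (abs_nonneg (x - y))
        have h2 := Real.sq_sqrt (le_max_right y 0)
        have h3 : 0 ≤ √|x - y| * √(max y 0) := by positivity
        linarith [add_sq (√|x - y|) (√(max y 0))]
      _ = √|x - y| + √y := by
        congr 1
        rcases le_total y 0 with h | h
        · rw [max_eq_right h, Real.sqrt_zero, Real.sqrt_eq_zero_of_nonpos h]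
        · rw [max_eq_left h]
  rw [abs_sub_le_iff]
  exact ⟨key, by rw [abs_sub_comm]; exact key⟩

namespace FHSSP

variable {S : Type u} {A : Type v} {d : ℕ} [Fintype A] [Nonempty A]

/-- The optimistic value function with regression weight `z` and bonus matrix `G`. -/
def greedyValue (φ : S → A → EuclideanSpace ℝ (Fin d)) (b β : ℝ) (z : Fin d → ℝ)
    (G : Matrix (Fin d) (Fin d) ℝ) (x : Option S) : ℝ :=
  Finset.univ.inf' Finset.univ_nonempty fun a => min (max (feature φ x a ⬝ᵥ z
    - β * √(feature φ x a ⬝ᵥ G *ᵥ feature φ x a)) 0) b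

lemma valueToGo_succ (φ : S → A → EuclideanSpace ℝ (Fin d)) (p : FHParams) (r : Record S A)
    (m j : ℕ) : valueToGo φ p r m (j + 1) = greedyValue φ p.B (beta d p m)
      (weight φ p r m (valueToGo φ p r m j)) (gram φ p r m)⁻¹ := rfl

variable {φ : S → A → EuclideanSpace ℝ (Fin d)} {b β : ℝ} {z : Fin d → ℝ}
  {G : Matrix (Fin d) (Fin d) ℝ}

lemma greedyValue_mem (hb : 0 ≤ b) (x : Option S) : greedyValue φ b β z G x ∈ Set.Icc 0 b := by
  constructor
  · exact Finset.le_inf' _ _ fun a _ => le_min (le_max_right _ _) hb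
  · obtain ⟨a⟩ := ‹Nonempty A›
    exact (Finset.inf'_le _ (Finset.mem_univ a)).trans (min_le_right _ _)

lemma greedyValue_none (hb : 0 ≤ b) : greedyValue φ b β z G none = 0 := by
  simp [greedyValue, feature, hb]

lemma measurable_greedyValue [MeasurableSpace S] {M : SSP S A} (hφ : M.IsLinear φ) :
    Measurable (greedyValue φ b β z G) := by
  have hf : ∀ a, Measurable fun x => feature φ x a := fun a =>
    measurable_pi_lambda _ fun i => SSP.measurable_feature hφ a i
  have : greedyValue φ b β z G = Finset.univ.inf' Finset.univ_nonempty fun a x =>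
      min (max (feature φ x a ⬝ᵥ z - β * √(feature φ x a ⬝ᵥ G *ᵥ feature φ x a)) 0) b := by
    ext x
    rw [Finset.inf'_apply]
    rfl
  rw [this]
  refine Finset.inf'_induction _ _ (fun f hf g hg => hf.inf hg) fun a _ => ?_
  have h1 : Measurable fun x => feature φ x a ⬝ᵥ z :=
    Ridge.measurable_dotProduct (hf a) measurable_const
  have h2 : Measurable fun x => feature φ x a ⬝ᵥ G *ᵥ feature φ x a :=
    Ridge.measurable_dotProduct (hf a) (measurable_pi_lambda _ fun i =>
      Ridge.measurable_dotProduct measurable_const (hf a))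
  exact ((h1.sub (h2.sqrt.const_mul β)).max measurable_const).min measurable_const

lemma abs_dotProduct_sub_le {f y y' : Fin d → ℝ} {ξ : ℝ} (hf : ∀ i, |f i| ≤ 1)
    (h : ∀ i, |y i - y' i| ≤ ξ) : |f ⬝ᵥ y - f ⬝ᵥ y'| ≤ d * ξ := by
  rw [← dotProduct_sub]
  calc |f ⬝ᵥ (y - y')| ≤ ∑ i, |f i * (y - y') i| := Finset.abs_sum_le_sum_abs _ _
    _ ≤ ∑ _i : Fin d, ξ := Finset.sum_le_sum fun i _ => by
      rw [abs_mul, Pi.sub_apply]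
      exact (mul_le_of_le_one_left (abs_nonneg _) (hf i)).trans (h i)
    _ = d * ξ := by simp

/-- Truncation and minimum are 1-Lipschitz, and the estimate is Lipschitz in `z`. The bonus is only
Hölder continuous of order one half in `G`, which explains `√ξ` and forces a quadratically fine
mesh. -/
lemma abs_greedyValue_sub_le {z' : Fin d → ℝ} {G' : Matrix (Fin d) (Fin d) ℝ} {ξ : ℝ}
    (hf : ∀ x a i, |feature φ x a i| ≤ 1) (hβ : 0 ≤ β) (hz : ∀ i, |z i - z' i| ≤ ξ)
    (hG : ∀ i j, |G i j - G' i j| ≤ ξ) (x : Option S) :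
    |greedyValue φ b β z G x - greedyValue φ b β z' G' x| ≤ d * ξ + β * (d * √ξ) := by
  refine Finset.abs_inf'_sub_inf'_le _ fun a _ => ?_
  refine (abs_min_sub_min_le_max _ _ _ _).trans ?_
  rw [sub_self, abs_zero, max_eq_left (abs_nonneg _)]
  refine (abs_max_sub_max_le_max _ _ _ _).trans ?_
  rw [sub_self, abs_zero, max_eq_left (abs_nonneg _)]
  set f := feature φ x a with hfdef
  have h1 : |f ⬝ᵥ z - f ⬝ᵥ z'| ≤ d * ξ := abs_dotProduct_sub_le (hf x a) hz
  have h2 : |f ⬝ᵥ G *ᵥ f - f ⬝ᵥ G' *ᵥ f| ≤ d * (d * ξ) := by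
    refine abs_dotProduct_sub_le (hf x a) fun i => ?_
    simp only [mulVec]
    rw [dotProduct_comm, dotProduct_comm (fun j => G' i j)]
    exact abs_dotProduct_sub_le (hf x a) (hG i)
  have h3 : |√(f ⬝ᵥ G *ᵥ f) - √(f ⬝ᵥ G' *ᵥ f)| ≤ d * √ξ := by
    refine abs_sqrt_sub_sqrt_le.trans ((Real.sqrt_le_sqrt h2).trans (le_of_eq ?_))
    rw [← mul_assoc, Real.sqrt_mul (by positivity), Real.sqrt_mul_self (Nat.cast_nonneg d)]
  calc _ = |(f ⬝ᵥ z - f ⬝ᵥ z') - β * (√(f ⬝ᵥ G *ᵥ f) - √(f ⬝ᵥ G' *ᵥ f))| := by ring_nf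
    _ ≤ |f ⬝ᵥ z - f ⬝ᵥ z'| + |β * (√(f ⬝ᵥ G *ᵥ f) - √(f ⬝ᵥ G' *ᵥ f))| := abs_sub _ _
    _ ≤ _ := by
      rw [abs_mul, abs_of_nonneg hβ]
      gcongr

/-- Integer grid points with coordinates bounded by `N`, for all parameters of a value function. -/
def net (d : ℕ) (N : ℕ) : Finset (Fin d ⊕ Fin d × Fin d → ℤ) :=
  Fintype.piFinset fun _ => Finset.Icc (-(N : ℤ)) N

lemma card_net (d N : ℕ) : (net d N).card = (2 * N + 1) ^ (d + d * d) := by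
  rw [net, Fintype.card_piFinset]
  simp only [Int.card_Icc, Finset.prod_const, Finset.card_univ, Fintype.card_sum,
    Fintype.card_prod, Fintype.card_fin]
  congr 1
  omega

/-- The value function of a grid point, for the mesh `ξ`. -/
def netValue (φ : S → A → EuclideanSpace ℝ (Fin d)) (b β ξ : ℝ)
    (k : Fin d ⊕ Fin d × Fin d → ℤ) : Option S → ℝ :=
  greedyValue φ b β (fun i => ξ * k (.inl i)) (Matrix.of fun i j => ξ * k (.inr (i, j)))

/-- Every coordinate is rounded down to a multiple of the mesh. The bonus coefficient is not
discretized, since it is fixed within an interval. -/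
lemma exists_mem_net {ξ R : ℝ} (hξ : 0 < ξ)
    (hf : ∀ x a i, |feature φ x a i| ≤ 1) (hβ : 0 ≤ β) (hz : ∀ i, |z i| ≤ R)
    (hG : ∀ i j, |G i j| ≤ R) :
    ∃ k ∈ net d ⌈R / ξ⌉₊, ∀ x,
      |greedyValue φ b β z G x - netValue φ b β ξ k x| ≤ d * ξ + β * (d * √ξ) := by
  have round : ∀ y : ℝ, |y - ξ * ⌊y / ξ⌋| ≤ ξ := by
    intro y
    have h1 := Int.floor_le (y / ξ)
    have h2 := Int.lt_floor_add_one (y / ξ)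
    rw [le_div_iff₀ hξ] at h1
    rw [div_lt_iff₀ hξ] at h2
    rw [abs_le]
    constructor <;> nlinarith
  have bound : ∀ y : ℝ, |y| ≤ R →
      ⌊y / ξ⌋ ∈ Finset.Icc (-(⌈R / ξ⌉₊ : ℤ)) ⌈R / ξ⌉₊ := by
    intro y hy
    have hy := abs_le.mp hy
    have hc := Nat.le_ceil (R / ξ)
    rw [Finset.mem_Icc]
    constructor
    · rw [Int.le_floor]
      push_cast
      have : -(R / ξ) ≤ y / ξ := by rw [← neg_div]; gcongr; exact hy.1
      linarith
    · have : y / ξ ≤ (⌈R / ξ⌉₊ : ℤ) := by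
        push_cast
        exact (div_le_div_of_nonneg_right hy.2 hξ.le).trans hc
      exact_mod_cast (Int.floor_le _).trans this
  refine ⟨Sum.elim (fun i => ⌊z i / ξ⌋) fun q => ⌊G q.1 q.2 / ξ⌋, ?_, fun x => ?_⟩
  · rw [net, Fintype.mem_piFinset]
    rintro (i | ⟨i, j⟩)
    · exact bound _ (hz i)
    · exact bound _ (hG i j)
  · exact abs_greedyValue_sub_le hf hβ (fun i => round _) (fun i j => round _) x

end FHSSP

namespace SSP

lemma abs_feature_le {S : Type u} {A : Type v} [MeasurableSpace S] {M : SSP S A} {d : ℕ}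
    {φ : S → A → EuclideanSpace ℝ (Fin d)} (hφ : M.IsLinear φ) (x : Option S) (a : A) (i : Fin d) :
    |FHSSP.feature φ x a i| ≤ 1 := by
  have h := feature_dotProduct_self_le hφ x a
  rw [← sq_le_one_iff_abs_le_one, sq]
  exact (Finset.single_le_sum (f := fun i => FHSSP.feature φ x a i * FHSSP.feature φ x a i)
    (fun j _ => mul_self_nonneg _) (Finset.mem_univ i)).trans h

end SSP

end

noncomputable section

open Matrix

/-! ## Confidence bounds -/

namespace FHSSP

variable {S : Type u} {A : Type v} {d : ℕ} [Fintype A] [Nonempty A]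
  {φ : S → A → EuclideanSpace ℝ (Fin d)} {p : FHParams}

lemma terminalCost_mem (h0 : 0 ≤ p.cf) (h1 : p.cf ≤ p.B) (x : Option S) :
    terminalCost p x ∈ Set.Icc 0 p.B := by
  cases x with
  | none => exact ⟨le_rfl, h0.trans h1⟩
  | some s => exact ⟨h0, h1⟩

lemma valueToGo_mem (h0 : 0 ≤ p.cf) (h1 : p.cf ≤ p.B) (r : Record S A) (m j : ℕ) (x : Option S) :
    valueToGo φ p r m j x ∈ Set.Icc 0 p.B := by
  cases j with
  | zero => exact terminalCost_mem h0 h1 x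
  | succ j => rw [valueToGo_succ]; exact greedyValue_mem (h0.trans h1) x

lemma valueToGo_none (hB : 0 ≤ p.B) (r : Record S A) (m j : ℕ) :
    valueToGo φ p r m j none = 0 := by
  cases j with
  | zero => rfl
  | succ j => rw [valueToGo_succ]; exact greedyValue_none hB

lemma measurable_terminalCost [MeasurableSpace S] :
    Measurable (terminalCost p : Option S → ℝ) :=
  measurable_option_iff.mpr measurable_const

lemma measurable_valueToGo [MeasurableSpace S] {M : SSP S A} (hφ : M.IsLinear φ) (r : Record S A)
    (m j : ℕ) : Measurable (valueToGo φ p r m j) := by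
  cases j with
  | zero => exact measurable_terminalCost
  | succ j => rw [valueToGo_succ]; exact measurable_greedyValue hφ

end FHSSP

namespace SSP

variable {S : Type u} {A : Type v} [MeasurableSpace S]

/-- The expected value of `V` at the state reached from `x` with action `a`. -/
def expect (M : SSP S A) (V : Option S → ℝ) (x : Option S) (a : A) : ℝ := ∫ y, V y ∂M.step a x

end SSP

namespace Trajectory

open FHSSP

variable {S : Type u} {A : Type v} {Ω : Type w} [MeasurableSpace S] {d : ℕ}
  {M : SSP S A} {φ : S → A → EuclideanSpace ℝ (Fin d)}

/-- This transfers concentration from a net point to a nearby function. Each noise term moves by at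
most `2 * ε` and features have coordinates at most one. The form is at most the squared Euclidean
norm, and the factors `2` come from the parallelogram law. -/
lemma form_noiseSum_le (X : Trajectory S A Ω) (hφ : M.IsLinear φ) (H T : ℕ) (ω : Ω)
    {V V' : Option S → ℝ} (hV : Measurable V) (hV' : Measurable V') {b ε : ℝ}
    (hb : ∀ x, V x ∈ Set.Icc 0 b) (hb' : ∀ x, V' x ∈ Set.Icc 0 b) (h : ∀ x, |V x - V' x| ≤ ε) :
    Ridge.form (visitedSeq φ (X.record M ω) H) T (X.noiseSum M φ H V T ω)
      ≤ 2 * Ridge.form (visitedSeq φ (X.record M ω) H) T (X.noiseSum M φ H V' T ω)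
        + 2 * (d * (T * (2 * ε)) ^ 2) := by
  set v := visitedSeq φ (X.record M ω) H
  set Δ := X.noiseSum M φ H V T ω - X.noiseSum M φ H V' T ω with hΔ
  have hε : 0 ≤ ε := (abs_nonneg _).trans (h none)
  have hcoord : ∀ i, |Δ i| ≤ T * (2 * ε) := by
    intro i
    have e : Δ i = ∑ t ∈ Finset.range T, ((V (X.next H t ω) - V' (X.next H t ω))
        - ∫ y, (V y - V' y) ∂X.nextLaw M H t ω) * v t i := by
      simp only [hΔ, noiseSum, Pi.sub_apply, Finset.sum_apply, Pi.smul_apply, smul_eq_mul]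
      rw [← Finset.sum_sub_distrib]
      refine Finset.sum_congr rfl fun t _ => ?_
      rw [integral_sub (Integrable.of_mem_Icc 0 b hV.aemeasurable (ae_of_all _ hb))
        (Integrable.of_mem_Icc 0 b hV'.aemeasurable (ae_of_all _ hb'))]
      ring
    rw [e]
    refine (Finset.abs_sum_le_sum_abs _ _).trans ?_
    calc _ ≤ ∑ _t ∈ Finset.range T, 2 * ε := by
          refine Finset.sum_le_sum fun t _ => ?_
          rw [abs_mul]
          refine (mul_le_of_le_one_right (abs_nonneg _)
            (SSP.abs_feature_le hφ (X.cur H t ω) (X.act H t ω) i)).trans ?_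
          refine (abs_sub _ _).trans ?_
          have : |∫ y, (V y - V' y) ∂X.nextLaw M H t ω| ≤ ε := by
            simpa using norm_integral_le_of_norm_le_const (μ := X.nextLaw M H t ω)
              (f := fun y => V y - V' y) (C := ε) (ae_of_all _ h)
          linarith [h (X.next H t ω)]
      _ = T * (2 * ε) := by simp
  have hself : Δ ⬝ᵥ Δ ≤ d * (T * (2 * ε)) ^ 2 := by
    calc Δ ⬝ᵥ Δ ≤ ∑ _i : Fin d, (T * (2 * ε)) ^ 2 := Finset.sum_le_sum fun i _ => by
          rw [← sq, ← sq_abs]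
          exact pow_le_pow_left₀ (abs_nonneg _) (hcoord i) 2
      _ = _ := by simp
  have := Ridge.form_add_le v T (X.noiseSum M φ H V' T ω) Δ
  rw [hΔ, add_sub_cancel, ← hΔ] at this
  linarith [Ridge.form_le v T Δ]

variable {p : FHParams}

/-- The regression targets are `v t ⬝ᵥ z` plus noise. The estimate therefore differs from `z` by the
inverse Gram matrix applied to the noise sum minus the ridge bias `z`, and both parts are bounded by
Cauchy–Schwarz in the form. -/
lemma abs_weight_sub_le (X : Trajectory S A Ω) (hφ : M.IsLinear φ) (hH : 0 < p.H) (m : ℕ) (ω : Ω)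
    {V : Option S → ℝ} (hV : Measurable V) {b : ℝ}
    (hb : ∀ x, V x ∈ Set.Icc 0 b) (h0 : V none = 0) (x : Option S) (a : A) :
    |feature φ x a ⬝ᵥ weight φ p (X.record M ω) m V - (M.stepCost x a + M.expect V x a)|
      ≤ (√(Ridge.form (visitedSeq φ (X.record M ω) p.H) (m * p.H)
          (X.noiseSum M φ p.H V (m * p.H) ω)) + √d * (1 + b))
        * √(Ridge.form (visitedSeq φ (X.record M ω) p.H) (m * p.H) (feature φ x a)) := by
  obtain ⟨z, hz, hz'⟩ := SSP.exists_weight hφ hV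
    (fun x => by rw [abs_of_nonneg (hb x).1]; exact (hb x).2) h0
  have hbn : 0 ≤ b := (hb none).1.trans (hb none).2
  set v := visitedSeq φ (X.record M ω) p.H with hv
  set T := m * p.H
  set f := feature φ x a
  have hgram : Ridge.gram v T *ᵥ z = z + ∑ t ∈ Finset.range T, (v t ⬝ᵥ z) • v t := by
    rw [Ridge.gram, add_mulVec, one_mulVec, sum_mulVec]
    congr 1
    refine Finset.sum_congr rfl fun t _ => ?_
    rw [vecMulVec_mulVec, op_smul_eq_smul]
  have hsum : ∑ t ∈ Finset.range T, ((X.record M ω).cost (t / p.H) (t % p.H)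
      + V ((X.record M ω).state (t / p.H) (t % p.H + 1))) • v t
      = X.noiseSum M φ p.H V T ω + (Ridge.gram v T *ᵥ z - z) := by
    rw [hgram, add_sub_cancel_left, noiseSum, ← Finset.sum_add_distrib]
    refine Finset.sum_congr rfl fun t _ => ?_
    have e : v t ⬝ᵥ z = M.stepCost (X.cur p.H t ω) (X.act p.H t ω)
      + ∫ y, V y ∂X.nextLaw M p.H t ω := hz' _ _
    rw [← hv, e, ← add_smul]
    congr 1
    simp only [record, cur, act, next]
    ring
  have key : f ⬝ᵥ weight φ p (X.record M ω) m V - (M.stepCost x a + M.expect V x a)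
      = f ⬝ᵥ Ridge.inv v T *ᵥ X.noiseSum M φ p.H V T ω - f ⬝ᵥ Ridge.inv v T *ᵥ z := by
    rw [weight_eq _ _ _ _ _ hH, ← hv, hsum, mulVec_add, mulVec_sub, mulVec_mulVec,
      Ridge.inv_mul_gram, one_mulVec, dotProduct_add, dotProduct_sub, hz' x a, SSP.expect]
    ring
  rw [key]
  have h1 := Ridge.abs_dotProduct_inv_le v T f (X.noiseSum M φ p.H V T ω)
  have h2 := Ridge.abs_dotProduct_inv_le v T f z
  have h3 : √(Ridge.form v T z) ≤ √d * (1 + b) := by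
    rw [← Real.sqrt_sq (show 0 ≤ 1 + b by linarith), ← Real.sqrt_mul (Nat.cast_nonneg d)]
    exact Real.sqrt_le_sqrt ((Ridge.form_le v T z).trans hz)
  calc _ ≤ |f ⬝ᵥ Ridge.inv v T *ᵥ X.noiseSum M φ p.H V T ω| + |f ⬝ᵥ Ridge.inv v T *ᵥ z| :=
        abs_sub _ _
    _ ≤ √(Ridge.form v T f) * √(Ridge.form v T (X.noiseSum M φ p.H V T ω))
        + √(Ridge.form v T f) * (√d * (1 + b)) :=
        add_le_add h1 (h2.trans (mul_le_mul_of_nonneg_left h3 (Real.sqrt_nonneg _)))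
    _ = _ := by ring

/-- A crude bound, needed only to place the regression weights in the box covered by the net. -/
lemma abs_weight_le (X : Trajectory S A Ω) (hφ : M.IsLinear φ) (hH : 0 < p.H) (m : ℕ) (ω : Ω)
    {V : Option S → ℝ} {b : ℝ} (hb : ∀ x, V x ∈ Set.Icc 0 b) (i : Fin d) :
    |weight φ p (X.record M ω) m V i| ≤ (m * p.H : ℕ) * (1 + b) := by
  rw [weight_eq _ _ _ _ _ hH, ← single_one_dotProduct i (Ridge.inv _ _ *ᵥ _), mulVec_sum, dotProduct_sum]
  refine (Finset.abs_sum_le_sum_abs _ _).trans ?_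
  calc _ ≤ ∑ _t ∈ Finset.range (m * p.H), (1 + b) := by
        refine Finset.sum_le_sum fun t _ => ?_
        rw [mulVec_smul, dotProduct_smul, smul_eq_mul, abs_mul]
        have h1 := SSP.stepCost_mem (M := M) (X.cur p.H t ω) (X.act p.H t ω)
        have h2 := hb (X.next p.H t ω)
        have h3 : |(X.record M ω).cost (t / p.H) (t % p.H)
            + V ((X.record M ω).state (t / p.H) (t % p.H + 1))| ≤ 1 + b :=
          (abs_of_nonneg (add_nonneg h1.1 h2.1)).trans_le (add_le_add h1.2 h2.2)
        refine (mul_le_of_le_one_right (abs_nonneg _) ?_).trans h3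
        refine (Ridge.abs_dotProduct_inv_le _ _ _ _).trans
          (mul_le_one₀ ?_ (Real.sqrt_nonneg _) ?_)
        · rw [Real.sqrt_le_one]
          exact (Ridge.form_le _ _ _).trans (by simp)
        · rw [Real.sqrt_le_one]
          exact (Ridge.form_le _ _ _).trans (SSP.feature_dotProduct_self_le hφ _ _)
    _ = _ := by rw [Finset.sum_const, Finset.card_range, nsmul_eq_mul]

variable [Fintype A] [Nonempty A]

/-- All regression estimates are accurate up to the bonus. -/
def Confident (X : Trajectory S A Ω) (M : SSP S A) (φ : S → A → EuclideanSpace ℝ (Fin d))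
    (p : FHParams) (ω : Ω) : Prop :=
  ∀ m j x a, |feature φ x a ⬝ᵥ weight φ p (X.record M ω) m (valueToGo φ p (X.record M ω) m j)
      - (M.stepCost x a + M.expect (valueToGo φ p (X.record M ω) m j) x a)|
    ≤ beta d p m * √(Ridge.form (visitedSeq φ (X.record M ω) p.H) (m * p.H) (feature φ x a))

end Trajectory

/-! ## Numerical estimates for the confidence radius -/

section Numerical

variable {B n δ : ℝ} {d : ℕ}

lemma two_le_log (hB : 3 ≤ B) (hn : 1 ≤ n) (hd : 2 ≤ d) (hδ : 0 < δ) (hδ1 : δ < 1) :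
    2 ≤ Real.log (16 * B * n * d / δ) ∧ 16 * (B * n * d) ≤ 16 * B * n * d / δ
      ∧ 6 ≤ B * n * d := by
  have hd' : (2 : ℝ) ≤ d := by exact_mod_cast hd
  have h1 : 3 ≤ B * n := by nlinarith
  have h2 : 6 ≤ B * n * d := by nlinarith
  have h3 : 16 * (B * n * d) ≤ 16 * B * n * d / δ := by
    rw [le_div_iff₀ hδ]
    nlinarith
  refine ⟨?_, h3, h2⟩
  rw [Real.le_log_iff_exp_le (by linarith)]
  have : Real.exp 2 ≤ 9 := by
    rw [show (2 : ℝ) = 1 + 1 by norm_num, Real.exp_add]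
    have := Real.exp_one_lt_d9
    have := Real.exp_pos 1
    nlinarith
  linarith

/-- With the mesh `1 / (β * d * n) ^ 2`, the number of grid points per coordinate is polynomial in
the argument of the logarithm in `β`, so its logarithm is a multiple of the one already present. -/
lemma two_mul_card_add_one_le (hB : 3 ≤ B) (hn : 1 ≤ n) (hd : 2 ≤ d) (hδ : 0 < δ) (hδ1 : δ < 1)
    {β ξ : ℝ} (hβ : β = 50 * d * B * √(Real.log (16 * B * n * d / δ)))
    (hξ : ξ = 1 / (β * d * n) ^ 2) :
    (2 * ⌈2 * B * n / ξ⌉₊ + 1 : ℝ) ≤ (16 * B * n * d / δ) ^ 5 := by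
  obtain ⟨h2, hY, hw⟩ := two_le_log hB hn hd hδ hδ1
  set Y := 16 * B * n * d / δ
  set L := Real.log Y with hL
  have hY0 : 0 < Y := by linarith
  have hLY : L ≤ Y := Real.log_le_self hY0.le
  have hd' : (2 : ℝ) ≤ d := by exact_mod_cast hd
  have e : 2 * B * n / ξ = 5000 * (B * n * d) ^ 3 * d * L := by
    rw [hξ, one_div, div_inv_eq_mul, hβ, mul_pow, mul_pow, mul_pow, Real.sq_sqrt (by linarith)]
    ring
  have hc : (⌈2 * B * n / ξ⌉₊ : ℝ) ≤ 2 * B * n / ξ + 1 := by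
    refine (Nat.ceil_lt_add_one ?_).le
    rw [e]
    positivity
  set q := B * n * d
  have hdq : (d : ℝ) ≤ q := by
    have : 1 ≤ B * n := by nlinarith
    exact le_mul_of_one_le_left (by linarith) this
  have h5 : (16 * q) ^ 4 * Y ≤ Y ^ 5 := by
    rw [show Y ^ 5 = Y ^ 4 * Y by ring]
    gcongr
  have h6 : q ^ 3 * d * L ≤ q ^ 4 * Y := by
    rw [show q ^ 4 = q ^ 3 * q by ring]
    gcongr
  have h7 : 1 ≤ q ^ 4 * Y := one_le_mul_of_one_le_of_one_le (one_le_pow₀ (by linarith)) (by linarith)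
  rw [e] at hc
  calc (2 * ⌈2 * B * n / ξ⌉₊ + 1 : ℝ) ≤ 10000 * (q ^ 3 * d * L) + 3 := by rw [e]; linarith
    _ ≤ 65536 * (q ^ 4 * Y) := by linarith
    _ = (16 * q) ^ 4 * Y := by ring
    _ ≤ Y ^ 5 := h5

/-- The `d + d * d` coordinates contribute `5` logarithms each, the union over intervals at most `3`
more. This entropy of order `d ^ 2` is why the bonus is proportional to `d`. -/
lemma log_card_le (hB : 3 ≤ B) (hn : 1 ≤ n) (hd : 2 ≤ d) (hδ : 0 < δ) (hδ1 : δ < 1)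
    {β ξ : ℝ} (hβ : β = 50 * d * B * √(Real.log (16 * B * n * d / δ)))
    (hξ : ξ = 1 / (β * d * n) ^ 2) {m : ℕ} (hm : (m + 1 : ℝ) ≤ n) :
    Real.log (((FHSSP.net d ⌈2 * B * n / ξ⌉₊).card + 1) * ((m + 1) * (m + 2)) / δ)
      ≤ 9 * d ^ 2 * Real.log (16 * B * n * d / δ) := by
  obtain ⟨h2, hY, hw⟩ := two_le_log hB hn hd hδ hδ1
  have hcard := two_mul_card_add_one_le hB hn hd hδ hδ1 hβ hξ
  set Y := 16 * B * n * d / δ with hYdef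
  have hY1 : 2 ≤ Y := by linarith
  have hd' : (2 : ℝ) ≤ d := by exact_mod_cast hd
  rw [FHSSP.card_net]
  push_cast
  set N : ℝ := 2 * ⌈2 * B * n / ξ⌉₊ + 1
  have e1 : N ^ (d + d * d) + 1 ≤ Y ^ (5 * (d + d * d) + 1) := by
    calc N ^ (d + d * d) + 1 ≤ (Y ^ 5) ^ (d + d * d) + 1 := by gcongr
      _ = Y ^ (5 * (d + d * d)) + 1 := by rw [pow_mul]
      _ ≤ Y ^ (5 * (d + d * d)) * 2 := by
        linarith [one_le_pow₀ (n := 5 * (d + d * d)) (by linarith : 1 ≤ Y)]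
      _ ≤ Y ^ (5 * (d + d * d)) * Y := by gcongr
      _ = _ := by rw [pow_succ]
  have e2 : ((m + 1) * (m + 2)) / δ ≤ Y ^ 2 := by
    have hBd : 2 ≤ B * d := by nlinarith
    have h1 : 2 * n ≤ B * n * d := by
      calc 2 * n ≤ B * d * n := by gcongr
        _ = B * n * d := by ring
    have h3 : 2 * n / δ ≤ Y := by
      rw [hYdef]
      refine div_le_div_of_nonneg_right ?_ hδ.le
      linarith
    calc ((m + 1) * (m + 2)) / δ ≤ (n * (2 * n)) / δ := by gcongr; linarith
      _ = n * (2 * n / δ) := by ring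
      _ ≤ Y * Y := by gcongr; linarith
      _ = Y ^ 2 := by ring
  have hN0 : 0 ≤ N := by positivity
  rw [mul_div_assoc]
  calc Real.log ((N ^ (d + d * d) + 1) * (((m + 1) * (m + 2)) / δ))
      ≤ Real.log (Y ^ (5 * (d + d * d) + 1) * Y ^ 2) := by
        refine Real.log_le_log (by positivity) ?_
        gcongr
    _ = (5 * (d + d * d) + 3) * Real.log Y := by
        rw [← pow_add, Real.log_pow]
        push_cast
        ring
    _ ≤ 9 * d ^ 2 * Real.log Y := by
        gcongr
        nlinarith

/-- The mesh makes the approximation error at most `2 / n`, so discretization adds only `32 * d` to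
`F`. The net term dominates and gives `√F ≤ 4 * d * B * √X`; the ridge bias adds `2 * d * B * √X`,
still far below the factor `50`. -/
lemma confidence_radius_le (hB : 3 ≤ B) (hn : 1 ≤ n) (hd : 2 ≤ d) (hδ : 0 < δ) (hδ1 : δ < 1)
    {β ξ g F L T : ℝ} (hβ : β = 50 * d * B * √(Real.log (16 * B * n * d / δ)))
    (hξ : ξ = 1 / (β * d * n) ^ 2) (hT0 : 0 ≤ T) (hT : T ≤ n) (hg : g ≤ d * Real.log (d + T))
    (hL : L ≤ 9 * d ^ 2 * Real.log (16 * B * n * d / δ))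
    (hF : F ≤ 2 * (B ^ 2 * g + B ^ 2 / 2 * L)
      + 2 * (d * (T * (2 * (d * ξ + β * (d * √ξ)))) ^ 2)) :
    √F + √d * (1 + B) ≤ β := by
  obtain ⟨h2, hY, hw⟩ := two_le_log hB hn hd hδ hδ1
  have hd' : (2 : ℝ) ≤ d := by exact_mod_cast hd
  have hg' : g ≤ d * Real.log (16 * B * n * d / δ) := by
    refine hg.trans ?_
    gcongr
    have h3 : (d : ℝ) ≤ n * d := le_mul_of_one_le_left (by linarith) hn
    have h4 : n ≤ n * d := le_mul_of_one_le_right (by linarith) (by linarith)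
    have h5 : n * d ≤ B * n * d := by
      rw [mul_assoc]
      exact le_mul_of_one_le_left (by positivity) (by linarith)
    linarith
  set X := Real.log (16 * B * n * d / δ)
  have hX1 : 1 ≤ √X := Real.one_le_sqrt.mpr (by linarith)
  have hβ1 : 1 ≤ β := by
    rw [hβ]
    have : 1 ≤ 50 * d * B := by nlinarith
    exact one_le_mul_of_one_le_of_one_le this hX1
  have hε : d * ξ + β * (d * √ξ) ≤ 2 / n := by
    have h1 : √ξ = 1 / (β * d * n) := by
      rw [hξ, Real.sqrt_div zero_le_one, Real.sqrt_one, Real.sqrt_sq (by positivity)]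
    have h3 : β * (d * √ξ) = 1 / n := by
      rw [h1]
      field_simp
    have h4 : d * ξ ≤ 1 / n := by
      have e : d * ξ = 1 / n * (1 / (β * β * d * n)) := by
        rw [hξ]
        field_simp
      rw [e]
      refine mul_le_of_le_one_right (by positivity) ?_
      rw [div_le_one (by positivity)]
      exact one_le_mul_of_one_le_of_one_le (one_le_mul_of_one_le_of_one_le
        (one_le_mul_of_one_le_of_one_le hβ1 hβ1) (by linarith)) hn
    calc _ ≤ 1 / n + 1 / n := add_le_add h4 h3.le
      _ = 2 / n := by ring
  have hξ0 : 0 ≤ ξ := by rw [hξ]; positivity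
  have hTε : (T * (2 * (d * ξ + β * (d * √ξ)))) ^ 2 ≤ 16 := by
    have h0 : 0 ≤ T * (2 * (d * ξ + β * (d * √ξ))) := by positivity
    have h1 : T * (2 * (d * ξ + β * (d * √ξ))) ≤ 4 := by
      calc _ ≤ n * (2 * (2 / n)) := by gcongr
        _ = 4 := by field_simp; norm_num
    calc _ ≤ (4 : ℝ) ^ 2 := pow_le_pow_left₀ h0 h1 2
      _ = 16 := by norm_num
  have hF' : F ≤ (4 * (d * B) * √X) ^ 2 := by
    rw [mul_pow, Real.sq_sqrt (by linarith)]
    have h3 : (d : ℝ) * (T * (2 * (d * ξ + β * (d * √ξ)))) ^ 2 ≤ d * 16 := by gcongr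
    have h4 : B ^ 2 * g ≤ B ^ 2 * (d * X) := by gcongr
    have h5 : B ^ 2 / 2 * L ≤ B ^ 2 / 2 * (9 * d ^ 2 * X) := by gcongr
    have h6 : 2 * (B ^ 2 * (d * X)) ≤ B ^ 2 * (d ^ 2 * X) := by
      have h9 : 2 * (d : ℝ) ≤ d ^ 2 := by nlinarith
      calc 2 * (B ^ 2 * (d * X)) = B ^ 2 * (2 * d * X) := by ring
        _ ≤ _ := by gcongr
    have h7 : 32 * (d : ℝ) ≤ B ^ 2 * (d ^ 2 * X) := by
      have h9 : (9 : ℝ) ≤ B ^ 2 := by nlinarith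
      have h10 : 2 * (d : ℝ) ≤ d ^ 2 := by nlinarith
      calc 32 * (d : ℝ) ≤ 9 * (2 * d * 2) := by linarith
        _ ≤ _ := by gcongr
    have e1 : (4 * (d * B)) ^ 2 * X = 16 * (B ^ 2 * (d ^ 2 * X)) := by ring
    have e2 : B ^ 2 / 2 * (9 * d ^ 2 * X) = 9 / 2 * (B ^ 2 * (d ^ 2 * X)) := by ring
    have h8 : 0 ≤ B ^ 2 * (d ^ 2 * X) := by positivity
    rw [e1]
    rw [e2] at h5
    linarith
  have h3 : √F ≤ 4 * (d * B) * √X := by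
    refine (Real.sqrt_le_sqrt hF').trans (Real.sqrt_sq ?_).le
    positivity
  have h4 : √(d : ℝ) ≤ d := by
    rw [Real.sqrt_le_left (by linarith), sq]
    exact le_mul_of_one_le_left (by linarith) (by linarith)
  have h5 : √(d : ℝ) * (1 + B) ≤ 2 * (d * B) * √X := by
    calc √(d : ℝ) * (1 + B) ≤ d * (2 * B) := by gcongr; linarith
      _ ≤ d * (2 * B) * √X := le_mul_of_one_le_right (by positivity) hX1
      _ = _ := by ring
  rw [hβ]
  have : 0 ≤ d * B * √X := by positivity
  linarith

end Numerical

end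

/-! ### The two events of high probability -/

noncomputable section

open Matrix

lemma tsum_ofReal_div_mul_le {δ : ℝ} (hδ : 0 ≤ δ) :
    ∑' m : ℕ, ENNReal.ofReal (δ / ((m + 1) * (m + 2))) ≤ ENNReal.ofReal δ := by
  refine ENNReal.tsum_le_of_sum_range_le fun n => ?_
  rw [← ENNReal.ofReal_sum_of_nonneg fun m _ => by positivity]
  refine ENNReal.ofReal_le_ofReal ?_
  have : ∑ m ∈ Finset.range n, δ / ((m + 1) * (m + 2) : ℝ) = δ - δ / (n + 1) := by
    induction n with
    | zero => simp
    | succ n ih =>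
      rw [Finset.sum_range_succ, ih]
      push_cast
      field_simp
      ring
  rw [this]
  linarith [show 0 ≤ δ / (n + 1) by positivity]

namespace IsRun

open FHSSP

variable {S : Type u} {A : Type v} {Ω : Type w} [MeasurableSpace S] [MeasurableSpace A]
  [Fintype A] [Nonempty A] {mΩ : MeasurableSpace Ω} {d : ℕ}
  {M : SSP S A} {φ : S → A → EuclideanSpace ℝ (Fin d)} {p : FHParams} {K : ℕ} {P : Measure Ω}
  {ℱ : Filtration ℕ mΩ} {X : Trajectory S A Ω} [MeasurableSingletonClass A]

/-- The estimated value functions of an interval depend measurably on the past of the interval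
and on the state. -/
lemma measurable_valueToGo (hX : IsRun M φ p K P ℱ X) (hφ : M.IsLinear φ) (hH : 0 < p.H)
    {m t : ℕ} (ht : m * p.H ≤ t) (j : ℕ) :
    Measurable[(ℱ t).prod inferInstance] fun q : Ω × Option S =>
      valueToGo φ p (X.record M q.1) m j q.2 := by
  have hsnd : Measurable[(ℱ t).prod inferInstance] (Prod.snd : Ω × Option S → Option S) :=
    @measurable_snd _ _ (ℱ t) inferInstance
  have hfst : Measurable[(ℱ t).prod inferInstance, ℱ t] (Prod.fst : Ω × Option S → Ω) :=
    @measurable_fst _ _ (ℱ t) inferInstance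
  have hv : ∀ s < m * p.H, Measurable[ℱ t] fun ω => visitedSeq φ (X.record M ω) p.H s :=
    fun s hs => hX.measurable_visited hφ hH (hs.le.trans ht)
  induction j with
  | zero => exact measurable_terminalCost.comp hsnd
  | succ j ih =>
    have hw : Measurable[ℱ t] fun ω =>
        weight φ p (X.record M ω) m (valueToGo φ p (X.record M ω) m j) := by
      simp only [weight_eq _ _ _ _ _ hH]
      refine Ridge.measurable_inv_mulVec hv (Finset.measurable_sum _ fun s hs => ?_)
      have hs := Finset.mem_range.mp hs
      exact ((hX.measurable_cost hφ hH (hs.le.trans ht)).add (ih.comp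
        (measurable_prodMk_of_le le_rfl (hX.measurable_next hH (hs.trans_le ht))))).smul (hv s hs)
    have hf : ∀ a, Measurable[(ℱ t).prod inferInstance] fun q : Ω × Option S =>
        feature φ q.2 a := fun a =>
      (measurable_pi_lambda _ fun i => SSP.measurable_feature hφ a i).comp hsnd
    have e : (fun q : Ω × Option S => valueToGo φ p (X.record M q.1) m (j + 1) q.2)
        = Finset.univ.inf' Finset.univ_nonempty fun (a : A) (q : Ω × Option S) =>
          truncQ φ p (X.record M q.1) m (valueToGo φ p (X.record M q.1) m j) q.2 a := by
      ext q
      rw [Finset.inf'_apply]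
      rfl
    rw [e]
    refine Finset.inf'_induction _ _
      (p := fun f : Ω × Option S → ℝ => Measurable[(ℱ t).prod inferInstance] f)
      (fun f hf g hg => hf.inf hg) fun a _ => ?_
    simp only [truncQ, rawQ_eq _ _ _ _ _ hH]
    have h1 := Ridge.measurable_dotProduct (hf a) (hw.comp hfst)
    have h2 := @Ridge.measurable_form _ ((ℱ t).prod inferInstance) d
      (fun q => visitedSeq φ (X.record M q.1) p.H) (m * p.H)
      (fun s hs => (hv s hs).comp hfst) (fun q => feature φ q.2 a) (hf a)
    exact ((h1.sub (h2.sqrt.const_mul _)).max measurable_const).min measurable_const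

variable [IsProbabilityMeasure P]

/-- With high probability, all regression estimates are accurate. -/
theorem measure_not_confident_le (hX : IsRun M φ p K P ℱ X) (hφ : M.IsLinear φ) (hd : 2 ≤ d)
    (hH : 0 < p.H) (hB : 3 ≤ p.B) (h0 : 0 ≤ p.cf) (h1 : p.cf ≤ p.B) (hδ : 0 < p.δ)
    (hδ1 : p.δ < 1) : P {ω | ¬ X.Confident M φ p ω} ≤ ENNReal.ofReal p.δ := by
  have hB0 : 0 ≤ p.B := by linarith
  set n : ℕ → ℝ := fun m => (m + 1 : ℕ) * p.H with hn
  set ξ : ℕ → ℝ := fun m => 1 / (beta d p m * d * n m) ^ 2 with hξ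
  set N : ℕ → Finset (Fin d ⊕ Fin d × Fin d → ℤ) := fun m => net d ⌈2 * p.B * n m / ξ m⌉₊ with hN
  set L : ℕ → ℝ := fun m => Real.log (((N m).card + 1) * ((m + 1) * (m + 2)) / p.δ) with hL
  set E : ℕ → (Option S → ℝ) → Set Ω := fun m V =>
    {ω | p.B ^ 2 * ∑ t ∈ Finset.range (m * p.H), Ridge.gain (visitedSeq φ (X.record M ω) p.H) t
        + p.B ^ 2 / 2 * L m
      ≤ Ridge.form (visitedSeq φ (X.record M ω) p.H) (m * p.H)
          (X.noiseSum M φ p.H V (m * p.H) ω)} with hE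
  -- One net serves all layers of the interval. The terminal cost is not of greedy form and is added
  -- separately, hence the `+ 1` in `L`.
  set bad : ℕ → Set Ω := fun m =>
    (⋃ k ∈ N m, E m (netValue φ p.B (beta d p m) (ξ m) k)) ∪ E m (terminalCost p) with hbad
  have hH1 : (1 : ℝ) ≤ p.H := by exact_mod_cast hH
  have hn1 : ∀ m, 1 ≤ n m ∧ (m + 1 : ℝ) ≤ n m ∧ ((m * p.H : ℕ) : ℝ) ≤ n m := by
    intro m
    have hm : (0 : ℝ) ≤ m := Nat.cast_nonneg m
    simp only [hn]
    push_cast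
    refine ⟨by nlinarith, by nlinarith, by nlinarith⟩
  have hβ : ∀ m, beta d p m = 50 * d * p.B * √(Real.log (16 * p.B * n m * d / p.δ)) := by
    intro m
    rw [FHSSP.beta, hn]
    ring_nf
  have hβ0 : ∀ m, 0 ≤ beta d p m := fun m => by rw [hβ]; positivity
  have hd' : (2 : ℝ) ≤ d := by exact_mod_cast hd
  have hξ0 : ∀ m, 0 < ξ m := by
    intro m
    have h2 := (two_le_log hB (hn1 m).1 hd hδ hδ1).1
    have h3 : 0 < √(Real.log (16 * p.B * n m * d / p.δ)) := Real.sqrt_pos.mpr (by linarith)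
    have h4 : 0 < n m := by linarith [(hn1 m).1]
    have h5 : 0 < beta d p m := by rw [hβ]; positivity
    simp only [hξ]
    positivity
  have hEbound : ∀ m V, Measurable V → (∀ x, V x ∈ Set.Icc 0 p.B) →
      P (E m V) ≤ ENNReal.ofReal (Real.exp (-L m)) := fun m V hV hVb =>
    hX.measure_form_noiseSum_le hφ hH hV (by linarith) hVb _ _
  have hbadm : ∀ m, P (bad m) ≤ ENNReal.ofReal (p.δ / ((m + 1) * (m + 2))) := by
    intro m
    calc P (bad m) ≤ P (⋃ k ∈ N m, E m (netValue φ p.B (beta d p m) (ξ m) k))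
          + P (E m (terminalCost p)) := measure_union_le _ _
      _ ≤ ∑ k ∈ N m, ENNReal.ofReal (Real.exp (-L m)) + ENNReal.ofReal (Real.exp (-L m)) := by
          refine add_le_add ((measure_biUnion_finset_le _ _).trans (Finset.sum_le_sum fun k _ => ?_))
            (hEbound m _ measurable_terminalCost (terminalCost_mem h0 h1))
          exact hEbound m _ (measurable_greedyValue hφ) (greedyValue_mem hB0)
      _ = ENNReal.ofReal (((N m).card + 1) * Real.exp (-L m)) := by
          rw [Finset.sum_const, nsmul_eq_mul, ENNReal.ofReal_mul (by positivity),
            ENNReal.ofReal_add (by positivity) zero_le_one, ENNReal.ofReal_one,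
            ENNReal.ofReal_natCast]
          ring
      _ = ENNReal.ofReal (p.δ / ((m + 1) * (m + 2))) := by
          simp only [hL]
          rw [Real.exp_neg, Real.exp_log (by positivity)]
          congr 1
          field_simp
  have hunion : P (⋃ m, bad m) ≤ ENNReal.ofReal p.δ :=
    (measure_iUnion_le _).trans ((ENNReal.tsum_le_tsum hbadm).trans (tsum_ofReal_div_mul_le hδ.le))
  refine (measure_mono fun ω hω => ?_).trans hunion
  by_contra hgood
  rw [Set.mem_iUnion, not_exists] at hgood
  refine hω fun m j x a => ?_
  set V := valueToGo φ p (X.record M ω) m j with hV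
  set v := visitedSeq φ (X.record M ω) p.H with hv
  set T := m * p.H with hT
  have hVm : Measurable V := FHSSP.measurable_valueToGo hφ _ _ _
  have hVb : ∀ x, V x ∈ Set.Icc 0 p.B := valueToGo_mem h0 h1 _ _ _
  -- The data-dependent `V` is replaced by a deterministic function near it, to which the
  -- concentration inequality applies.
  obtain ⟨V', hV'm, hV'b, hV'E, hVV'⟩ : ∃ V', Measurable V' ∧ (∀ x, V' x ∈ Set.Icc 0 p.B) ∧
      ω ∉ E m V' ∧ ∀ x, |V x - V' x| ≤ d * ξ m + beta d p m * (d * √(ξ m)) := by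
    rcases j with _ | j
    · refine ⟨terminalCost p, measurable_terminalCost, terminalCost_mem h0 h1,
        fun h => hgood m (Or.inr h), fun x => ?_⟩
      have : V x - terminalCost p x = 0 := sub_self _
      rw [this, abs_zero]
      have := (hξ0 m).le
      have := hβ0 m
      positivity
    · have hR : (1 : ℝ) ≤ 2 * p.B * n m := by nlinarith [(hn1 m).1]
      have hz : ∀ i, |weight φ p (X.record M ω) m (valueToGo φ p (X.record M ω) m j) i|
          ≤ 2 * p.B * n m := by
        intro i
        refine (X.abs_weight_le hφ hH m ω (valueToGo_mem h0 h1 _ _ _) i).trans ?_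
        calc ((m * p.H : ℕ) : ℝ) * (1 + p.B) ≤ n m * (2 * p.B) :=
              mul_le_mul (hn1 m).2.2 (by linarith) (by linarith) (by linarith [(hn1 m).1])
          _ = _ := by ring
      have hG : ∀ i j, |(gram φ p (X.record M ω) m)⁻¹ i j| ≤ 2 * p.B * n m := by
        intro i j
        rw [gram_inv_eq _ _ _ _ hH]
        exact (Ridge.abs_inv_apply_le _ _ _ _).trans hR
      obtain ⟨k, hk, hk'⟩ := exists_mem_net (b := p.B) (hξ0 m)
        (fun x a i => SSP.abs_feature_le hφ x a i) (hβ0 m) hz hG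
      exact ⟨_, measurable_greedyValue hφ, greedyValue_mem hB0,
        fun h => hgood m (Or.inl (Set.mem_biUnion hk h)), hk'⟩
  refine (X.abs_weight_sub_le hφ hH m ω hVm hVb (valueToGo_none hB0 _ _ _) x a).trans ?_
  refine mul_le_mul_of_nonneg_right ?_ (Real.sqrt_nonneg _)
  have hform := X.form_noiseSum_le hφ p.H T ω hVm hV'm hVb hV'b hVV'
  simp only [hE, Set.mem_ofPred_eq, not_le] at hV'E
  refine confidence_radius_le hB (hn1 m).1 hd hδ hδ1 (hβ m) rfl (Nat.cast_nonneg T) (hn1 m).2.2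
    (g := ∑ t ∈ Finset.range T, Ridge.gain v t) (L := L m) ?_ ?_ ?_
  · simpa using Ridge.sum_gain_le v (fun t => SSP.feature_dotProduct_self_le hφ _ _) T
  · exact log_card_le hB (hn1 m).1 hd hδ hδ1 (hβ m) rfl (hn1 m).2.1
  · exact hform.trans (by linarith)

/-- The fluctuation of the estimated value functions along the run. -/
def _root_.Trajectory.valueNoise (X : Trajectory S A Ω) (M : SSP S A)
    (φ : S → A → EuclideanSpace ℝ (Fin d)) (p : FHParams) (t : ℕ) (ω : Ω) : ℝ :=
  valueToGo φ p (X.record M ω) (t / p.H) (p.H - (t % p.H + 1)) (X.next p.H t ω)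
    - ∫ y, valueToGo φ p (X.record M ω) (t / p.H) (p.H - (t % p.H + 1)) y ∂X.nextLaw M p.H t ω

/-- With high probability, the fluctuations remain small at the end of all intervals. -/
theorem measure_valueNoise_le (hX : IsRun M φ p K P ℱ X) (hφ : M.IsLinear φ)
    (hH : 0 < p.H) (hB : 0 < p.B) (h0 : 0 ≤ p.cf) (h1 : p.cf ≤ p.B) (hδ : 0 < p.δ)
    (hδ1 : p.δ < 1) :
    P {ω | ∃ m : ℕ, p.B * √(((m + 1) * p.H : ℕ) * Real.log ((m + 1) * (m + 2) / p.δ))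
      ≤ ∑ t ∈ Finset.range ((m + 1) * p.H), X.valueNoise M φ p t ω} ≤ ENNReal.ofReal p.δ := by
  have hlog : ∀ m : ℕ, 0 < Real.log ((m + 1) * (m + 2) / p.δ) := by
    intro m
    refine Real.log_pos ?_
    rw [one_lt_div hδ]
    have : (0 : ℝ) ≤ m := Nat.cast_nonneg m
    nlinarith
  have hset : {ω | ∃ m : ℕ, p.B * √(((m + 1) * p.H : ℕ) * Real.log ((m + 1) * (m + 2) / p.δ))
      ≤ ∑ t ∈ Finset.range ((m + 1) * p.H), X.valueNoise M φ p t ω}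
      = ⋃ m : ℕ, {ω | p.B * √(((m + 1) * p.H : ℕ) * Real.log ((m + 1) * (m + 2) / p.δ))
      ≤ ∑ t ∈ Finset.range ((m + 1) * p.H), X.valueNoise M φ p t ω} := by
    ext ω; simp
  rw [hset]
  refine (measure_iUnion_le _).trans ((ENNReal.tsum_le_tsum fun m => ?_).trans
    (tsum_ofReal_div_mul_le hδ.le))
  refine (hX.measure_sum_noise_ge_le hH
    (V := fun t ω => valueToGo φ p (X.record M ω) (t / p.H) (p.H - (t % p.H + 1)))
    (fun t => hX.measurable_valueToGo hφ hH (Nat.div_mul_le_self t p.H) _) hB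
    (fun t ω x => valueToGo_mem h0 h1 _ _ _ x) (Nat.mul_pos (Nat.succ_pos m) hH)
    (hlog m)).trans (le_of_eq ?_)
  rw [Real.exp_neg, Real.exp_log (by positivity), inv_div]

end IsRun

end

noncomputable section

open Matrix

/-! ## The comparator policy -/

namespace SSP

variable {S : Type u} {A : Type v}

/-- The indicator of the non-goal states. -/
def alive : Option S → ENNReal := ({none}ᶜ : Set (Option S)).indicator 1

lemma alive_none : alive (none : Option S) = 0 := by
  simp [alive]

lemma alive_some (s : S) : alive (some s) = 1 := by
  simp [alive]

variable [MeasurableSpace S] {M : SSP S A}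
  {π : S → A}

/-- The expectation of `f` after one step of `π`. -/
def stepOp (M : SSP S A) (π : S → A) (f : Option S → ENNReal) (x : Option S) : ENNReal :=
  ∫⁻ y, f y ∂M.policyStep π x

/-- The expected total cost of `π`, extended to the goal. -/
def totalValue (M : SSP S A) (π : S → A) (x : Option S) : ENNReal :=
  ∑' n, (M.stepOp π)^[n] (M.policyCost π) x

/-- The probability that the goal is not reached in `n` steps. -/
def survival (M : SSP S A) (π : S → A) (n : ℕ) : Option S → ENNReal := (M.stepOp π)^[n] alive

lemma measurable_alive : Measurable (alive : Option S → ENNReal) :=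
  measurable_one.indicator measurableSet_singleton_none.compl

lemma stepOp_none (f : Option S → ENNReal) (hf : Measurable f) :
    M.stepOp π f none = f none := by
  change ∫⁻ y, f y ∂(Measure.dirac none) = _
  rw [lintegral_dirac' _ hf]

instance (x : Option S) : IsProbabilityMeasure (M.policyStep π x) := by
  cases x with
  | none => exact inferInstanceAs (IsProbabilityMeasure (Measure.dirac none))
  | some s =>
    have := M.isMarkov (π s)
    exact inferInstanceAs (IsProbabilityMeasure (M.trans (π s) s))

lemma stepOp_mono {f g : Option S → ENNReal} (h : f ≤ g) : M.stepOp π f ≤ M.stepOp π g :=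
  fun _ => lintegral_mono h

lemma stepOp_add {f g : Option S → ENNReal} (hf : Measurable f) (x : Option S) :
    M.stepOp π (f + g) x = M.stepOp π f x + M.stepOp π g x :=
  lintegral_add_left hf g

lemma stepOp_const (c : ENNReal) (x : Option S) : M.stepOp π (fun _ => c) x = c := by
  simp [stepOp]

lemma stepOp_const_mul (c : ENNReal) {f : Option S → ENNReal} (hf : Measurable f) (x : Option S) :
    M.stepOp π (fun x => c * f x) x = c * M.stepOp π f x :=
  lintegral_const_mul c hf

lemma iterate_stepOp_mono {f g : Option S → ENNReal} (h : f ≤ g) (n : ℕ) :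
    (M.stepOp π)^[n] f ≤ (M.stepOp π)^[n] g := by
  induction n with
  | zero => exact h
  | succ n ih =>
    rw [Function.iterate_succ_apply', Function.iterate_succ_apply']
    exact stepOp_mono ih

lemma policyCost_le_alive : M.policyCost π ≤ alive := by
  intro x
  cases x with
  | none => simp [policyCost]
  | some s =>
    rw [alive_some]
    exact ENNReal.ofReal_le_one.mpr (M.cost_mem s (π s)).2

lemma survival_antitone (x : Option S) :
    Antitone fun n => M.survival π n x := by
  refine antitone_nat_of_succ_le fun n => ?_
  rw [survival, Function.iterate_succ_apply]
  refine iterate_stepOp_mono (fun y => ?_) n x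
  cases y with
  | none => rw [stepOp_none _ measurable_alive]
  | some s =>
    rw [alive_some]
    refine (stepOp_mono (g := fun _ => 1) (fun y => ?_) _).trans (stepOp_const 1 _).le
    exact Set.indicator_le_self' (f := fun _ => (1 : ENNReal)) (fun _ _ => zero_le_one) y

variable [MeasurableSpace A] [MeasurableSingletonClass A] [Countable A]

lemma measurable_policyStep (hπ : Measurable π) : Measurable (M.policyStep π) :=
  measurable_option_iff.mpr
    (M.stepKernel.measurable.comp (measurable_option_some.prodMk hπ))

lemma measurable_stepOp (hπ : Measurable π) {f : Option S → ENNReal} (hf : Measurable f) :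
    Measurable (M.stepOp π f) :=
  (Measure.measurable_lintegral hf).comp (measurable_policyStep hπ)

lemma measurable_iterate_stepOp (hπ : Measurable π) {f : Option S → ENNReal} (hf : Measurable f)
    (n : ℕ) : Measurable ((M.stepOp π)^[n] f) := by
  induction n with
  | zero => exact hf
  | succ n ih => rw [Function.iterate_succ_apply']; exact measurable_stepOp hπ ih

/-- Duality between forward laws and backward operators. It turns values and hitting times into
iterates of a monotone operator on functions, where induction on the horizon is possible. -/
lemma lintegral_law (hπ : Measurable π) {f : Option S → ENNReal} (hf : Measurable f) (s : S)
    (n : ℕ) : ∫⁻ x, f x ∂M.law π s n = (M.stepOp π)^[n] f (some s) := by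
  induction n generalizing f with
  | zero => rw [law, lintegral_dirac' _ hf]; rfl
  | succ n ih =>
    rw [law, Measure.lintegral_bind (measurable_policyStep hπ).aemeasurable hf.aemeasurable,
      Function.iterate_succ_apply]
    exact ih (measurable_stepOp hπ hf)

lemma measurable_policyCost {d : ℕ} {φ : S → A → EuclideanSpace ℝ (Fin d)} (hφ : M.IsLinear φ)
    (hπ : Measurable π) : Measurable (M.policyCost π) := by
  have h1 : Measurable fun q : S × A => M.cost q.1 q.2 :=
    measurable_from_prod_countable_left fun a => measurable_option_iff.mp (measurable_stepCost hφ a)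
  exact measurable_option_iff.mpr (h1.comp (measurable_id.prodMk hπ)).ennreal_ofReal

lemma value_eq (hπ : Measurable π) (hc : Measurable (M.policyCost π)) (s : S) :
    M.value π s = M.totalValue π (some s) :=
  tsum_congr fun n => lintegral_law hπ hc s n

lemma hittingTime_eq (hπ : Measurable π) (s : S) :
    M.hittingTime π s = ∑' n, M.survival π n (some s) := by
  refine tsum_congr fun n => ?_
  rw [survival, ← lintegral_law hπ measurable_alive, alive,
    lintegral_indicator_one measurableSet_singleton_none.compl]

lemma totalValue_eq (hπ : Measurable π) (hc : Measurable (M.policyCost π)) (x : Option S) :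
    M.totalValue π x = M.policyCost π x + M.stepOp π (M.totalValue π) x := by
  have h : M.stepOp π (M.totalValue π) x = ∑' n, (M.stepOp π)^[n + 1] (M.policyCost π) x := by
    simp only [Function.iterate_succ_apply']
    exact lintegral_tsum fun n => (measurable_iterate_stepOp hπ hc n).aemeasurable
  rw [h, totalValue, tsum_eq_zero_add' ENNReal.summable]
  rfl

lemma measurable_totalValue (hπ : Measurable π) (hc : Measurable (M.policyCost π)) :
    Measurable (M.totalValue π) :=
  Measurable.tsum fun n => measurable_iterate_stepOp hπ hc n

lemma totalValue_none (hπ : Measurable π) (hc : Measurable (M.policyCost π)) :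
    M.totalValue π none = 0 := by
  have : ∀ n, (M.stepOp π)^[n] (M.policyCost π) none = 0 := by
    intro n
    induction n with
    | zero => rfl
    | succ n ih =>
      rw [Function.iterate_succ_apply', stepOp_none _ (measurable_iterate_stepOp hπ hc n), ih]
  simp [totalValue, this]

lemma value_le_hittingTime (hπ : Measurable π) (hc : Measurable (M.policyCost π)) (s : S) :
    M.value π s ≤ M.hittingTime π s := by
  rw [value_eq hπ hc, hittingTime_eq hπ]
  exact ENNReal.tsum_le_tsum fun n => iterate_stepOp_mono policyCost_le_alive n _

lemma survival_none (hπ : Measurable π) (n : ℕ) : M.survival π n none = 0 := by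
  induction n with
  | zero => exact alive_none
  | succ n ih =>
    rw [survival, Function.iterate_succ_apply',
      stepOp_none _ (measurable_iterate_stepOp hπ measurable_alive n)]
    exact ih

/-- The Markov property: `b` further steps after the first `a` cost a factor `c` off the goal, while
survival from the goal is zero. -/
lemma survival_add_le (hπ : Measurable π) {b : ℕ} {c : ENNReal}
    (h : ∀ s : S, M.survival π b (some s) ≤ c) (a : ℕ) (x : Option S) :
    M.survival π (a + b) x ≤ c * M.survival π a x := by
  have h1 : M.survival π b ≤ fun x => c * alive x := by
    intro x
    cases x with
    | none => rw [survival_none hπ]; exact zero_le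
    | some s =>
      change _ ≤ c * alive (some s)
      rw [alive_some, mul_one]
      exact h s
  have h2 : ∀ n, (M.stepOp π)^[n] (fun x => c * alive x) = fun x => c * M.survival π n x := by
    intro n
    induction n with
    | zero => rfl
    | succ n ih =>
      ext x
      rw [Function.iterate_succ_apply', ih]
      change _ = c * (M.stepOp π)^[n + 1] alive x
      rw [Function.iterate_succ_apply']
      exact stepOp_const_mul c (measurable_iterate_stepOp hπ measurable_alive n) x
  rw [survival, Function.iterate_add_apply]
  exact (iterate_stepOp_mono h1 a x).trans (congrFun (h2 a) x).le

lemma survival_mul_le (hπ : Measurable π) {b : ℕ} {c : ENNReal}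
    (h : ∀ s : S, M.survival π b (some s) ≤ c) (j : ℕ) (x : Option S) :
    M.survival π (j * b) x ≤ c ^ j := by
  induction j with
  | zero =>
    rw [zero_mul, pow_zero]
    exact Set.indicator_le_self' (f := fun _ => (1 : ENNReal)) (fun _ _ => zero_le_one) x
  | succ j ih =>
    rw [Nat.succ_mul, pow_succ']
    exact (survival_add_le hπ h _ x).trans (mul_le_mul_right ih c)

/-- Within the horizon, the goal is reached except with a small probability. -/
lemma survival_horizon_le (hπ : Measurable π) {τ : ℝ} (hτ : 1 ≤ τ)
    (h : ∀ s, M.hittingTime π s ≤ ENNReal.ofReal τ) {K : ℕ} (hK : 2 ≤ K) (x : Option S) :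
    M.survival π ⌈4 * τ * Real.log (4 * K)⌉₊ x ≤ ENNReal.ofReal (1 / (2 * K)) := by
  set H := ⌈4 * τ * Real.log (4 * K)⌉₊ with hH
  have hK' : (2 : ℝ) ≤ K := by exact_mod_cast hK
  obtain ⟨b, hb⟩ : ∃ b, ⌈2 * τ⌉₊ = b + 1 :=
    Nat.exists_eq_succ_of_ne_zero (Nat.ceil_pos.mpr (by linarith)).ne'
  have hb1 : 2 * τ ≤ (b + 1 : ℕ) := hb ▸ Nat.le_ceil (2 * τ)
  have hb2 : (b : ℝ) ≤ 2 * τ := by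
    have := Nat.ceil_lt_add_one (show 0 ≤ 2 * τ by linarith)
    rw [hb] at this
    push_cast at this
    linarith
  have hb0 : 0 < b := by
    have : (1 : ℝ) ≤ b := by push_cast at hb1; linarith
    exact_mod_cast this
  have half : ∀ s : S, M.survival π b (some s) ≤ ENNReal.ofReal (1 / 2) := by
    intro s
    have h1 : (b + 1 : ℕ) * M.survival π b (some s) ≤ ENNReal.ofReal τ := by
      refine le_trans ?_ (h s)
      rw [hittingTime_eq hπ]
      calc ((b + 1 : ℕ) : ENNReal) * M.survival π b (some s)
          = ∑ _k ∈ Finset.range (b + 1), M.survival π b (some s) := by simp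
        _ ≤ ∑ k ∈ Finset.range (b + 1), M.survival π k (some s) :=
            Finset.sum_le_sum fun k hk => survival_antitone (some s)
              (Nat.lt_succ_iff.mp (Finset.mem_range.mp hk))
        _ ≤ _ := ENNReal.sum_le_tsum _
    have h2 : M.survival π b (some s) ≤ ENNReal.ofReal τ / (b + 1 : ℕ) := by
      rw [ENNReal.le_div_iff_mul_le (Or.inl (by simp)) (Or.inl (by simp)), mul_comm]
      exact h1
    refine h2.trans ?_
    rw [← ENNReal.ofReal_natCast, ← ENNReal.ofReal_div_of_pos (by positivity)]
    refine ENNReal.ofReal_le_ofReal ?_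
    rw [div_le_div_iff₀ (by positivity) (by norm_num)]
    linarith
  refine (survival_antitone x (Nat.div_mul_le_self H b)).trans
    ((survival_mul_le hπ half _ x).trans ?_)
  rw [← ENNReal.ofReal_pow (by norm_num)]
  refine ENNReal.ofReal_le_ofReal ?_
  have hlt : H < (H / b + 1) * b := by
    rw [Nat.add_mul, one_mul]; exact Nat.lt_div_mul_add hb0
  have h3 : 2 * Real.log (4 * K) ≤ (H / b + 1 : ℕ) := by
    have h4 : 4 * τ * Real.log (4 * K) ≤ (H / b + 1 : ℕ) * b := by
      have h9 : (H : ℝ) ≤ ((H / b + 1) * b : ℕ) := by exact_mod_cast hlt.le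
      rw [Nat.cast_mul] at h9
      exact (Nat.le_ceil _).trans h9
    have h5 : ((H / b + 1 : ℕ) : ℝ) * b ≤ (H / b + 1 : ℕ) * (2 * τ) := by gcongr
    have h6 : 2 * τ * (2 * Real.log (4 * K)) ≤ 2 * τ * (H / b + 1 : ℕ) := by linarith
    exact le_of_mul_le_mul_left h6 (by linarith)
  -- The horizon contains only `H / b` complete blocks. The missing one costs a factor `2`, which is
  -- why `H` is built on `log (4 * K)`.
  have h7 : (1 / 2 : ℝ) ^ (H / b + 1) ≤ 1 / (4 * K) := by
    have h8 : (1 / 2 : ℝ) ≤ Real.exp (-(1 / 2)) := by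
      linarith [Real.add_one_le_exp (-(1 / 2) : ℝ)]
    calc (1 / 2 : ℝ) ^ (H / b + 1) ≤ Real.exp (-(1 / 2)) ^ (H / b + 1) := by gcongr
      _ = Real.exp (-((H / b + 1 : ℕ) / 2)) := by
        rw [← Real.exp_nat_mul]; congr 1; ring
      _ ≤ Real.exp (-Real.log (4 * K)) := Real.exp_le_exp.mpr (by linarith)
      _ = 1 / (4 * K) := by
        rw [Real.exp_neg, Real.exp_log (by positivity), one_div]
  rw [pow_succ] at h7
  calc (1 / 2 : ℝ) ^ (H / b) = (1 / 2 : ℝ) ^ (H / b) * (1 / 2) * 2 := by ring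
    _ ≤ 1 / (4 * K) * 2 := by gcongr
    _ = 1 / (2 * K) := by field_simp; norm_num

/-- The expected cost of `n` steps of `π` followed by the terminal cost. -/
def horizonValue (M : SSP S A) (π : S → A) (cf : ENNReal) : ℕ → Option S → ENNReal
  | 0 => fun x => cf * alive x
  | n + 1 => fun x => M.policyCost π x + M.stepOp π (horizonValue M π cf n) x

lemma measurable_horizonValue (hπ : Measurable π) (hc : Measurable (M.policyCost π)) (cf : ENNReal)
    (n : ℕ) : Measurable (M.horizonValue π cf n) := by
  induction n with
  | zero => exact measurable_alive.const_mul cf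
  | succ n ih => exact hc.add (measurable_stepOp hπ ih)

/-- The first `n` steps cost at most the whole run, and the terminal cost is charged only if the
goal is missed. -/
lemma horizonValue_le (hπ : Measurable π) (hc : Measurable (M.policyCost π)) (cf : ENNReal)
    (n : ℕ) (x : Option S) :
    M.horizonValue π cf n x ≤ M.totalValue π x + cf * M.survival π n x := by
  induction n generalizing x with
  | zero => exact le_add_self
  | succ n ih =>
    rw [totalValue_eq hπ hc, horizonValue, add_assoc, survival, Function.iterate_succ_apply',
      ← stepOp_const_mul cf (measurable_iterate_stepOp hπ measurable_alive n),
      ← stepOp_add (measurable_totalValue hπ hc)]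
    exact add_le_add le_rfl
      (stepOp_mono (g := M.totalValue π + fun x => cf * M.survival π n x) ih x)

/-- Where the terminal cost is charged, the true run still has at least one step of cost `cmin`
ahead; where it is not, `cf` itself covers `cmin`. This slack keeps estimates strictly below the
truncation level. -/
lemma horizonValue_add_le (hπ : Measurable π) (hc : Measurable (M.policyCost π)) {cf : ENNReal}
    (hcf : ENNReal.ofReal M.cmin ≤ cf) (n : ℕ) (x : Option S) :
    M.horizonValue π cf n x + ENNReal.ofReal M.cmin ≤ M.totalValue π x + cf := by
  induction n generalizing x with
  | zero =>
    cases x with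
    | none =>
      simp only [horizonValue, alive_none, mul_zero, zero_add]
      exact hcf.trans le_add_self
    | some s =>
      change cf * alive (some s) + _ ≤ _
      rw [alive_some, mul_one, add_comm]
      gcongr
      rw [totalValue_eq hπ hc]
      exact (ENNReal.ofReal_le_ofReal (M.cost_mem s (π s)).1).trans le_self_add
  | succ n ih =>
    have h := stepOp_mono (π := π) (M := M) (f := M.horizonValue π cf n + fun _ =>
      ENNReal.ofReal M.cmin) (g := M.totalValue π + fun _ => cf) ih x
    rw [stepOp_add (measurable_horizonValue hπ hc cf n),
      stepOp_add (measurable_totalValue hπ hc), stepOp_const, stepOp_const] at h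
    rw [totalValue_eq hπ hc, horizonValue, add_assoc, add_assoc]
    gcongr

end SSP

end

noncomputable section

open Matrix

/-! ## Optimism and the regret over complete intervals -/

namespace Ridge

variable {n : Type*} [Fintype n] [DecidableEq n] (v : ℕ → n → ℝ)

/-- Over a block in which the Gram matrix hardly changes, the norm at the beginning of the block is
controlled by the gain. -/
lemma form_le_four_mul_gain (hv : ∀ t, v t ⬝ᵥ v t ≤ 1) {s k h : ℕ} (hk : h ≤ k)
    (hg : ∑ i ∈ Finset.range k, gain v (s + i) ≤ 1 / 2) :
    form v s (v (s + h)) ≤ 4 * gain v (s + h) := by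
  have h0 := form_nonneg v (s + h) (v (s + h))
  have h1 : ∑ i ∈ Finset.range h, gain v (s + i) ≤ 1 / 2 :=
    (Finset.sum_le_sum_of_subset_of_nonneg (Finset.range_mono hk)
      fun _ _ _ => gain_nonneg v _).trans hg
  have h2 : Real.exp (∑ i ∈ Finset.range h, gain v (s + i)) ≤ 2 := by
    rw [← Real.le_log_iff_exp_le (by norm_num)]
    linarith [Real.log_two_gt_d9]
  -- For `x` in `[0, 1]`, `x ≤ 2 * log (1 + x)`, already by `log (1 + x) ≥ 1 - 1 / (1 + x)`.
  have h3 : form v (s + h) (v (s + h)) ≤ 2 * gain v (s + h) := by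
    have hle : form v (s + h) (v (s + h)) ≤ 1 := (form_le v _ _).trans (hv _)
    have := Real.one_sub_inv_le_log_of_pos (x := 1 + form v (s + h) (v (s + h))) (by linarith)
    refine le_trans ?_ (mul_le_mul_of_nonneg_left this zero_le_two)
    set x := form v (s + h) (v (s + h))
    have : 2 * (1 - (1 + x)⁻¹) - x = x * (1 - x) / (1 + x) := by
      field_simp
      ring
    have : 0 ≤ x * (1 - x) / (1 + x) :=
      div_nonneg (mul_nonneg h0 (by linarith)) (by linarith)
    linarith
  calc _ ≤ Real.exp (∑ i ∈ Finset.range h, gain v (s + i)) * form v (s + h) (v (s + h)) :=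
        form_le_exp_mul v s h _
    _ ≤ 2 * (2 * gain v (s + h)) := mul_le_mul h2 h3 h0 zero_le_two
    _ = _ := by ring

end Ridge

namespace FHSSP

/-- The bound of the regret over `n + 1` intervals of the finite-horizon problem. -/
def intervalRegretBound (d : ℕ) (p : FHParams) (n : ℕ) : ℝ :=
  4 * p.B * p.H * (d * Real.log (d + ((n + 1) * p.H : ℕ)))
    + 4 * beta d p n * √(((n + 1) * p.H : ℕ) * (d * Real.log (d + ((n + 1) * p.H : ℕ))))
    + p.B * √(((n + 1) * p.H : ℕ) * Real.log ((n + 1) * (n + 2) / p.δ))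

lemma beta_nonneg {d : ℕ} {p : FHParams} (hB : 0 ≤ p.B) (m : ℕ) : 0 ≤ beta d p m := by
  unfold beta; positivity

lemma beta_mono {d : ℕ} {p : FHParams} (hd : 0 < d) (hH : 0 < p.H) (hB : 0 < p.B) (hδ : 0 < p.δ) :
    Monotone (beta d p) := by
  intro m n hmn
  unfold beta
  have : 0 < (d : ℝ) := by exact_mod_cast hd
  have : 0 < (p.H : ℝ) := by exact_mod_cast hH
  gcongr

end FHSSP

namespace Trajectory

open FHSSP

variable {S : Type u} {A : Type v} {Ω : Type w} [MeasurableSpace S] [Fintype A] [Nonempty A] {d : ℕ}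
  {M : SSP S A} {φ : S → A → EuclideanSpace ℝ (Fin d)} {p : FHParams} {X : Trajectory S A Ω}
  {ω : Ω}

lemma Confident.rawQ_le (hω : X.Confident M φ p ω) (hH : 0 < p.H) (m j : ℕ) (x : Option S) (a : A) :
    rawQ φ p (X.record M ω) m (valueToGo φ p (X.record M ω) m j) x a
      ≤ M.stepCost x a + M.expect (valueToGo φ p (X.record M ω) m j) x a := by
  rw [rawQ_eq _ _ _ _ _ hH]
  linarith [(abs_le.mp (hω m j x a)).2]

lemma Confident.le_rawQ (hω : X.Confident M φ p ω) (hH : 0 < p.H) (m j : ℕ) (x : Option S) (a : A) :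
    M.stepCost x a + M.expect (valueToGo φ p (X.record M ω) m j) x a
      ≤ rawQ φ p (X.record M ω) m (valueToGo φ p (X.record M ω) m j) x a + 2 * (beta d p m *
        √(Ridge.form (visitedSeq φ (X.record M ω) p.H) (m * p.H) (feature φ x a))) := by
  rw [rawQ_eq _ _ _ _ _ hH]
  linarith [(abs_le.mp (hω m j x a)).1]

/-- Optimism: the estimated values are at most those of any stationary policy. -/
lemma Confident.ofReal_valueToGo_le (hω : X.Confident M φ p ω) (hφ : M.IsLinear φ) (hH : 0 < p.H)
    (h0 : 0 ≤ p.cf) (h1 : p.cf ≤ p.B) (π : S → A) (m j : ℕ) (x : Option S) :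
    ENNReal.ofReal (valueToGo φ p (X.record M ω) m j x)
      ≤ M.horizonValue π (ENNReal.ofReal p.cf) j x := by
  induction j generalizing x with
  | zero =>
    cases x with
    | none => simp [valueToGo, terminalCost]
    | some s =>
      change _ ≤ ENNReal.ofReal p.cf * SSP.alive (some s)
      rw [SSP.alive_some, mul_one]
      rfl
  | succ j ih =>
    cases x with
    | none => simp [valueToGo_none (h0.trans h1)]
    | some s =>
      set V := valueToGo φ p (X.record M ω) m j with hV
      have hb := valueToGo_mem (φ := φ) h0 h1 (X.record M ω) m j
      have hint : Integrable V (M.step (π s) (some s)) :=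
        Integrable.of_mem_Icc 0 p.B (measurable_valueToGo hφ _ m j).aemeasurable (ae_of_all _ hb)
      have e : 0 ≤ M.expect V (some s) (π s) := integral_nonneg fun y => (hb y).1
      have hle : valueToGo φ p (X.record M ω) m (j + 1) (some s)
          ≤ M.stepCost (some s) (π s) + M.expect V (some s) (π s) := by
        refine (Finset.inf'_le _ (Finset.mem_univ (π s))).trans ((min_le_left _ _).trans ?_)
        exact max_le (hω.rawQ_le hH m j _ _) (add_nonneg (SSP.stepCost_mem _ _).1 e)
      refine (ENNReal.ofReal_le_ofReal hle).trans ?_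
      rw [ENNReal.ofReal_add (SSP.stepCost_mem _ _).1 e, SSP.expect,
        ofReal_integral_eq_lintegral_ofReal hint (ae_of_all _ fun y => (hb y).1)]
      exact add_le_add le_rfl (lintegral_mono ih)

/-- The excess of the Bellman backup over the estimated value along the run. -/
def bellmanGap (X : Trajectory S A Ω) (M : SSP S A) (φ : S → A → EuclideanSpace ℝ (Fin d))
    (p : FHParams) (t : ℕ) (ω : Ω) : ℝ :=
  M.stepCost (X.cur p.H t ω) (X.act p.H t ω)
    + M.expect (valueToGo φ p (X.record M ω) (t / p.H) (p.H - (t % p.H + 1)))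
      (X.cur p.H t ω) (X.act p.H t ω)
    - valueToGo φ p (X.record M ω) (t / p.H) (p.H - t % p.H) (X.cur p.H t ω)

/-- Adding the noise replaces the expected continuation value by the realized one, so estimated
values telescope within each interval and end in the terminal cost. -/
lemma sum_bellmanGap_add_valueNoise (X : Trajectory S A Ω) (M : SSP S A)
    (φ : S → A → EuclideanSpace ℝ (Fin d)) (p : FHParams) (hH : 0 < p.H) (n : ℕ) (ω : Ω) :
    ∑ t ∈ Finset.range (n * p.H), (X.bellmanGap M φ p t ω + X.valueNoise M φ p t ω)
      = ∑ m ∈ Finset.range n,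
        (∑ h ∈ Finset.range p.H, M.stepCost (X.state m h ω) (X.action m h ω)
          + terminalCost p (X.state m p.H ω)
          - valueToGo φ p (X.record M ω) m p.H (X.state m 0 ω)) := by
  set V := fun m h => valueToGo φ p (X.record M ω) m (p.H - h) (X.state m h ω) with hV
  set f := fun m h => M.stepCost (X.state m h ω) (X.action m h ω) + (V m (h + 1) - V m h) with hf
  have h1 : ∀ t, X.bellmanGap M φ p t ω + X.valueNoise M φ p t ω = f (t / p.H) (t % p.H) := by
    intro t
    simp only [bellmanGap, valueNoise, hf, hV, SSP.expect, nextLaw, cur, act, next]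
    ring
  rw [Finset.sum_congr rfl fun t _ => h1 t, Finset.sum_range_mul_eq_sum_div_mod f n hH]
  refine Finset.sum_congr rfl fun m _ => ?_
  rw [Finset.sum_add_distrib, Finset.sum_range_sub (V m)]
  simp only [hV, Nat.sub_self, Nat.sub_zero]
  rw [add_sub_assoc]
  rfl

variable [MeasurableSpace A] {K : ℕ} {mΩ : MeasurableSpace Ω} {P : Measure Ω} {ℱ : Filtration ℕ mΩ}

/-- If the gain of the interval is at most one half, the frozen bonus is comparable to the root of
the current gain. Otherwise the trivial bound `1 + B ≤ 2 * B` is charged to that gain. -/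
lemma Confident.bellmanGap_le (hω : X.Confident M φ p ω) (hX : IsRun M φ p K P ℱ X)
    (hφ : M.IsLinear φ) (hH : 0 < p.H) (hB : 1 ≤ p.B) (h0 : 0 ≤ p.cf) (h1 : p.cf ≤ p.B)
    (hV : ∀ m j x, valueToGo φ p (X.record M ω) m j x < p.B) {m h : ℕ} (hh : h < p.H) :
    X.bellmanGap M φ p (m * p.H + h) ω ≤ 4 * p.B * ∑ i ∈ Finset.range p.H,
        Ridge.gain (visitedSeq φ (X.record M ω) p.H) (m * p.H + i)
      + 4 * (beta d p m * √(Ridge.gain (visitedSeq φ (X.record M ω) p.H) (m * p.H + h))) := by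
  set v := visitedSeq φ (X.record M ω) p.H with hv
  have hv1 : ∀ t, v t ⬝ᵥ v t ≤ 1 := fun t => SSP.feature_dotProduct_self_le hφ _ _
  have ediv : (m * p.H + h) / p.H = m := by
    rw [mul_comm, Nat.mul_add_div hH, Nat.div_eq_of_lt hh, add_zero]
  have emod : (m * p.H + h) % p.H = h := by
    rw [mul_comm, Nat.mul_add_mod, Nat.mod_eq_of_lt hh]
  have hvt : v (m * p.H + h) = feature φ (X.state m h ω) (X.action m h ω) := by
    rw [hv, visitedSeq, ediv, emod]; rfl
  have egap : X.bellmanGap M φ p (m * p.H + h) ω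
      = M.stepCost (X.state m h ω) (X.action m h ω)
        + M.expect (valueToGo φ p (X.record M ω) m (p.H - (h + 1))) (X.state m h ω)
          (X.action m h ω)
        - valueToGo φ p (X.record M ω) m (p.H - h) (X.state m h ω) := by
    simp only [bellmanGap, cur, act, ediv, emod]
  have hb := valueToGo_mem (φ := φ) h0 h1 (X.record M ω) m
  have hl : 0 ≤ ∑ i ∈ Finset.range p.H, Ridge.gain v (m * p.H + i) :=
    Finset.sum_nonneg fun i _ => Ridge.gain_nonneg v _
  rw [egap]
  rcases le_or_gt (∑ i ∈ Finset.range p.H, Ridge.gain v (m * p.H + i)) (1 / 2) with hs | hs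
  · have hform := Ridge.form_le_four_mul_gain v hv1 hh.le hs
    have hroot : √(Ridge.form v (m * p.H) (feature φ (X.state m h ω) (X.action m h ω)))
        ≤ 2 * √(Ridge.gain v (m * p.H + h)) := by
      rw [← hvt]
      refine (Real.sqrt_le_sqrt hform).trans (le_of_eq ?_)
      rw [Real.sqrt_mul (by norm_num), show (4 : ℝ) = 2 ^ 2 by norm_num,
        Real.sqrt_sq zero_le_two]
    have hle := hω.le_rawQ hH m (p.H - (h + 1)) (X.state m h ω) (X.action m h ω)
    have hval : rawQ φ p (X.record M ω) m (valueToGo φ p (X.record M ω) m (p.H - (h + 1)))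
        (X.state m h ω) (X.action m h ω)
        ≤ valueToGo φ p (X.record M ω) m (p.H - h) (X.state m h ω) := by
      have hj : p.H - h = p.H - (h + 1) + 1 := by omega
      have hlt := hV m (p.H - h) (X.state m h ω)
      rw [hj] at hlt ⊢
      have hg : truncQ φ p (X.record M ω) m (valueToGo φ p (X.record M ω) m (p.H - (h + 1)))
          (X.state m h ω) (X.action m h ω)
          ≤ valueToGo φ p (X.record M ω) m (p.H - (h + 1) + 1) (X.state m h ω) :=
        Finset.le_inf' Finset.univ_nonempty _ fun a _ => hX.greedy m h hh ω a
      -- Strict inequality with `B` shows that the outer minimum is inactive at the action played,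
      -- so the value is at least the raw estimate there.
      have hmax := hg.trans_lt hlt
      rw [truncQ] at hg hmax
      rw [min_lt_iff, or_iff_left (lt_irrefl _)] at hmax
      rw [min_eq_left hmax.le] at hg
      exact (le_max_left _ _).trans hg
    have hβ := mul_le_mul_of_nonneg_left hroot (beta_nonneg (d := d) (zero_le_one.trans hB) m)
    have : 0 ≤ 4 * p.B * ∑ i ∈ Finset.range p.H, Ridge.gain v (m * p.H + i) := by positivity
    linarith
  · have hexp : M.expect (valueToGo φ p (X.record M ω) m (p.H - (h + 1))) (X.state m h ω)
        (X.action m h ω) ≤ p.B := by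
      refine (le_abs_self _).trans ?_
      simpa [SSP.expect] using norm_integral_le_of_norm_le_const
        (μ := M.step (X.action m h ω) (X.state m h ω)) (C := p.B)
        (ae_of_all _ fun x => (Real.norm_of_nonneg (hb (p.H - (h + 1)) x).1).le.trans
          (hb (p.H - (h + 1)) x).2)
    have hc := (SSP.stepCost_mem (M := M) (X.state m h ω) (X.action m h ω)).2
    have hn := (hb (p.H - h) (X.state m h ω)).1
    have : 0 ≤ beta d p m * √(Ridge.gain v (m * p.H + h)) :=
      mul_nonneg (beta_nonneg (zero_le_one.trans hB) m) (Real.sqrt_nonneg _)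
    have : 4 * p.B * (1 / 2) ≤ 4 * p.B * ∑ i ∈ Finset.range p.H, Ridge.gain v (m * p.H + i) := by
      gcongr
    linarith

/-- On the good event, the regret over complete intervals is bounded. -/
lemma Confident.sum_interval_le (hω : X.Confident M φ p ω) (hX : IsRun M φ p K P ℱ X)
    (hφ : M.IsLinear φ) (hd : 0 < d) (hH : 0 < p.H) (hB : 1 ≤ p.B) (h0 : 0 ≤ p.cf)
    (h1 : p.cf ≤ p.B) (hδ : 0 < p.δ) (hV : ∀ m j x, valueToGo φ p (X.record M ω) m j x < p.B)
    {n : ℕ}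
    (hnoise : ∑ t ∈ Finset.range ((n + 1) * p.H), X.valueNoise M φ p t ω
      ≤ p.B * √(((n + 1) * p.H : ℕ) * Real.log ((n + 1) * (n + 2) / p.δ))) :
    ∑ m ∈ Finset.range (n + 1),
        (∑ h ∈ Finset.range p.H, M.stepCost (X.state m h ω) (X.action m h ω)
          + terminalCost p (X.state m p.H ω)
          - valueToGo φ p (X.record M ω) m p.H (X.state m 0 ω)) ≤ intervalRegretBound d p n := by
  set v := visitedSeq φ (X.record M ω) p.H with hv
  have hv1 : ∀ t, v t ⬝ᵥ v t ≤ 1 := fun t => SSP.feature_dotProduct_self_le hφ _ _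
  set N := (n + 1) * p.H with hN
  have hG : ∑ t ∈ Finset.range N, Ridge.gain v t ≤ d * Real.log (d + N) := by
    simpa using Ridge.sum_gain_le v hv1 N
  have hB0 : 0 < p.B := by linarith
  have hβ := beta_nonneg (d := d) hB0.le n
  have hblock : ∀ (f : ℕ → ℝ), ∑ m ∈ Finset.range (n + 1), ∑ h ∈ Finset.range p.H, f (m * p.H + h)
      = ∑ t ∈ Finset.range N, f t := by
    intro f
    rw [hN, ← Finset.sum_range_mul_eq_sum_div_mod (fun m h => f (m * p.H + h)) (n + 1) hH]
    exact Finset.sum_congr rfl fun t _ => by rw [Nat.div_add_mod']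
  have hsqrt : ∑ t ∈ Finset.range N, √(Ridge.gain v t) ≤ √(N * (d * Real.log (d + N))) := by
    refine Real.le_sqrt_of_sq_le ((sq_sum_le_card_mul_sum_sq).trans ?_)
    rw [Finset.card_range, Finset.sum_congr rfl fun t _ => Real.sq_sqrt (Ridge.gain_nonneg v t)]
    gcongr
  have hgap : ∑ t ∈ Finset.range N, X.bellmanGap M φ p t ω
      ≤ 4 * p.B * p.H * (d * Real.log (d + N)) + 4 * beta d p n * √(N * (d * Real.log (d + N))) := by
    calc _ = ∑ m ∈ Finset.range (n + 1), ∑ h ∈ Finset.range p.H,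
          X.bellmanGap M φ p (m * p.H + h) ω := (hblock fun t => X.bellmanGap M φ p t ω).symm
      _ ≤ ∑ m ∈ Finset.range (n + 1), ∑ h ∈ Finset.range p.H,
          (4 * p.B * ∑ i ∈ Finset.range p.H, Ridge.gain v (m * p.H + i)
            + 4 * beta d p n * √(Ridge.gain v (m * p.H + h))) := by
        refine Finset.sum_le_sum fun m hm => Finset.sum_le_sum fun h hh => ?_
        refine (hω.bellmanGap_le hX hφ hH hB h0 h1 hV (Finset.mem_range.mp hh)).trans ?_
        have := mul_le_mul_of_nonneg_right
          (beta_mono hd hH hB0 hδ (Nat.lt_succ_iff.mp (Finset.mem_range.mp hm)))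
          (Real.sqrt_nonneg (Ridge.gain v (m * p.H + h)))
        linarith
      -- The charge for intervals of large gain occurs in each of their `H` layers, hence the factor
      -- `p.H`.
      _ = 4 * p.B * p.H * ∑ t ∈ Finset.range N, Ridge.gain v t
          + 4 * beta d p n * ∑ t ∈ Finset.range N, √(Ridge.gain v t) := by
        simp only [Finset.sum_add_distrib, Finset.sum_const, Finset.card_range, nsmul_eq_mul,
          ← Finset.mul_sum]
        rw [hblock, hblock fun t => √(Ridge.gain v t)]
        ring
      _ ≤ _ := by gcongr
  rw [← sum_bellmanGap_add_valueNoise X M φ p hH, Finset.sum_add_distrib, intervalRegretBound]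
  exact add_le_add hgap hnoise

end Trajectory

end

noncomputable section

open Matrix

/-! ## Counting intervals and episodes -/

namespace Trajectory

variable {S : Type u} {A : Type v} {Ω : Type w} {X : Trajectory S A Ω} {H : ℕ} {ω : Ω}

/-- The goal is never left within an interval. -/
def Absorbed (X : Trajectory S A Ω) (H : ℕ) (ω : Ω) : Prop :=
  ∀ t, X.cur H t ω = none → X.next H t ω = none

lemma Absorbed.state_eq_none (hω : X.Absorbed H ω) {m : ℕ} (h0 : X.state m 0 ω = none) {h : ℕ}
    (hh : h ≤ H) : X.state m h ω = none := by
  induction h with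
  | zero => exact h0
  | succ h ih =>
    have hlt : h < H := hh
    have ediv : (m * H + h) / H = m := by
      rw [mul_comm, Nat.mul_add_div (by omega), Nat.div_eq_of_lt hlt, add_zero]
    have emod : (m * H + h) % H = h := by
      rw [mul_comm, Nat.mul_add_mod, Nat.mod_eq_of_lt hlt]
    have := hω (m * H + h)
    simp only [cur, next, ediv, emod] at this
    exact this (ih hlt.le)

open Classical in
lemma episodesDone_succ (X : Trajectory S A Ω) (H m : ℕ) (ω : Ω) :
    X.episodesDone H (m + 1) ω = X.episodesDone H m ω + if X.state m H ω = none then 1 else 0 := by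
  rw [episodesDone, Finset.range_add_one, Finset.filter_insert]
  split_ifs with h
  · rw [Finset.card_insert_of_notMem (by simp), episodesDone]
  · rw [add_zero, episodesDone]

lemma episodesDone_mono (X : Trajectory S A Ω) (H : ℕ) (ω : Ω) :
    Monotone fun m => X.episodesDone H m ω :=
  monotone_nat_of_le_succ fun m => by
    rw [episodesDone_succ]
    exact Nat.le_add_right _ _

/-- The count rises by at most one per interval, so the first time it is at least `K` it equals `K`.
-/
lemma exists_last_interval {K : ℕ} (hK : 0 < K) (h : ∃ m, K ≤ X.episodesDone H m ω) :
    ∃ n, X.state n H ω = none ∧ X.episodesDone H (n + 1) ω = K := by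
  classical
  obtain ⟨n, hn⟩ : ∃ n, Nat.find h = n + 1 := by
    refine Nat.exists_eq_succ_of_ne_zero fun h0 => ?_
    have := Nat.find_spec h
    rw [h0] at this
    simp [episodesDone] at this
    omega
  have h1 := Nat.find_spec h
  have h2 := Nat.find_min h (m := n) (by omega)
  rw [hn, episodesDone_succ] at h1
  refine ⟨n, ?_⟩
  rw [episodesDone_succ]
  split_ifs at h1 ⊢ with h3
  · exact ⟨h3, by omega⟩
  · omega

open Classical in
/-- Long runs without reaching the goal incur regret. -/
lemma mul_le_sum_interval {p : FHParams} {u c : ℕ → ℝ} {b : ℝ} (hc : ∀ m, 0 ≤ c m) (hcf : p.cf = 2 * b)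
    (hu : ∀ m, u m ≤ 3 / 2 * b) (n : ℕ) :
    b / 2 * n - 2 * b * X.episodesDone p.H n ω
      ≤ ∑ m ∈ Finset.range n, (c m + FHSSP.terminalCost p (X.state m p.H ω) - u m) := by
  induction n with
  | zero => simp [Trajectory.episodesDone]
  | succ n ih =>
    rw [Finset.sum_range_succ, episodesDone_succ]
    have h1 := hc n
    have h2 := hu n
    -- An interval ending in the goal loses at most `3 / 2 * b = 2 * b - b / 2`; any other gains at
    -- least `2 * b - 3 / 2 * b = b / 2`.
    split_ifs with hy
    · rw [hy, show FHSSP.terminalCost p (none : Option S) = 0 from rfl]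
      push_cast
      linarith
    · have ht : FHSSP.terminalCost p (X.state n p.H ω) = p.cf := by
        obtain ⟨s, hs⟩ := Option.ne_none_iff_exists'.mp hy
        rw [hs]; rfl
      rw [ht]
      push_cast
      linarith

end Trajectory

namespace IsRun

open FHSSP

variable {S : Type u} {A : Type v} {Ω : Type w} [MeasurableSpace S] [MeasurableSpace A]
  [Fintype A] [Nonempty A] {mΩ : MeasurableSpace Ω} {d : ℕ}
  {M : SSP S A} {φ : S → A → EuclideanSpace ℝ (Fin d)} {p : FHParams} {K : ℕ} {P : Measure Ω}
  {ℱ : Filtration ℕ mΩ} {X : Trajectory S A Ω} {ω : Ω}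

/-- Costs of the next episodes are paid by the terminal costs of the intervals that do not end in
the goal, except for the first interval of each episode. -/
lemma sum_sub_terminalCost_le (hX : IsRun M φ p K P ℱ X) (hK : 0 < K) {u : ℕ → ℝ} {b : ℝ}
    (h0 : 0 ≤ p.cf) (hb : 0 ≤ b) (hu : ∀ m, u m ≤ p.cf)
    (hinit : ∀ m, X.state m 0 ω = some M.init → u m ≤ b)
    (hnone : ∀ m, X.state m 0 ω = none → u m ≤ 0) (n : ℕ) :
    ∑ m ∈ Finset.range (n + 1), (u m - terminalCost p (X.state m p.H ω)) ≤ K * b := by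
  have hcf : ∀ x : Option S, 0 ≤ terminalCost p x := by
    intro x
    cases x with
    | none => exact le_rfl
    | some s => exact h0
  -- The invariant keeps the latest terminal cost as credit for the next interval. The minimum
  -- counts the episodes started so far.
  have key : ∀ n, ∑ m ∈ Finset.range (n + 1), (u m - terminalCost p (X.state m p.H ω))
      + terminalCost p (X.state n p.H ω) ≤ (min (X.episodesDone p.H n ω + 1) K : ℕ) * b := by
    intro n
    induction n with
    | zero =>
      have : min (X.episodesDone p.H 0 ω + 1) K = 1 := by
        simp [Trajectory.episodesDone]; omega
      rw [this]
      simpa using hinit 0 (hX.start ω)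
    | succ n ih =>
      rw [Finset.sum_range_succ, add_assoc, sub_add_cancel]
      by_cases hy : X.state n p.H ω = none
      · have hE : X.episodesDone p.H (n + 1) ω = X.episodesDone p.H n ω + 1 := by
          rw [Trajectory.episodesDone_succ, if_pos hy]
        have hr := hX.restart n ω hy
        rw [hy, show terminalCost p (none : Option S) = 0 from rfl, add_zero] at ih
        split_ifs at hr with hlt
        · have h1 : min (X.episodesDone p.H (n + 1) ω + 1) K
              = min (X.episodesDone p.H n ω + 1) K + 1 := by omega
          rw [h1, Nat.cast_add, Nat.cast_one, add_mul, one_mul]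
          exact add_le_add ih (hinit _ hr)
        · have h1 : min (X.episodesDone p.H n ω + 1) K
              ≤ min (X.episodesDone p.H (n + 1) ω + 1) K := by omega
          have h2 : ((min (X.episodesDone p.H n ω + 1) K : ℕ) : ℝ) * b
              ≤ (min (X.episodesDone p.H (n + 1) ω + 1) K : ℕ) * b := by gcongr
          linarith [hnone _ hr]
      · have hE : X.episodesDone p.H (n + 1) ω = X.episodesDone p.H n ω := by
          rw [Trajectory.episodesDone_succ, if_neg hy, add_zero]
        have ht : terminalCost p (X.state n p.H ω) = p.cf := by
          obtain ⟨s, hs⟩ := Option.ne_none_iff_exists'.mp hy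
          rw [hs]; rfl
        rw [hE]
        linarith [hu (n + 1)]
  have h1 : ((min (X.episodesDone p.H n ω + 1) K : ℕ) : ℝ) * b ≤ K * b := by
    gcongr
    exact min_le_right _ _
  linarith [key n, hcf (X.state n p.H ω)]

lemma state_eq_none_of_le (hX : IsRun M φ p K P ℱ X) (hω : X.Absorbed p.H ω) {n : ℕ}
    (hn : K ≤ X.episodesDone p.H (n + 1) ω) (hlast : X.state n p.H ω = none) {m : ℕ}
    (hm : n + 1 ≤ m) {h : ℕ} (hh : h ≤ p.H) : X.state m h ω = none := by
  suffices hs : X.state m 0 ω = none from hω.state_eq_none hs hh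
  have hstep : ∀ k, n ≤ k → X.state k p.H ω = none → X.state (k + 1) 0 ω = none := by
    intro k hk hy
    rw [hX.restart k ω hy, if_neg]
    exact not_lt.mpr (hn.trans (X.episodesDone_mono p.H ω (Nat.succ_le_succ hk)))
  induction m, hm using Nat.le_induction with
  | base => exact hstep n le_rfl hlast
  | succ m hm ih => exact hstep m (by omega) (hω.state_eq_none ih le_rfl)

/-- The regret of a run in which all episodes are completed. -/
lemma regret_le (hX : IsRun M φ p K P ℱ X) (hω : X.Absorbed p.H ω) {n : ℕ}
    (hn : K ≤ X.episodesDone p.H (n + 1) ω) (hlast : X.state n p.H ω = none) {π : S → A}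
    (hv : M.value π M.init ≠ ⊤) {D : ℝ}
    (hD : ∑ m ∈ Finset.range (n + 1), ∑ h ∈ Finset.range p.H,
      M.stepCost (X.state m h ω) (X.action m h ω) ≤ K * (M.value π M.init).toReal + D) :
    X.regret M π p.H K ω ≤ (D : EReal) := by
  classical
  have hnone : ∀ m ∉ Finset.range (n + 1), ∀ h ∈ Finset.range p.H, X.state m h ω = none :=
    fun m hm h hh => hX.state_eq_none_of_le hω hn hlast (by simpa using hm)
      (Finset.mem_range.mp hh).le
  have hT : X.totalSteps p.H ω ≠ ⊤ := by
    rw [Trajectory.totalSteps, tsum_eq_sum (s := Finset.range (n + 1))]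
    · refine ENNReal.sum_ne_top.mpr fun m _ => ENNReal.sum_ne_top.mpr fun h _ => ?_
      split_ifs <;> simp
    · intro m hm
      exact Finset.sum_eq_zero fun h hh => if_pos (hnone m hm h hh)
  have hC : X.totalCost M p.H ω = ENNReal.ofReal (∑ m ∈ Finset.range (n + 1),
      ∑ h ∈ Finset.range p.H, M.stepCost (X.state m h ω) (X.action m h ω)) := by
    rw [Trajectory.totalCost, tsum_eq_sum (s := Finset.range (n + 1)), ENNReal.ofReal_sum_of_nonneg]
    · refine Finset.sum_congr rfl fun m _ => ?_
      rw [ENNReal.ofReal_sum_of_nonneg fun h _ => (SSP.stepCost_mem _ _).1]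
    · exact fun m _ => Finset.sum_nonneg fun h _ => (SSP.stepCost_mem _ _).1
    · intro m hm
      refine Finset.sum_eq_zero fun h hh => ?_
      rw [hnone m hm h hh]
      simp [SSP.stepCost]
  have hV : (M.value π M.init : EReal) = ((M.value π M.init).toReal : EReal) := by
    conv_lhs => rw [← ENNReal.ofReal_toReal hv]
    rw [EReal.coe_ennreal_ofReal, max_eq_left ENNReal.toReal_nonneg]
  have hK : (K : EReal) = ((K : ℝ) : EReal) := by norm_cast
  rw [Trajectory.regret, if_neg hT, hC, hV, hK, EReal.coe_ennreal_ofReal, max_eq_left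
    (Finset.sum_nonneg fun m _ => Finset.sum_nonneg fun h _ => (SSP.stepCost_mem _ _).1)]
  rw [← EReal.coe_mul, ← EReal.coe_sub, EReal.coe_le_coe_iff]
  linarith

variable [MeasurableSingletonClass A] [IsProbabilityMeasure P]

/-- A run is specified only through conditional laws. Since the law at the goal is a Dirac mass,
leaving the goal is a null event at each of countably many times. -/
lemma ae_absorbed (hX : IsRun M φ p K P ℱ X) (hH : 0 < p.H) : ∀ᵐ ω ∂P, X.Absorbed p.H ω := by
  refine ae_all_iff.mpr fun t => ?_
  have hset : MeasurableSet[ℱ t] (X.cur p.H t ⁻¹' {none}) :=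
    hX.measurable_cur hH le_rfl measurableSet_singleton_none
  set G : Ω × Option S → ENNReal := fun q =>
    (X.cur p.H t ⁻¹' {none}).indicator (fun _ => 1) q.1 * SSP.alive q.2 with hG
  have hGm : Measurable[(ℱ t).prod inferInstance] G := by
    refine Measurable.mul ?_ ?_
    · exact (Measurable.indicator (m := ℱ t) measurable_const hset).comp measurable_fst
    · exact SSP.measurable_alive.comp measurable_snd
  have h := hX.lintegral_next hH t hGm
  have h0 : ∀ ω, ∫⁻ x, G (ω, x) ∂X.nextLaw M p.H t ω = 0 := by
    intro ω
    simp only [hG]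
    rw [lintegral_const_mul _ SSP.measurable_alive]
    by_cases hc : X.cur p.H t ω = none
    · rw [Trajectory.nextLaw, hc]
      change _ * ∫⁻ x, SSP.alive x ∂(Measure.dirac none) = 0
      rw [lintegral_dirac' _ SSP.measurable_alive, SSP.alive_none, mul_zero]
    · rw [Set.indicator_of_notMem (by simpa using hc), zero_mul]
  simp only [h0, lintegral_zero] at h
  have hm : Measurable fun ω => G (ω, X.next p.H t ω) := by
    refine Measurable.mul ?_ ?_
    · exact measurable_const.indicator (ℱ.le t _ hset)
    · exact SSP.measurable_alive.comp
        ((hX.measurable_next hH (Nat.lt_succ_self t)).mono (ℱ.le _) le_rfl)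
  rw [lintegral_eq_zero_iff hm] at h
  filter_upwards [h] with ω hω hc
  by_contra hne
  obtain ⟨s, hs⟩ := Option.ne_none_iff_exists'.mp hne
  simp [hG, hs, hc, SSP.alive_some] at hω

end IsRun

end

noncomputable section

open Matrix

/-! ## Numerical estimates for the regret -/

/-- Apply `log x ≤ x` to the fourth root. The bound serves to solve an inequality for `m` that has
`m` inside a logarithm. -/
lemma Real.sq_log_le {y : ℝ} (hy : 1 ≤ y) : Real.log y ^ 2 ≤ 16 * √y := by
  have h1 : Real.log y = 4 * Real.log √√y := by
    rw [Real.log_sqrt (Real.sqrt_nonneg _), Real.log_sqrt (by linarith)]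
    ring
  have h2 : Real.log √√y ≤ √√y := (Real.log_le_self (Real.sqrt_nonneg _))
  have h3 : 0 ≤ Real.log y := Real.log_nonneg hy
  calc Real.log y ^ 2 ≤ (4 * √√y) ^ 2 := by
        refine pow_le_pow_left₀ h3 ?_ 2
        rw [h1]
        linarith
    _ = 16 * √y := by rw [mul_pow, Real.sq_sqrt (Real.sqrt_nonneg _)]; norm_num

namespace FHSSP

/-- All logarithms are dominated by multiples of that of the bonus. The factor `d * √X` of `β` times
`√(m * h * d * X)` produces `√(d ^ 3 * m * h) * X`; `603` is `4 * 50 * 3` from the bonus plus `3`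
from the noise. -/
lemma intervalRegretBound_le {d : ℕ} {p : FHParams} {b : ℝ} (hd : 2 ≤ d) (hH : 0 < p.H)
    (hB : p.B = 3 * b) (hb : 1 ≤ b) (hδ : 0 < p.δ) (hδ1 : p.δ < 1) (n : ℕ) :
    1 ≤ Real.log (48 * b * (n + 1 : ℕ) * p.H * d / p.δ) ∧ intervalRegretBound d p n
      ≤ 12 * b * d * p.H * Real.log (48 * b * (n + 1 : ℕ) * p.H * d / p.δ)
        + 603 * b * √(d ^ 3 * ((n + 1 : ℕ) * p.H))
          * Real.log (48 * b * (n + 1 : ℕ) * p.H * d / p.δ) := by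
  have hd' : (2 : ℝ) ≤ d := by exact_mod_cast hd
  have hh : (1 : ℝ) ≤ p.H := by exact_mod_cast hH
  have hm : (1 : ℝ) ≤ (n + 1 : ℕ) := by exact_mod_cast Nat.succ_pos n
  have e1 : 16 * p.B * (n + 1 : ℕ) * p.H * d / p.δ = 48 * b * (n + 1 : ℕ) * p.H * d / p.δ := by
    rw [hB]; ring
  have e2 : ((n : ℝ) + 1) * (n + 2) = (n + 1 : ℕ) * ((n + 1 : ℕ) + 1) := by push_cast; ring
  rw [intervalRegretBound, beta, e1, e2, Nat.cast_mul, hB]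
  generalize (d : ℝ) = d at *
  generalize (p.H : ℝ) = h at *
  generalize ((n + 1 : ℕ) : ℝ) = m at *
  generalize p.δ = δ at *
  have hmh : 1 ≤ m * h := one_le_mul_of_one_le_of_one_le hm hh
  have hmhd : m * h * 2 ≤ m * h * d := by gcongr
  have hbm : m * h * d ≤ b * (m * h * d) := le_mul_of_one_le_left (by positivity) hb
  set Y := 48 * b * m * h * d / δ with hY
  have hYδ : 48 * b * m * h * d ≤ Y := by
    rw [hY, le_div_iff₀ hδ]
    exact mul_le_of_le_one_right (by positivity) hδ1.le
  have hX : 1 ≤ Real.log Y := by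
    rw [Real.le_log_iff_exp_le (by linarith)]
    linarith [Real.exp_one_lt_d9]
  refine ⟨hX, ?_⟩
  set X := Real.log Y with hXdef
  have hX0 : 0 ≤ X := by linarith
  have hG : Real.log (d + m * h) ≤ X := by
    refine Real.log_le_log (by linarith) (le_trans ?_ hYδ)
    have h1 : d ≤ m * h * d := le_mul_of_one_le_left (by linarith) hmh
    linarith
  have hlog : Real.log (m * (m + 1) / δ) ≤ 2 * X := by
    have : Real.log (m * (m + 1) / δ) ≤ Real.log (Y ^ 2) := by
      refine Real.log_le_log (by positivity) ?_
      have hm2 : m ≤ m * (h * d) := le_mul_of_one_le_right (by linarith)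
        (one_le_mul_of_one_le_of_one_le hh (by linarith))
      have h1 : m + 1 ≤ Y := by
        linarith [show 48 * b * m * h * d = 48 * (b * (m * h * d)) by ring,
          show m * h * d = m * (h * d) by ring]
      have h2 : m / δ ≤ Y := by
        rw [hY]
        gcongr
        linarith [show 48 * b * m * h * d = 48 * (b * (m * h * d)) by ring,
          show m * h * d = m * (h * d) by ring]
      calc m * (m + 1) / δ = m / δ * (m + 1) := by ring
        _ ≤ Y * Y := mul_le_mul h2 h1 (by linarith) (by linarith)
        _ = Y ^ 2 := by ring
    rwa [Real.log_pow] at this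
  have hdd : (1 : ℝ) ≤ d ^ 3 := one_le_pow₀ (by linarith)
  set R := √(d ^ 3 * (m * h)) with hR
  have t2 : 4 * (50 * d * (3 * b) * √X) * √(m * h * (d * Real.log (d + m * h)))
      ≤ 600 * b * R * X := by
    have h1 : √X * √(m * h * (d * Real.log (d + m * h))) * d ≤ R * X := by
      rw [← Real.sqrt_mul hX0]
      have h2 : d = √(d ^ 2) := (Real.sqrt_sq (by linarith)).symm
      have h3 : X = √(X ^ 2) := (Real.sqrt_sq hX0).symm
      calc √(X * (m * h * (d * Real.log (d + m * h)))) * d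
          ≤ √(X * (m * h * (d * X))) * √(d ^ 2) := by
            rw [← h2]
            gcongr
        _ = √(d ^ 3 * (m * h)) * √(X ^ 2) := by
            rw [← Real.sqrt_mul (by positivity), ← Real.sqrt_mul (by positivity)]
            congr 1
            ring
        _ = R * X := by rw [← h3]
    calc _ = 600 * b * (√X * √(m * h * (d * Real.log (d + m * h))) * d) := by ring
      _ ≤ 600 * b * (R * X) := by gcongr
      _ = _ := by ring
  have t3 : 3 * b * √(m * h * Real.log (m * (m + 1) / δ)) ≤ 3 * b * R * X := by
    have h3 : X = √(X ^ 2) := (Real.sqrt_sq hX0).symm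
    have : √(m * h * Real.log (m * (m + 1) / δ)) ≤ R * X := by
      calc √(m * h * Real.log (m * (m + 1) / δ)) ≤ √(d ^ 3 * (m * h) * X ^ 2) := by
            refine Real.sqrt_le_sqrt ?_
            have h4 : 2 * X ≤ d ^ 3 * X ^ 2 := by
              have h5 : (2 : ℝ) ≤ d ^ 3 := by
                calc (2 : ℝ) ≤ d ^ 1 := by linarith
                  _ ≤ d ^ 3 := pow_le_pow_right₀ (by linarith) (by norm_num)
              have h6 : X ≤ X ^ 2 := le_self_pow₀ hX two_ne_zero
              exact mul_le_mul h5 h6 hX0 (by linarith)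
            calc m * h * Real.log (m * (m + 1) / δ) ≤ m * h * (d ^ 3 * X ^ 2) := by
                  gcongr
                  exact hlog.trans h4
              _ = _ := by ring
        _ = R * X := by rw [Real.sqrt_mul (by positivity), ← h3]
    calc _ ≤ 3 * b * (R * X) := by gcongr
      _ = _ := by ring
  have t1 : 4 * (3 * b) * h * (d * Real.log (d + m * h)) ≤ 12 * b * d * h * X := by
    calc _ = 12 * b * d * h * Real.log (d + m * h) := by ring
      _ ≤ _ := by gcongr
  linarith

end FHSSP

section

variable {d b τ K δ h m : ℝ}

/-- Solving the quadratic inequality for the number of intervals. -/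
lemma le_of_le_add_sqrt {r X : ℝ} (hd : 1 ≤ d) (hb : 0 < b) (hh : 0 ≤ h) (hm : 0 ≤ m)
    (hX : 1 ≤ X) (hr : r ≤ 12 * b * d * h * X + 603 * b * √(d ^ 3 * (m * h)) * X)
    (hM : b / 2 * m - 2 * b * K ≤ r) : m ≤ 8 * K + 1500000 * (d ^ 3 * h * X ^ 2) := by
  have h1 : b * (m / 2) ≤ b * (2 * K + 12 * d * h * X + 603 * √(d ^ 3 * (m * h)) * X) := by
    linarith
  have h2 := le_of_mul_le_mul_left h1 hb
  -- The arithmetic-geometric inequality, with weights that leave `m / 4` on the left side.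
  have h3 : 603 * √(d ^ 3 * (m * h)) * X ≤ m / 4 + 603 ^ 2 * (d ^ 3 * h * X ^ 2) := by
    have e : √(d ^ 3 * (m * h)) = √m * √(d ^ 3 * h) := by
      rw [← Real.sqrt_mul hm]; congr 1; ring
    have s1 := Real.sq_sqrt hm
    have s2 := Real.sq_sqrt (show 0 ≤ d ^ 3 * h by positivity)
    have := sq_nonneg (√m / 2 - 603 * √(d ^ 3 * h) * X)
    have e2 : (√m / 2 - 603 * √(d ^ 3 * h) * X) ^ 2
        = √m ^ 2 / 4 - 603 * (√m * √(d ^ 3 * h)) * X + 603 ^ 2 * (√(d ^ 3 * h) ^ 2 * X ^ 2) := by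
      ring
    rw [e2, s1, s2, ← e] at this
    linarith
  have h4 : d * h * X ≤ d ^ 3 * h * X ^ 2 := by
    have : d ≤ d ^ 3 := le_self_pow₀ hd (by norm_num)
    have : X ≤ X ^ 2 := le_self_pow₀ hX two_ne_zero
    gcongr
  have h5 : 0 ≤ d ^ 3 * h * X ^ 2 := by positivity
  linarith

/-- The number of intervals and its logarithm are bounded in terms of the instance. -/
lemma log_le_of_le_add_log (hd : 2 ≤ d) (hb : 1 ≤ b) (hτ : 1 ≤ τ) (hK : 2 ≤ K) (hδ : 0 < δ)
    (hδ1 : δ < 1) (hh : 0 < h) (hh1 : h ≤ 4 * τ * Real.log (4 * K) + 1) (hm : 1 ≤ m)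
    (hX : 1 ≤ Real.log (48 * b * m * h * d / δ))
    (hM : m ≤ 8 * K + 1500000 * (d ^ 3 * h * Real.log (48 * b * m * h * d / δ) ^ 2)) :
    m ≤ 144 * 10 ^ 18 * (d * b * τ * K / δ) ^ 10 ∧
      Real.log (48 * b * m * h * d / δ) ≤ 51 * Real.log (d * b * τ * K / δ) := by
  set Z := d * b * τ * K / δ with hZ
  have hτK : 2 ≤ τ * K := by nlinarith
  have hbd : 2 ≤ b * d := by nlinarith
  have hbd1 : 1 ≤ b / δ := by rw [one_le_div hδ]; linarith
  have z1 : τ * K ≤ Z := by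
    have : Z = τ * K * (d * (b / δ)) := by rw [hZ]; ring
    rw [this]
    exact le_mul_of_one_le_right (by positivity)
      (one_le_mul_of_one_le_of_one_le (by linarith) hbd1)
  have z2 : d ≤ Z := by
    have : Z = d * ((τ * K) * (b / δ)) := by rw [hZ]; ring
    rw [this]
    exact le_mul_of_one_le_right (by positivity)
      (one_le_mul_of_one_le_of_one_le (by linarith) hbd1)
  have z3 : b * d / δ ≤ Z := by
    have : Z = b * d / δ * (τ * K) := by rw [hZ]; ring
    rw [this]
    exact le_mul_of_one_le_right (by positivity) (by linarith)
  have z4 : 4 ≤ Z := by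
    have : Z = (b / δ) * (d * (τ * K)) := by rw [hZ]; ring
    rw [this]
    calc (4 : ℝ) = 1 * (2 * 2) := by norm_num
      _ ≤ _ := by gcongr
  have z5 : K ≤ Z := (le_mul_of_one_le_left (by linarith) hτ).trans z1
  have hhZ : h ≤ 17 * Z := by
    have h1 : Real.log (4 * K) ≤ 4 * K := Real.log_le_self (by linarith)
    have h2 : 4 * τ * Real.log (4 * K) ≤ 4 * τ * (4 * K) := by gcongr
    linarith
  have hY0 : 1 ≤ 48 * b * m * h * d / δ := by
    by_contra! hlt
    have := Real.log_nonpos (by positivity) hlt.le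
    linarith
  have hsqrtY : √(48 * b * m * h * d / δ) ≤ 29 * Z * √m := by
    have h1 : 48 * b * m * h * d / δ ≤ (29 * Z) ^ 2 * m := by
      calc 48 * b * m * h * d / δ = 48 * (b * d / δ) * h * m := by ring
        _ ≤ 48 * Z * (17 * Z) * m := by gcongr
        _ ≤ _ := by nlinarith [mul_nonneg (sq_nonneg Z) (show 0 ≤ m by linarith)]
    calc _ ≤ √((29 * Z) ^ 2 * m) := Real.sqrt_le_sqrt h1
      _ = _ := by rw [Real.sqrt_mul (by positivity), Real.sqrt_sq (by positivity)]
  have hsm : 1 ≤ √m := Real.one_le_sqrt.mpr hm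
  -- Bounding the squared logarithm by a square root makes the right side linear in `√m`, so one
  -- factor `√m` cancels.
  have hmZ : √m ≤ 12 * 10 ^ 9 * Z ^ 5 := by
    have h1 : m ≤ 8 * Z ^ 5 * √m + 1500000 * (Z ^ 3 * (17 * Z) * (16 * (29 * Z * √m))) := by
      refine hM.trans ?_
      have h2 : K ≤ Z ^ 5 * √m := z5.trans ((le_self_pow₀ (by linarith) (by norm_num)).trans
        (le_mul_of_one_le_right (by positivity) hsm))
      have h3 := (Real.sq_log_le hY0).trans (mul_le_mul_of_nonneg_left hsqrtY (by norm_num))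
      have h4 : d ^ 3 * h * Real.log (48 * b * m * h * d / δ) ^ 2
          ≤ Z ^ 3 * (17 * Z) * (16 * (29 * Z * √m)) := by gcongr
      linarith
    have h5 : √m * √m ≤ 12 * 10 ^ 9 * Z ^ 5 * √m := by
      rw [Real.mul_self_sqrt (by linarith)]
      have : 0 ≤ Z ^ 5 * √m := by positivity
      nlinarith
    exact le_of_mul_le_mul_right h5 (by linarith)
  have hmZ' : m ≤ 144 * 10 ^ 18 * Z ^ 10 := by
    calc m = √m ^ 2 := (Real.sq_sqrt (by linarith)).symm
      _ ≤ (12 * 10 ^ 9 * Z ^ 5) ^ 2 := by gcongr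
      _ = _ := by ring
  refine ⟨hmZ', ?_⟩
  have hYZ : 48 * b * m * h * d / δ ≤ Z ^ 51 := by
    calc 48 * b * m * h * d / δ = 48 * (b * d / δ) * h * m := by ring
      _ ≤ 48 * Z * (17 * Z) * (144 * 10 ^ 18 * Z ^ 10) := by gcongr
      _ = (816 * 144 * 10 ^ 18) * Z ^ 12 := by ring
      -- Numerical constants become powers of `Z` through `4 ≤ Z`; thus `51 = 39 + 12`.
      _ ≤ 4 ^ 39 * Z ^ 12 := by gcongr; norm_num
      _ ≤ Z ^ 39 * Z ^ 12 := by gcongr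
      _ = _ := by ring
  calc _ ≤ Real.log (Z ^ 51) := Real.log_le_log (by linarith) hYZ
    _ = _ := by rw [Real.log_pow]; norm_num

/-- The bound on the number `m` of intervals is inserted into the regret bound. Its part of order
`K` yields the `√K` term. Its other part makes `d ^ 3 * m * h` essentially a square, about `(1225 *
d ^ 3 * h * X) ^ 2`, and yields the lower-order term. -/
lemma add_regret_le {r X : ℝ} (hd : 2 ≤ d) (hb : 1 ≤ b) (hτ : 1 ≤ τ) (hK : 2 ≤ K) (hδ : 0 < δ)
    (hδ1 : δ < 1) (hh : 0 < h) (hh1 : h ≤ 4 * τ * Real.log (4 * K) + 1)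
    (hX : 1 ≤ X) (hXL : X ≤ 51 * Real.log (d * b * τ * K / δ))
    (hM : m ≤ 8 * K + 1500000 * (d ^ 3 * h * X ^ 2))
    (hr : r ≤ 12 * b * d * h * X + 603 * b * √(d ^ 3 * (m * h)) * X) :
    b + r ≤ 2 * 10 ^ 10 * (√(d ^ 3 * b ^ 2 * τ * K) + d ^ 3 * b * τ)
      * Real.log (d * b * τ * K / δ) ^ 3 := by
  set Z := d * b * τ * K / δ with hZ
  set L := Real.log Z with hL
  have z1 : 2 * K ≤ Z := by
    rw [hZ, le_div_iff₀ hδ]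
    calc 2 * K * δ ≤ 2 * K * 1 := by gcongr
      _ = 2 * 1 * 1 * K := by ring
      _ ≤ _ := by gcongr
  have hL1 : 1 ≤ L := by
    rw [hL, Real.le_log_iff_exp_le (by linarith)]
    linarith [Real.exp_one_lt_d9]
  have hlogK : Real.log (4 * K) ≤ 2 * L := by
    have : Real.log (4 * K) ≤ Real.log (Z ^ 2) := Real.log_le_log (by linarith) (by nlinarith)
    rwa [Real.log_pow] at this
  have hτL : 1 ≤ τ * L := one_le_mul_of_one_le_of_one_le hτ hL1
  have hhL : h ≤ 9 * (τ * L) := by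
    have : 4 * τ * Real.log (4 * K) ≤ 4 * τ * (2 * L) := by gcongr
    linarith
  have hL2 : L ≤ L ^ 2 := le_self_pow₀ hL1 (by norm_num)
  have hL3 : L ^ 2 ≤ L ^ 3 := pow_le_pow_right₀ hL1 (by norm_num)
  have hd3 : d ≤ d ^ 3 := le_self_pow₀ (by linarith) (by norm_num)
  have hroot : √(d ^ 3 * (m * h)) ≤ 9 * √(d ^ 3 * τ * K) * L + 1225 * (d ^ 3 * h * X) := by
    have h1 : d ^ 3 * (m * h) ≤ 81 * (d ^ 3 * τ * K) * L ^ 2 + (1225 * (d ^ 3 * h * X)) ^ 2 := by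
      have h2 : d ^ 3 * (m * h) ≤ d ^ 3 * ((8 * K + 1500000 * (d ^ 3 * h * X ^ 2)) * h) := by
        gcongr
      have h3 : d ^ 3 * K * h ≤ d ^ 3 * K * (9 * (τ * L)) := by gcongr
      have h4 : d ^ 3 * τ * K * L ≤ d ^ 3 * τ * K * L ^ 2 := by gcongr
      have h5 : 0 ≤ (d ^ 3 * h * X) ^ 2 := sq_nonneg _
      have h6 : 0 ≤ d ^ 3 * τ * K * L := by positivity
      nlinarith
    calc _ ≤ √(81 * (d ^ 3 * τ * K) * L ^ 2 + (1225 * (d ^ 3 * h * X)) ^ 2) :=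
          Real.sqrt_le_sqrt h1
      _ ≤ √((9 * √(d ^ 3 * τ * K) * L + 1225 * (d ^ 3 * h * X)) ^ 2) := by
        refine Real.sqrt_le_sqrt ?_
        have h2 := Real.sq_sqrt (show 0 ≤ d ^ 3 * τ * K by positivity)
        have h3 : 0 ≤ 9 * √(d ^ 3 * τ * K) * L * (1225 * (d ^ 3 * h * X)) := by positivity
        have h4 : (9 * √(d ^ 3 * τ * K) * L + 1225 * (d ^ 3 * h * X)) ^ 2
            = 81 * √(d ^ 3 * τ * K) ^ 2 * L ^ 2
              + 2 * (9 * √(d ^ 3 * τ * K) * L * (1225 * (d ^ 3 * h * X)))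
              + (1225 * (d ^ 3 * h * X)) ^ 2 := by ring
        rw [h4, h2]
        linarith
      _ = _ := Real.sqrt_sq (by positivity)
  have hbroot : √(d ^ 3 * b ^ 2 * τ * K) = b * √(d ^ 3 * τ * K) := by
    rw [show d ^ 3 * b ^ 2 * τ * K = b ^ 2 * (d ^ 3 * τ * K) by ring,
      Real.sqrt_mul (by positivity), Real.sqrt_sq (by linarith)]
  rw [hbroot]
  set R := √(d ^ 3 * τ * K)
  have hR : 0 ≤ R := Real.sqrt_nonneg _
  have c0 : b ≤ d ^ 3 * b * τ * L ^ 3 := by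
    calc b = 1 * b * 1 * 1 := by ring
      _ ≤ _ := by
        gcongr
        · linarith
        · linarith
  have c1 : 12 * b * d * h * X ≤ 5508 * (d ^ 3 * b * τ * L ^ 3) := by
    calc 12 * b * d * h * X ≤ 12 * b * d ^ 3 * (9 * (τ * L)) * (51 * L) := by gcongr
      _ = 5508 * (d ^ 3 * b * τ * L ^ 2) := by ring
      _ ≤ _ := by gcongr
  have c2 : 603 * b * √(d ^ 3 * (m * h)) * X
      ≤ 276777 * (b * R * L ^ 3) + 17291643075 * (d ^ 3 * b * τ * L ^ 3) := by
    calc 603 * b * √(d ^ 3 * (m * h)) * X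
        ≤ 603 * b * (9 * R * L + 1225 * (d ^ 3 * (9 * (τ * L)) * (51 * L))) * (51 * L) := by
          gcongr
          exact hroot.trans (by gcongr)
      _ = 276777 * (b * R * L ^ 2) + 17291643075 * (d ^ 3 * b * τ * L ^ 3) := by ring
      _ ≤ _ := by gcongr
  have c3 : 0 ≤ b * R * L ^ 3 := by positivity
  have c4 : 0 ≤ d ^ 3 * b * τ * L ^ 3 := by positivity
  calc b + r ≤ 276777 * (b * R * L ^ 3) + 17300000000 * (d ^ 3 * b * τ * L ^ 3) := by linarith
    _ ≤ 2 * 10 ^ 10 * (b * R * L ^ 3 + d ^ 3 * b * τ * L ^ 3) := by linarith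
    _ = _ := by ring

end

end

noncomputable section

open Matrix

/-! ## The regret bound -/

namespace SSP

variable {S : Type u} {A : Type v} [MeasurableSpace S] [MeasurableSpace A]
  [MeasurableSingletonClass A] [Countable A] {M : SSP S A} {π : S → A}

lemma maxValue_le_maxHittingTime (hπ : Measurable π) (hc : Measurable (M.policyCost π)) :
    M.maxValue π ≤ M.maxHittingTime π :=
  iSup_mono fun s => value_le_hittingTime hπ hc s

lemma totalValue_le_maxValue (hπ : Measurable π) (hc : Measurable (M.policyCost π))
    (x : Option S) : M.totalValue π x ≤ M.maxValue π := by
  cases x with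
  | none => rw [totalValue_none hπ hc]; exact zero_le
  | some s =>
    rw [← value_eq hπ hc]
    exact le_iSup (M.value π) s

/-- Terminal cost `2 * b` times failure probability `1 / (2 * K)`. Over `K` episodes these excesses
add up to only `b`. -/
lemma horizonValue_horizon_le (hπ : Measurable π) (hc : Measurable (M.policyCost π))
    (hT : M.maxHittingTime π ≠ ⊤) (hT1 : 1 ≤ (M.maxHittingTime π).toReal) {K : ℕ} (hK : 2 ≤ K)
    {b : ℝ} (hb : 0 ≤ b) (x : Option S) :
    M.horizonValue π (ENNReal.ofReal (2 * b))
        ⌈4 * (M.maxHittingTime π).toReal * Real.log (4 * K)⌉₊ x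
      ≤ M.totalValue π x + ENNReal.ofReal (b / K) := by
  refine (horizonValue_le hπ hc _ _ x).trans (add_le_add le_rfl ?_)
  have hs := survival_horizon_le hπ hT1 (fun s => by
    rw [ENNReal.ofReal_toReal hT]; exact le_iSup (M.hittingTime π) s) hK x
  refine (mul_le_mul_right hs _).trans ?_
  rw [← ENNReal.ofReal_mul (by positivity)]
  refine ENNReal.ofReal_le_ofReal (le_of_eq ?_)
  have : (K : ℝ) ≠ 0 := by positivity
  field_simp

end SSP

namespace IsRun

open FHSSP

variable {S : Type u} {A : Type v} {Ω : Type w} [MeasurableSpace S] [MeasurableSpace A]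
  [MeasurableSingletonClass A] [Fintype A] [Nonempty A] {mΩ : MeasurableSpace Ω} {d : ℕ}
  {M : SSP S A} {φ : S → A → EuclideanSpace ℝ (Fin d)} {K : ℕ} {δ : ℝ} {π : S → A}
  {P : Measure Ω} {ℱ : Filtration ℕ mΩ} {X : Trajectory S A Ω} {ω : Ω}

/-- The regret bound holds on the event that the confidence bounds hold and the noise is small. -/
theorem regret_le_of_confident (hX : IsRun M φ (fhParams M π K δ) K P ℱ X) (hφ : M.IsLinear φ)
    (hd : 2 ≤ d) (hπ : Measurable π) (hT : M.maxHittingTime π ≠ ⊤)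
    (hb1 : 1 ≤ (M.maxValue π).toReal) (hK : 2 ≤ K) (hδ : 0 < δ) (hδ1 : δ < 1)
    (hω : X.Confident M φ (fhParams M π K δ) ω) (habs : X.Absorbed (fhParams M π K δ).H ω)
    (hnoise : ∀ n : ℕ, ∑ t ∈ Finset.range ((n + 1) * (fhParams M π K δ).H),
        X.valueNoise M φ (fhParams M π K δ) t ω
      ≤ (fhParams M π K δ).B * √(((n + 1) * (fhParams M π K δ).H : ℕ)
        * Real.log ((n + 1) * (n + 2) / (fhParams M π K δ).δ))) :
    X.regret M π (fhParams M π K δ).H K ω ≤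
      ((2 * 10 ^ 10 * (√((d : ℝ) ^ 3 * (M.maxValue π).toReal ^ 2
          * (M.maxHittingTime π).toReal * K)
        + (d : ℝ) ^ 3 * (M.maxValue π).toReal * (M.maxHittingTime π).toReal)
        * Real.log (d * (M.maxValue π).toReal * (M.maxHittingTime π).toReal * K / δ) ^ 3 : ℝ) :
          EReal) := by
  have hc := SSP.measurable_policyCost hφ hπ
  have hVT := SSP.maxValue_le_maxHittingTime hπ hc
  have hVtop : M.maxValue π ≠ ⊤ := ne_top_of_le_ne_top hT hVT
  have hτ1 : 1 ≤ (M.maxHittingTime π).toReal := hb1.trans (ENNReal.toReal_mono hT hVT)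
  have hU := fun x => SSP.horizonValue_horizon_le hπ hc hT hτ1 hK (zero_le_one.trans hb1) x
  have htot := SSP.totalValue_le_maxValue (M := M) hπ hc
  have hvle : M.value π M.init ≤ M.maxValue π := le_iSup (M.value π) M.init
  have hv : M.value π M.init ≠ ⊤ := ne_top_of_le_ne_top hVtop hvle
  have hK' : (2 : ℝ) ≤ K := by exact_mod_cast hK
  have hlogK : 0 < Real.log (4 * K) := Real.log_pos (by linarith)
  set p := fhParams M π K δ with hp
  set b := (M.maxValue π).toReal with hb
  set τ := (M.maxHittingTime π).toReal with hτ
  have hH : 0 < p.H := Nat.ceil_pos.mpr (by positivity)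
  have hH1 : (p.H : ℝ) ≤ 4 * τ * Real.log (4 * K) + 1 := (Nat.ceil_lt_add_one (by positivity)).le
  have hpB : p.B = 3 * b := rfl
  have hcf : p.cf = 2 * b := rfl
  have hpδ : p.δ = δ := rfl
  have h0 : 0 ≤ p.cf := by rw [hcf]; linarith
  have h1 : p.cf ≤ p.B := by rw [hcf, hpB]; linarith
  have hcmin : M.cmin ≤ 2 * b := by
    have := M.cost_mem M.init (Classical.arbitrary A)
    linarith [this.1, this.2]
  -- Optimism and the slack `cmin` give an estimate plus `cmin` of at most `b + 2 * b = B`.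
  have hlt : ∀ m j x, valueToGo φ p (X.record M ω) m j x < p.B := by
    intro m j x
    have e1 := hω.ofReal_valueToGo_le hφ hH h0 h1 π m j x
    have e2 := SSP.horizonValue_add_le (M := M) hπ hc (cf := ENNReal.ofReal p.cf)
      (ENNReal.ofReal_le_ofReal hcmin) j x
    have e3 : ENNReal.ofReal (valueToGo φ p (X.record M ω) m j x + M.cmin)
        ≤ ENNReal.ofReal (b + p.cf) := by
      rw [ENNReal.ofReal_add (valueToGo_mem h0 h1 _ m j x).1 M.cmin_pos.le,
        ENNReal.ofReal_add (zero_le_one.trans hb1) h0, hb, ENNReal.ofReal_toReal hVtop]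
      exact (add_le_add e1 le_rfl).trans (e2.trans (add_le_add (htot x) le_rfl))
    have e4 := (ENNReal.ofReal_le_ofReal_iff (by linarith)).mp e3
    have := M.cmin_pos
    linarith
  set u : ℕ → ℝ := fun m => valueToGo φ p (X.record M ω) m p.H (X.state m 0 ω) with hu
  set c : ℕ → ℝ := fun m => ∑ h ∈ Finset.range p.H,
    M.stepCost (X.state m h ω) (X.action m h ω) with hcdef
  have huU : ∀ m, ENNReal.ofReal (u m)
      ≤ M.totalValue π (X.state m 0 ω) + ENNReal.ofReal (b / K) := fun m =>
    (hω.ofReal_valueToGo_le hφ hH h0 h1 π m p.H _).trans (hU _)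
  have hbK : 0 ≤ b / K := by positivity
  have hu1 : ∀ m, u m ≤ 3 / 2 * b := by
    intro m
    have e : ENNReal.ofReal (u m) ≤ ENNReal.ofReal (b + b / K) := by
      rw [ENNReal.ofReal_add (zero_le_one.trans hb1) hbK, hb, ENNReal.ofReal_toReal hVtop]
      exact (huU m).trans (add_le_add (htot _) le_rfl)
    have e2 := (ENNReal.ofReal_le_ofReal_iff (by linarith)).mp e
    have e3 : b / K ≤ b / 2 := by gcongr
    linarith
  have huinit : ∀ m, X.state m 0 ω = some M.init → u m ≤ (M.value π M.init).toReal + b / K := by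
    intro m hm
    have e : ENNReal.ofReal (u m) ≤ ENNReal.ofReal ((M.value π M.init).toReal + b / K) := by
      rw [ENNReal.ofReal_add ENNReal.toReal_nonneg hbK, ENNReal.ofReal_toReal hv]
      refine (huU m).trans (le_of_eq ?_)
      rw [hm, SSP.value_eq hπ hc]
    exact (ENNReal.ofReal_le_ofReal_iff (by positivity)).mp e
  have hunone : ∀ m, X.state m 0 ω = none → u m ≤ 0 := by
    intro m hm
    simp only [hu, hm, valueToGo_none (h0.trans h1), le_refl]
  have hsum : ∀ n, ∑ m ∈ Finset.range (n + 1), (c m + terminalCost p (X.state m p.H ω) - u m)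
      ≤ intervalRegretBound d p n := fun n =>
    hω.sum_interval_le hX hφ (by omega) hH (by linarith) h0 h1 hδ hlt (hnoise n)
  have hlow : ∀ n, b / 2 * (n + 1 : ℕ) - 2 * b * X.episodesDone p.H (n + 1) ω
      ≤ intervalRegretBound d p n := fun n =>
    (Trajectory.mul_le_sum_interval
      (fun m => Finset.sum_nonneg fun h _ => (SSP.stepCost_mem _ _).1) hcf hu1 (n + 1)).trans
      (hsum n)
  have hd' : (2 : ℝ) ≤ d := by exact_mod_cast hd
  have hh0 : (0 : ℝ) < p.H := by exact_mod_cast hH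
  have hm1 : ∀ n : ℕ, (1 : ℝ) ≤ (n + 1 : ℕ) := fun n => by exact_mod_cast Nat.succ_pos n
  have hcount : ∀ n, X.episodesDone p.H (n + 1) ω ≤ K →
      ((n + 1 : ℕ) : ℝ) ≤ 8 * K + 1500000 * (d ^ 3 * p.H
        * Real.log (48 * b * (n + 1 : ℕ) * p.H * d / δ) ^ 2) := by
    intro n hn
    obtain ⟨hX1, hr⟩ := intervalRegretBound_le hd hH hpB hb1 hδ hδ1 n
    refine le_of_le_add_sqrt (by linarith) (by linarith) hh0.le (zero_le_one.trans (hm1 n)) hX1 hr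
      (le_trans ?_ (hlow n))
    have : (X.episodesDone p.H (n + 1) ω : ℝ) ≤ K := by exact_mod_cast hn
    gcongr
  have hlog := fun n hn => log_le_of_le_add_log hd' hb1 hτ1 hK' hδ hδ1 hh0 hH1 (hm1 n)
    (intervalRegretBound_le hd hH hpB hb1 hδ hδ1 n).1 (hcount n hn)
  -- If fewer than `K` episodes were ever completed, the bound on the number of intervals would hold
  -- for every `n`.
  have hex : ∃ m, K ≤ X.episodesDone p.H m ω := by
    by_contra! hne
    obtain ⟨n, hn⟩ := exists_nat_gt (144 * 10 ^ 18 * (d * b * τ * K / δ) ^ 10)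
    have := (hlog n (hne (n + 1)).le).1
    push_cast at this
    linarith
  obtain ⟨n, hlast, hE⟩ := Trajectory.exists_last_interval (by omega) hex
  obtain ⟨hX1, hr⟩ := intervalRegretBound_le hd hH hpB hb1 hδ hδ1 n
  have hfinal := add_regret_le hd' hb1 hτ1 hK' hδ hδ1 hh0 hH1 hX1 (hlog n hE.le).2
    (hcount n hE.le) hr
  have hcredit := hX.sum_sub_terminalCost_le (by omega) (b := (M.value π M.init).toReal + b / K)
    (u := u) h0 (by positivity) (fun m => by rw [hcf]; linarith [hu1 m]) huinit hunone n
  refine (hX.regret_le habs hE.ge hlast hv (D := b + intervalRegretBound d p n) ?_).trans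
    (EReal.coe_le_coe_iff.mpr hfinal)
  -- The cost is the interval regret plus initial estimates minus terminal costs; the latter
  -- difference was bounded by crediting terminal costs.
  have hsplit : ∑ m ∈ Finset.range (n + 1), c m
      = ∑ m ∈ Finset.range (n + 1), (c m + terminalCost p (X.state m p.H ω) - u m)
        + ∑ m ∈ Finset.range (n + 1), (u m - terminalCost p (X.state m p.H ω)) := by
    rw [← Finset.sum_add_distrib]
    exact Finset.sum_congr rfl fun m _ => by ring
  have hKb : (K : ℝ) * ((M.value π M.init).toReal + b / K)
      = K * (M.value π M.init).toReal + b := by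
    field_simp
  change ∑ m ∈ Finset.range (n + 1), c m ≤ _
  linarith [hsum n]

variable [IsProbabilityMeasure P]

/-- The regret bound holds with high probability. -/
theorem le_measure_regret_le (hX : IsRun M φ (fhParams M π K δ) K P ℱ X) (hφ : M.IsLinear φ)
    (hd : 2 ≤ d) (hπ : Measurable π) (hT : M.maxHittingTime π ≠ ⊤) (hV : 1 < M.maxValue π)
    (hK : 2 ≤ K) (hδ : 0 < δ) (hδ1 : δ < 1) :
    ENNReal.ofReal (1 - 2 * δ) ≤ P {ω | X.regret M π (fhParams M π K δ).H K ω ≤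
      ((2 * 10 ^ 10 * (√((d : ℝ) ^ 3 * (M.maxValue π).toReal ^ 2
          * (M.maxHittingTime π).toReal * K)
        + (d : ℝ) ^ 3 * (M.maxValue π).toReal * (M.maxHittingTime π).toReal)
        * Real.log (d * (M.maxValue π).toReal * (M.maxHittingTime π).toReal * K / δ) ^ 3 : ℝ) :
          EReal)} := by
  have hc := SSP.measurable_policyCost hφ hπ
  have hVT := SSP.maxValue_le_maxHittingTime hπ hc
  have hVtop : M.maxValue π ≠ ⊤ := ne_top_of_le_ne_top hT hVT
  have hb1 : 1 < (M.maxValue π).toReal := by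
    simpa using (ENNReal.toReal_lt_toReal ENNReal.one_ne_top hVtop).mpr hV
  have hτ1 : 1 < (M.maxHittingTime π).toReal := hb1.trans_le (ENNReal.toReal_mono hT hVT)
  have hK' : (2 : ℝ) ≤ K := by exact_mod_cast hK
  have hlogK : 0 < Real.log (4 * K) := Real.log_pos (by linarith)
  set p := fhParams M π K δ with hp
  have hH : 0 < p.H := Nat.ceil_pos.mpr (by positivity)
  have hpB : p.B = 3 * (M.maxValue π).toReal := rfl
  have hcf : p.cf = 2 * (M.maxValue π).toReal := rfl
  have h0 : 0 ≤ p.cf := by rw [hcf]; linarith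
  have h1 : p.cf ≤ p.B := by rw [hcf, hpB]; linarith
  have hconf := hX.measure_not_confident_le hφ hd hH (by linarith) h0 h1 hδ hδ1
  have hnoise := hX.measure_valueNoise_le hφ hH (by linarith) h0 h1 hδ hδ1
  have habs : P {ω | ¬X.Absorbed p.H ω} = 0 := hX.ae_absorbed hH
  set E := {ω | X.regret M π p.H K ω ≤ _}
  set F := {ω | ∃ m : ℕ, p.B * √(((m + 1) * p.H : ℕ) * Real.log ((m + 1) * (m + 2) / p.δ))
      ≤ ∑ t ∈ Finset.range ((m + 1) * p.H), X.valueNoise M φ p t ω} with hF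
  have hcover : (Set.univ : Set Ω)
      ⊆ E ∪ ({ω | ¬X.Confident M φ p ω} ∪ (F ∪ {ω | ¬X.Absorbed p.H ω})) := by
    intro ω _
    by_cases e1 : X.Confident M φ p ω
    · by_cases e2 : ω ∈ F
      · exact Or.inr (Or.inr (Or.inl e2))
      · by_cases e3 : X.Absorbed p.H ω
        · refine Or.inl (hX.regret_le_of_confident hφ hd hπ hT hb1.le hK hδ hδ1 e1 e3 fun n => ?_)
          simp only [hF, Set.mem_ofPred_eq, not_exists, not_le] at e2
          exact (e2 n).le
        · exact Or.inr (Or.inr (Or.inr e3))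
    · exact Or.inr (Or.inl e1)
  have h2 : (1 : ENNReal) ≤ P E + ENNReal.ofReal (2 * δ) := by
    calc (1 : ENNReal) = P Set.univ := measure_univ.symm
      _ ≤ P E + (P {ω | ¬X.Confident M φ p ω} + (P F + P {ω | ¬X.Absorbed p.H ω})) := by
        refine (measure_mono hcover).trans ((measure_union_le _ _).trans ?_)
        gcongr
        refine (measure_union_le _ _).trans ?_
        gcongr
        exact measure_union_le _ _
      _ ≤ P E + (ENNReal.ofReal δ + (ENNReal.ofReal δ + 0)) := by
        rw [habs]
        gcongr
        · exact hconf
        · exact hnoise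
      _ = P E + ENNReal.ofReal (2 * δ) := by
        rw [add_zero, ← ENNReal.ofReal_add hδ.le hδ.le, two_mul]
  rw [ENNReal.ofReal_sub _ (by linarith), ENNReal.ofReal_one]
  exact tsub_le_iff_right.mpr h2

end IsRun

end

theorem mainTheorem1 :
    (∃ (C : ℝ) (q : ℕ), 0 < C ∧
      ∀ (S : Type u) (A : Type v) (Ω : Type w) [MeasurableSpace S] [MeasurableSpace A]
        [MeasurableSingletonClass A] [Fintype A] [Nonempty A] [mΩ : MeasurableSpace Ω]
        (P : Measure Ω) [IsProbabilityMeasure P] (ℱ : Filtration ℕ mΩ)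
        (M : SSP S A) (d : ℕ) (φ : S → A → EuclideanSpace ℝ (Fin d)) (π : S → A)
        (K : ℕ) (δ : ℝ) (X : Trajectory S A Ω),
        2 ≤ d → M.IsLinear φ → M.IsOptimalProper π → M.maxHittingTime π ≠ ⊤ →
        1 < M.maxValue π → 2 ≤ K → 0 < δ → δ < 1 →
        IsRun M φ (fhParams M π K δ) K P ℱ X →
        ENNReal.ofReal (1 - 2 * δ) ≤
          P {ω | X.regret M π (fhParams M π K δ).H K ω ≤
            ((C * (√((d : ℝ) ^ 3 * (M.maxValue π).toReal ^ 2 * (M.maxHittingTime π).toReal * K)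
                + (d : ℝ) ^ 3 * (M.maxValue π).toReal * (M.maxHittingTime π).toReal)
              * Real.log (d * (M.maxValue π).toReal * (M.maxHittingTime π).toReal * K / δ) ^ q :
                ℝ) : EReal)}) ∧
    (∃ C q : ℕ,
      ∀ (S : Type u) (A : Type v) [Fintype A] [Nonempty A] (d : ℕ)
        (φ : S → A → EuclideanSpace ℝ (Fin d)) (p : FHParams) (m h : ℕ), 1 ≤ d → h < p.H →
        ∃ (n : ℕ) (R : Set (Record S A → ℝ)),
          StraightLine (observations φ p.H m h) n R ∧
          n ≤ C * (d * Fintype.card A * p.H * (m + 1)) ^ q ∧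
          ∀ a, (fun r : Record S A => FHSSP.Q φ p r m h (r.state m h) a) ∈ R) := by
  refine ⟨⟨2 * 10 ^ 10, 3, by norm_num, ?_⟩, 100, 6, ?_⟩
  · intro S A Ω _ _ _ _ _ _ P _ ℱ M d φ π K δ X hd hφ hπ hT hV hK hδ hδ1 hX
    exact hX.le_measure_regret_le hφ hd hπ.1.1 hT hV hK hδ hδ1
  · intro S A _ _ d φ p m h hd hh
    exact FHSSP.exists_straightLine φ p m h hd hh
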